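/- **Setting.** Let $(W,S)$ be a Coxeter system with $S$ finite, let $\ell$ be its length function and $m(s,t)$ the order of $st$. Let $*$ be an automorphism of $W$ with $*^2=1$ and $S^*=S$ (possibly $*=\mathrm{id}$). Let $\circ$ be the associative operation on $W$ with $s\circ s=s$ for $s\in S$ and $v\circ w=vw$ whenever $\ell(vw)=\ell(v)+\ell(w)$. Put $\mathcal I_*=\{w\in W: w^*=w^{-1}\}$. A *word* is a finite sequence in $S$. For $w\in\mathcal I_*$ let $\hat{\mathcal R}_*(w)$ be the set of words $(s_1,\dots,s_n)$ of minimal length with $w=s_n^*\circ\cdots\circ s_1^*\circ s_1\circ\cdots\circ s_n$. Elements of these sets are *involution words*. **Relations.** Write $(\mathbf u,-)\sim(\mathbf v,-)$ for the symmetric relation on words that exchanges the initial segments $\mathbf u,\mathbf v$ and keeps an arbitrary continuation. The *braid relations* $\mathscr B$ are the relations $(-,s,t,s,\dots,-)\sim(-,t,s,t,\dots,-)$ with $m(s,t)<\infty$ alternating terms and arbitrary identical surroundings. The *half-braid relations* are the relations $(s,t,s,\dots,-)\sim(t,s,t,\dots,-)$ with $m$ alternating terms, $1\le m<m(s,t)$,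 such that both $m$-letter words lie in $\hat{\mathcal R}_*(z)$ for one $z\in\mathcal I_*$. Let $\hat{\mathscr B}$ be the union of $\mathscr B$ and the half-braid relations. For a set $X$ of word relations and a word relation $\sim$, write $X\Rightarrow{\sim}$ if there are $\sim_1,\dots,\sim_n$ in $X$ such that whenever involution words satisfy $\mathbf a\sim\mathbf b$, there are involution words with $\mathbf a=\mathbf a_0\sim_1\mathbf a_1\sim_2\cdots\sim_n\mathbf a_n=\mathbf b$. Write $X\Rightarrow Y$ if $X\Rightarrow{\sim}$ for all ${\sim}\in Y$. For a map $\theta$ on $\{s,t\}$ with $m=m(s,t)<\infty$ let $m_\theta(s,t)$ be $\frac{m+1}2$ if $m$ is odd and $\theta(\{s,t\})=\{s,t\}$; $\frac m2+1$ if $m$ is even and $\theta$ fixes $s$ and $t$; $\frac m2$ if $m$ is even and $\theta$ swaps $s$ and $t$; and $m$ otherwise. If $m(s,t)=\infty$, let $m_\theta(s,t)=\infty$. **Braid systems.** Let $V$ be the geometric representation, with basis $(\alpha_s)_{s\in S}$, form $(\alpha_s,\alpha_t)=-\cos(\pi/m(s,t))$ and action $sv=v-2(\alpha_s,v)\alpha_s$.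 Let $V_J=\mathbb R\text{-span}\{\alpha_s:s\in J\}$ and $\mathbb R[S]=\mathbb R[x_s:s\in S]$, and extend the action and the form to $V\otimes\mathbb R[S]$. For $v\in V$ write $v>0$ (resp. $v<0$) if $v\ne0$ has nonnegative (resp. nonpositive) coefficients in the basis of simple roots. For vectors with polynomial coefficients, $\ge0$ and $\le0$ as constraints are meant coefficientwise. A *braid system* $\mathcal B=(\{\mathbf s,\mathbf t\},\sigma,C)$ with domain $J\subset S$ consists of two words of equal length, an $\mathbb R$-linear map $\sigma:V_J\to V\otimes\mathbb R[S]$, and a set $C$ of equalities and inequalities between elements of $\mathbb R[S]$. It is *constant* if $\sigma V_J\subset V$ and $C=\varnothing$. A *solution* is a ring homomorphism $\psi:\mathbb R[S]\to\mathbb R$ that makes all constraints true and for which each $(1\otimes\psi)\sigma\alpha_s$, $s\in J$, is $>0$ or $<0$. The system is *valid* if both words are reduced and it has a solution. A *$\sigma$-relation* is $(r,s,r,\dots,u,-)\sim(s,r,s,\dots,u,-)$ with $m_\theta(r,s)$ alternating terms before $u$, where $r,s,u\in J$, $\theta$ is a bijection of $\{r,s\}$ with $\sigma\alpha_r=\alpha_{\theta(r)^*}$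 and $\sigma\alpha_s=\alpha_{\theta(s)^*}$, and $m_\theta(r,s)<m(r,s)<\infty$. The system is *redundant* if the classes of $\mathbf s$ and $\mathbf t$ under the equivalence generated by $\mathscr B$ and the $\sigma$-relations contain words with last letters $s'$ and $t'$, respectively, such that $s'=t'$ or $m(s,t)<m(s',t')<\infty$, where $s,t$ are the last letters of $\mathbf s,\mathbf t$. Put $\mathrm{Des}(\mathcal B)=\{s\in J:\sigma\alpha_s\in V,\ \sigma\alpha_s<0\}$ and $\partial J=\{s\in S\setminus J: m(s,t)>2\text{ for some }t\in J\}$. Operations: - For $\mathcal B$ constant and $r\in\partial J$, $\mathcal B\downarrow r$ has the same words and domain $J\cup\{r\}$. Its map $\sigma'$ extends $\sigma$ by $\sigma'\alpha_r=-\sum_{s\in S}x_s\alpha_s$. Its constraints are $x_s\ge0$ for $s\in S$, $(\sigma'\alpha_r,\sigma'\alpha_s)=(\alpha_r,\alpha_s)$ for $s\in J$, and $|\det\sigma'|=1$ if $J\cup\{r\}=S$. - For $r\in J$, $r\bullet_{\rm asc}\mathcal B$ adds the constraints $\sigma\alpha_r\ge0$. - For $r\in J$, $r\bullet_{\rm des}\mathcal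 B$ prepends $r$ to both words, replaces $\sigma$ by $r^*\sigma$, and adds $\sigma\alpha_r=-\alpha_{r^*}$. - For $r\in J$, $r\,\hat\bullet_{\rm des}\mathcal B$ prepends $r$ to both words, replaces $\sigma$ by $r^*\sigma r|_{V_J}$, and adds $-\alpha_{r^*}\ne\sigma\alpha_r\le0$. - For a solution $\psi$, $\mathcal B[\psi]$ is the constant system with the same words and with map $(1\otimes\psi)\circ\sigma$. Algorithms 1 and 2 use a total order on $S$. **Algorithm 1.** Given a constant $\mathcal B_0$ with domain $K$ and $r\in\partial K$, it builds the tree $\mathscr T(\mathcal B_0\downarrow r)$ with root $\mathcal B_0\downarrow r$. The children of a vertex $\mathcal B=(\{\mathbf s,\mathbf t\},\sigma,C)$ with domain $J$ are as follows. If $\mathcal B$ is constant, invalid or redundant, there are none. Otherwise, if $\mathcal B$ has finitely many solutions, they are the systems $\mathcal B[\psi]$ for the solutions $\psi$. Otherwise write $\sigma\alpha_s=\sum_t\sigma_{st}\alpha_t$, and call $s\in J$ an unconditional (resp. conditional) descent if for some $t\in S$ no ring homomorphism $\mathbb R[S]\to\mathbb R$ satisfies $C\cup\{\sigma_{st}\ge0\}$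 (resp. $C\cup\{\sigma_{st}>0\}$). If unconditional descents exist, let $s$ be the least one; the children are $s\bullet_{\rm des}\mathcal B$ and $s\,\hat\bullet_{\rm des}\mathcal B$. If not, but conditional descents exist, let $s$ be the least one; the children are $s\bullet_{\rm asc}\mathcal B$, $s\bullet_{\rm des}\mathcal B$ and $s\,\hat\bullet_{\rm des}\mathcal B$. If neither exists, $\mathcal B$ is its own child, so the tree is infinite. **Algorithm 2.** Given a constant $\mathcal B$ with domain $J$, set $\mathcal B_0=\mathcal B$ and run the following loop for $i=0,1,2,\dots$. If $\mathcal B_i=(\{\mathbf s_i,\mathbf t_i\},\sigma_i,\varnothing)$ is invalid, redundant or descent-periodic, stop without output. Otherwise, if $\mathrm{Des}(\mathcal B_i)=\varnothing$, stop with output $\mathcal B_i$. Otherwise let $r$ be the least element of $\mathrm{Des}(\mathcal B_i)$, and let $\mathcal B_{i+1}$ be $r\bullet_{\rm des}\mathcal B_i$ if $\sigma_i\alpha_r=-\alpha_{r^*}$ and $r\,\hat\bullet_{\rm des}\mathcal B_i$ otherwise, without the added constraints (which hold). Here $\mathcal B_i$ is *descent-periodic* if there are $p\ge1$, $q\ge2$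 with $pq\le i$ and $r_1,\dots,r_p$ in $J$ (put $r_{p+1}=r_1$) such that: - (i) $\mathbf s_i$ and $\mathbf t_i$ both begin with $(r_p,\dots,r_1)$ repeated $q$ times. - (ii) Let $\lambda_j(n):V_J\to V$, for $1\le j\le p$, be the maps whose matrix entries are the polynomials in $n$ of degree $<q$ with $\lambda_j(n)=\sigma_{i-pq+j+np}$ for $0\le n<q$. Then for each $j$, with $\beta=r_{j+1}$, one has $\lambda_j(n)\alpha_{\beta}<0$ for all $n\in\mathbb N$, and $\lambda_j(n)\alpha_{\beta}=-\alpha_{\beta^*}$ holds for all $n\in\mathbb N$ or for none. - (iii) For all $n\in\mathbb N$, $\lambda_1(n+1)=\lambda_p(n)\bullet r_1$, and $\lambda_j(n+1)=\lambda_{j-1}(n+1)\bullet r_j$ for $2\le j\le p$. Here $\lambda\bullet r$ is $r^*\lambda$ if $\lambda\alpha_r=-\alpha_{r^*}$, and $r^*\lambda r|_{V_J}$ otherwise. **Algorithm 3.** Given distinct $s,t\in S$, it builds the forest $\mathscr F_{s,t}$. The roots are the constant systems $\mathcal B_{s,t}^\theta$, for the two bijections $\theta$ of $\{s,t\}$,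 with words $(\dots,s,t,s)$ and $(\dots,t,s,t)$ of length $m_\theta(s,t)$, domain $\{s,t\}$, and $\sigma\alpha_s=\alpha_{\theta(s)^*}$, $\sigma\alpha_t=\alpha_{\theta(t)^*}$. The children of a vertex $\mathcal B$ with domain $J$ are all outputs of Algorithm 2 applied to the constant leaves of the trees $\mathscr T(\mathcal B\downarrow r)$, $r\in\partial J$. The algorithm *succeeds* if all trees it builds are finite and all its runs of Algorithm 2 terminate. **Induced relations.** A braid system with words $\mathbf s,\mathbf t$ is *trivial* if both words lie in $\hat{\mathcal R}_*(z)$ for one $z\in\mathcal I_*$ and $\sigma$ is the identity on its domain. Let $\mathscr R_{s,t}$ be the set of relations $(\mathbf s,-)\sim(\mathbf t,-)$ given by the trivial vertices of $\mathscr F_{s,t}$. **Theorem.** For each pair $s,t\in S$ with $2<m(s,t)<\infty$ choose, independently, a total order on $S$, and suppose that Algorithm 3, run with this order, succeeds on the input $s,t$. Let $\mathscr R$ be the union of all these $\mathscr R_{s,t}$, and let $\mathscr R_{\min}$ be any minimal subset of $\mathscr R$ with $\hat{\mathscr B}\cup\mathscr R_{\min}\Rightarrow\mathscr R$. Then for each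 $w\in\mathcal I_*$ the set $\hat{\mathcal R}_*(w)$ is an equivalence class under the equivalence relation on words generated by $\hat{\mathscr B}\cup\mathscr R_{\min}$. -/

import Mathlib

/-! ### Words and word relations -/

/-- The alternating word `(i, j, i, j, …)` with `n` letters, starting with `i`. -/
def altWord {B : Type*} : B → B → ℕ → List B
  | _, _, 0 => []
  | i, j, n + 1 => i :: altWord j i n

/-- Word relations: relations on finite sequences of simple generators. -/
abbrev WordRel (B : Type*) := List B → List B → Prop

/-- The symmetric word relation `(u, ---) ∼ (v, ---)`: exchange the initial segments `u` and `v`,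
keeping an arbitrary common continuation. -/
def prefixRel {B : Type*} (u v : List B) : WordRel B := fun a b =>
  ∃ c : List B, (a = u ++ c ∧ b = v ++ c) ∨ (a = v ++ c ∧ b = u ++ c)

/-- The symmetric word relation `(---, u, ---) ∼ (---, v, ---)`. -/
def infixRel {B : Type*} (u v : List B) : WordRel B := fun a b =>
  ∃ d c : List B, (a = d ++ u ++ c ∧ b = d ++ v ++ c) ∨ (a = d ++ v ++ c ∧ b = d ++ u ++ c)

/-- The equivalence relation on words generated by a set of word relations. -/
def generatedEquiv {B : Type*} (X : Set (WordRel B)) : WordRel B :=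
  Relation.EqvGen fun a b => ∃ R ∈ X, R a b

/-- The braid relations `(---, s, t, s, …, ---) ∼ (---, t, s, t, …, ---)`, with `m(s,t)` terms, one
for all `s, t` with `m(s,t) < ∞`. (The value `0` of a Coxeter matrix stands for `∞`.) -/
def braidRelations {B : Type*} (M : CoxeterMatrix B) : Set (WordRel B) :=
  {R | ∃ s t : B, M s t ≠ 0 ∧ R = infixRel (altWord s t (M s t)) (altWord t s (M s t))}

open Classical in
/-- The number `m_θ(s,t)`; only the values of `θ` at `s` and `t` matter. The value `0` stands
for `∞`, as in a Coxeter matrix. -/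
noncomputable def mTheta {B : Type*} (M : CoxeterMatrix B) (θ : B → B) (s t : B) : ℕ :=
  if M s t = 0 then 0
  else if Odd (M s t) ∧ θ '' {s, t} = {s, t} then (M s t + 1) / 2
  else if Even (M s t) ∧ θ s = s ∧ θ t = t then M s t / 2 + 1
  else if Even (M s t) ∧ θ s = t ∧ θ t = s then M s t / 2
  else M s t

/-! ### The geometric representation, with coefficients extended to a commutative `ℝ`-algebra -/

section Geometric

variable {B : Type*} (A : Type*) [CommRing A] [Algebra ℝ A]

open Classical in
/-- The simple root `α_s`, in the free module with basis indexed by the generators. -/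
noncomputable def simpleRoot (s : B) : B → A := fun t => if t = s then 1 else 0

/-- The number `(α_s, α_t) = -cos(π / m(s,t))`. If `m(s,t) = ∞`, that is `M s t = 0`, this
is `-cos 0 = -1`. -/
noncomputable def rootForm (M : CoxeterMatrix B) (s t : B) : ℝ :=
  -Real.cos (Real.pi / (M s t : ℝ))

variable {A}

/-- The `A`-bilinear extension of the form `(·,·)`. -/
noncomputable def extForm [Fintype B] (M : CoxeterMatrix B) (u v : B → A) : A :=
  ∑ s, ∑ t, algebraMap ℝ A (rootForm M s t) * u s * v t

/-- The action of the simple generator `s`, namely `v ↦ v - 2 (α_s, v) α_s`. -/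
noncomputable def reflect [Fintype B] (M : CoxeterMatrix B) (s : B) (v : B → A) : B → A :=
  v - (2 * extForm M (simpleRoot A s) v) • simpleRoot A s

end Geometric

/-- `v > 0`: a nonzero combination of simple roots with nonnegative coefficients. -/
def IsPosVec {B : Type*} (v : B → ℝ) : Prop := v ≠ 0 ∧ ∀ t, 0 ≤ v t

/-- `v < 0`: a nonzero combination of simple roots with nonpositive coefficients. -/
def IsNegVec {B : Type*} (v : B → ℝ) : Prop := v ≠ 0 ∧ ∀ t, v t ≤ 0

/-! ### Braid systems -/

/-- Equalities and inequalities involving elements of the polynomial ring `ℝ[S]`. -/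
inductive PolyConstraint (B : Type*) where
  /-- `p = q` -/
  | eq (p q : MvPolynomial B ℝ)
  /-- `p ≤ q` -/
  | le (p q : MvPolynomial B ℝ)
  /-- `|p| = q` -/
  | absEq (p q : MvPolynomial B ℝ)
  /-- `u ≠ v`, for vectors with polynomial coefficients -/
  | vecNe (u v : B → MvPolynomial B ℝ)

/-- A ring homomorphism `ℝ[S] → ℝ` transforms the constraint to a true statement. -/
def PolyConstraint.Holds {B : Type*} (ψ : MvPolynomial B ℝ →+* ℝ) : PolyConstraint B → Prop
  | .eq p q => ψ p = ψ q
  | .le p q => ψ p ≤ ψ q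
  | .absEq p q => |ψ p| = ψ q
  | .vecNe u v => (fun t => ψ (u t)) ≠ fun t => ψ (v t)

/-- A braid system with domain `J`: two words of the same length, a linear map `σ` from
`V_J = ℝ-span {α_s : s ∈ J}` to `V ⊗ ℝ[S]`, given by the images `σ α_s` of the basis vectors, and a
set of constraints. `σ s t` is the coefficient of `α_t` in `σ α_s`. -/
structure BraidSystem (B : Type*) (J : Set B) where
  word₁ : List B
  word₂ : List B
  length_eq : word₁.length = word₂.length
  σ : J → B → MvPolynomial B ℝ
  constraints : Set (PolyConstraint B)

/-- The boundary `∂J`: the `s ∈ S - J` with `m(s,t) > 2` for some `t ∈ J`. -/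
def coxBoundary {B : Type*} (M : CoxeterMatrix B) (J : Set B) : Set B :=
  {s | s ∉ J ∧ ∃ t ∈ J, M s t = 0 ∨ 2 < M s t}

namespace BraidSystem

variable {B : Type*} {J : Set B}

/-- The system is constant: `σ V_J ⊆ V` and there are no constraints. -/
def IsConstant (S : BraidSystem B J) : Prop :=
  (∀ s t, ∃ c : ℝ, S.σ s t = MvPolynomial.C c) ∧ S.constraints = ∅

/-- `ψ` satisfies all constraints of the system. -/
def Feasible (S : BraidSystem B J) (ψ : MvPolynomial B ℝ →+* ℝ) : Prop :=
  ∀ c ∈ S.constraints, c.Holds ψ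

/-- The solutions: the ring homomorphisms `ψ : ℝ[S] → ℝ` which satisfy all constraints and for
which `(1 ⊗ ψ) ∘ σ : V_J → V` is root-preserving. -/
def solutions (S : BraidSystem B J) : Set (MvPolynomial B ℝ →+* ℝ) :=
  {ψ | S.Feasible ψ ∧ ∀ s : J, IsPosVec (fun t => ψ (S.σ s t)) ∨ IsNegVec (fun t => ψ (S.σ s t))}

/-- The descent set: the `s ∈ J` with `σ α_s ∈ V` and `σ α_s < 0`. -/
def descents (S : BraidSystem B J) : Set J :=
  {s | ∃ v : B → ℝ, (∀ t, S.σ s t = MvPolynomial.C (v t)) ∧ IsNegVec v}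

/-- `s ∈ J` is an unconditional descent: for some `t`, adding `σ_{st} ≥ 0` to the constraints
makes them infeasible. -/
def IsUncondDescent (S : BraidSystem B J) (s : J) : Prop :=
  ∃ t : B, ¬ ∃ ψ, S.Feasible ψ ∧ 0 ≤ ψ (S.σ s t)

/-- `s ∈ J` is a conditional descent: for some `t`, adding `σ_{st} > 0` to the constraints
makes them infeasible. -/
def IsCondDescent (S : BraidSystem B J) (s : J) : Prop :=
  ∃ t : B, ¬ ∃ ψ, S.Feasible ψ ∧ 0 < ψ (S.σ s t)

/-- The system `S[ψ]` for a solution `ψ` of `S`. Every constraint becomes a true statement on real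
numbers and is omitted. -/
noncomputable def subst (S : BraidSystem B J) (ψ : MvPolynomial B ℝ →+* ℝ) : BraidSystem B J where
  word₁ := S.word₁
  word₂ := S.word₂
  length_eq := S.length_eq
  σ := fun s t => MvPolynomial.C (ψ (S.σ s t))
  constraints := ∅

/-- The operation `r •_asc S`, which adds the constraint `σ α_r ≥ 0`. -/
def asc (S : BraidSystem B J) (r : J) : BraidSystem B J where
  word₁ := S.word₁
  word₂ := S.word₂
  length_eq := S.length_eq
  σ := S.σ
  constraints := S.constraints ∪ {c | ∃ t : B, c = .le 0 (S.σ r t)}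

/-- The same system without its constraints. -/
def dropConstraints (S : BraidSystem B J) : BraidSystem B J := { S with constraints := ∅ }

/-- `r` is the least element of `D` in the total order `o` of the generators. -/
def IsLeastGen (o : LinearOrder B) (D : Set J) (r : J) : Prop :=
  r ∈ D ∧ ∀ r' ∈ D, o.le (r : B) (r' : B)

end BraidSystem

/-! ### Twisted Coxeter systems -/

/-- An involution `*` of `W` (possibly the identity) which is a group automorphism and preserves
the set of simple generators; `gen` is its effect on the labels of the generators. -/
structure CoxeterTwist {B W : Type*} [Group W] {M : CoxeterMatrix B}
    (cs : CoxeterSystem M W) where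
  toMulEquiv : W ≃* W
  gen : B → B
  involutive : ∀ w, toMulEquiv (toMulEquiv w) = w
  map_simple : ∀ s, toMulEquiv (cs.simple s) = cs.simple (gen s)

namespace CoxeterTwist

variable {B W : Type*} [Group W] {M : CoxeterMatrix B} {cs : CoxeterSystem M W}

open Classical in
/-- The product `s₁ ∘ s₂ ∘ ⋯ ∘ sₙ` for the associative operation `∘` on `W` with `s ∘ s = s` and
`v ∘ w = vw` if `ℓ(vw) = ℓ(v) + ℓ(w)`. These rules give `w ∘ s = ws` if `ℓ(ws) > ℓ(w)` and
`w ∘ s = w` otherwise. -/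
noncomputable def demazureProd (cs : CoxeterSystem M W) (ω : List B) : W :=
  ω.foldl (fun w s => if cs.IsRightDescent w s then w else w * cs.simple s) 1

/-- The element `sₙ^* ∘ ⋯ ∘ s₁^* ∘ s₁ ∘ ⋯ ∘ sₙ`. -/
noncomputable def involutionProd (τ : CoxeterTwist cs) (ω : List B) : W :=
  demazureProd cs ((ω.map τ.gen).reverse ++ ω)

/-- The set of twisted involutions: the `w` with `w^* = w⁻¹`. -/
def twistedInvolutions (τ : CoxeterTwist cs) : Set W := {w | τ.toMulEquiv w = w⁻¹}

/-- The set of involution words of `w`: the words `(s₁, …, sₙ)` of minimal length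
with `w = sₙ^* ∘ ⋯ ∘ s₁^* ∘ s₁ ∘ ⋯ ∘ sₙ`. -/
def involutionWords (τ : CoxeterTwist cs) (w : W) : Set (List B) :=
  {ω | τ.involutionProd ω = w ∧ ∀ ω', τ.involutionProd ω' = w → ω.length ≤ ω'.length}

/-- The word is an involution word of some twisted involution. -/
def IsInvolutionWord (τ : CoxeterTwist cs) (ω : List B) : Prop :=
  ∃ w ∈ τ.twistedInvolutions, ω ∈ τ.involutionWords w

/-- The half-braid relations `(s, t, s, …, ---) ∼ (t, s, t, …, ---)` with `m < m(s,t)` terms, where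
both `m`-letter words are involution words of the same twisted involution. -/
def halfBraidRelations (τ : CoxeterTwist cs) : Set (WordRel B) :=
  {R | ∃ (s t : B) (m : ℕ), 1 ≤ m ∧ m < M s t ∧
    (∃ z ∈ τ.twistedInvolutions,
      altWord s t m ∈ τ.involutionWords z ∧ altWord t s m ∈ τ.involutionWords z) ∧
    R = prefixRel (altWord s t m) (altWord t s m)}

/-- The braid relations together with the half-braid relations. -/
def braidAndHalfBraid (τ : CoxeterTwist cs) : Set (WordRel B) :=
  braidRelations M ∪ τ.halfBraidRelations

/-- There are involution words `a = a₀, a₁, …, aₙ = b` with `a₀ ∼₁ a₁ ∼₂ ⋯ ∼ₙ aₙ`, for the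
given list of relations `∼₁, …, ∼ₙ`. -/
def Connects (τ : CoxeterTwist cs) : List (WordRel B) → List B → List B → Prop
  | [], a, b => a = b
  | R :: L, a, b => ∃ c, τ.IsInvolutionWord c ∧ R a c ∧ Connects τ L c b

/-- `X ⇒ ∼` for a single word relation `∼`. -/
def ImpliesRel (τ : CoxeterTwist cs) (X : Set (WordRel B)) (R : WordRel B) : Prop :=
  ∃ L : List (WordRel B), (∀ Q ∈ L, Q ∈ X) ∧
    ∀ a b, τ.IsInvolutionWord a → τ.IsInvolutionWord b → R a b → τ.Connects L a b

/-- `X ⇒ Y` for sets of word relations. -/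
def Implies (τ : CoxeterTwist cs) (X Y : Set (WordRel B)) : Prop :=
  ∀ R ∈ Y, τ.ImpliesRel X R

variable {J : Set B}

/-- One step of a `σ`-relation
`(r, s, r, …, t, ---) ∼ (s, r, s, …, t, ---)`, with `m_θ(r,s)` alternating terms before `t`, where
`r, s, t ∈ J`, `θ` is a bijection of `{r, s}` with `σ α_r = α_{θ(r)^*}` and `σ α_s = α_{θ(s)^*}`,
and `m_θ(r,s) < m(r,s) < ∞`. -/
def SigmaStep (τ : CoxeterTwist cs) (σ : J → B → MvPolynomial B ℝ) (a b : List B) : Prop :=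
  ∃ (r s t : J) (θ : B → B) (c : List B),
    Set.BijOn θ {(r : B), (s : B)} {(r : B), (s : B)} ∧
    σ r = simpleRoot _ (τ.gen (θ r)) ∧ σ s = simpleRoot _ (τ.gen (θ s)) ∧
    mTheta M θ r s < M r s ∧
    a = altWord (r : B) s (mTheta M θ r s) ++ (t : B) :: c ∧
    b = altWord (s : B) r (mTheta M θ r s) ++ (t : B) :: c

/-- The `σ`-equivalence of words, generated by the braid relations and the `σ`-relations. -/
def SigmaEquiv (τ : CoxeterTwist cs) (σ : J → B → MvPolynomial B ℝ) : WordRel B :=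
  Relation.EqvGen fun a b => (∃ R ∈ braidRelations M, R a b) ∨ τ.SigmaStep σ a b

/-- A braid system is redundant if the `σ`-equivalence classes of its two words contain words with
right-most letters `s'` and `t'` such that `s' = t'` or `m(s,t) < m(s',t') < ∞`, where `s` and `t`
are the right-most letters of the words of the system. -/
def Redundant (τ : CoxeterTwist cs) (S : BraidSystem B J) : Prop :=
  ∃ (a b : List B) (s t s' t' : B),
    S.word₁.getLast? = some s ∧ S.word₂.getLast? = some t ∧
    τ.SigmaEquiv S.σ S.word₁ a ∧ τ.SigmaEquiv S.σ S.word₂ b ∧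
    a.getLast? = some s' ∧ b.getLast? = some t' ∧
    (s' = t' ∨ (M s t ≠ 0 ∧ M s t < M s' t'))

/-- A braid system is valid if its words are reduced and it has a solution. -/
def Valid (_τ : CoxeterTwist cs) (S : BraidSystem B J) : Prop :=
  cs.IsReduced S.word₁ ∧ cs.IsReduced S.word₂ ∧ S.solutions.Nonempty

variable [Fintype B]

open Classical in
/-- The map `σ'` of `S ↓ r`: it extends `σ` by `σ' α_r = -∑ₛ xₛ αₛ`. -/
noncomputable def extendSigma (S : BraidSystem B J) (r : B) :
    ↥(insert r J : Set B) → B → MvPolynomial B ℝ :=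
  fun s t => if h : (s : B) ∈ J then S.σ ⟨s, h⟩ t else -MvPolynomial.X t

open Classical in
/-- The system `S ↓ r` for a constant system `S` with domain `J` and `r ∈ ∂J`: the constraints are
`xₛ ≥ 0` for all `s`, `(σ' α_r, σ' α_s) = (α_r, α_s)` for `s ∈ J`, and `|det σ'| = 1`
if `{r} ∪ J` is the set of all generators. -/
noncomputable def extend (_τ : CoxeterTwist cs) (S : BraidSystem B J) (r : B) :
    BraidSystem B (insert r J : Set B) where
  word₁ := S.word₁
  word₂ := S.word₂
  length_eq := S.length_eq
  σ := extendSigma S r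
  constraints :=
    {c | ∃ s : B, c = .le 0 (MvPolynomial.X s)} ∪
    {c | ∃ s : J, c = .eq
      (extForm M (extendSigma S r ⟨r, Set.mem_insert r J⟩)
        (extendSigma S r ⟨s, Set.mem_insert_of_mem r s.2⟩))
      (MvPolynomial.C (rootForm M r s))} ∪
    {c | ∃ h : ∀ s : B, s ∈ (insert r J : Set B),
      c = .absEq (Matrix.det (Matrix.of fun s t : B => extendSigma S r ⟨s, h s⟩ t)) 1}

/-- The operation `r •_des S`: prepend `r` to both words, replace `σ` by `r^* σ`, and add the
constraint `σ α_r = -α_{r^*}`. -/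
noncomputable def des (τ : CoxeterTwist cs) (S : BraidSystem B J) (r : J) : BraidSystem B J where
  word₁ := (r : B) :: S.word₁
  word₂ := (r : B) :: S.word₂
  length_eq := by simp [S.length_eq]
  σ := fun s => reflect M (τ.gen r) (S.σ s)
  constraints := S.constraints ∪
    {c | ∃ t : B, c = .eq (S.σ r t) (-simpleRoot (MvPolynomial B ℝ) (τ.gen r) t)}

/-- The linear map `r^* λ r` on `V_J` for `r ∈ J`, where `λ` is given by the images of the simple
roots. Recall that `r α_s = α_s - 2 (α_r, α_s) α_r`. -/
noncomputable def conjMap (τ : CoxeterTwist cs) {A : Type*} [CommRing A] [Algebra ℝ A]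
    (f : J → B → A) (r : J) : J → B → A :=
  fun s => reflect M (τ.gen r) (f s - algebraMap ℝ A (2 * rootForm M r s) • f r)

/-- The operation `r •̂_des S`: prepend `r` to both words, replace `σ` by `r^* σ r`, and add the
constraints `-α_{r^*} ≠ σ α_r ≤ 0`. -/
noncomputable def hatDes (τ : CoxeterTwist cs) (S : BraidSystem B J) (r : J) :
    BraidSystem B J where
  word₁ := (r : B) :: S.word₁
  word₂ := (r : B) :: S.word₂
  length_eq := by simp [S.length_eq]
  σ := τ.conjMap S.σ r
  constraints := S.constraints ∪
    ({c | c = .vecNe (-simpleRoot (MvPolynomial B ℝ) (τ.gen r)) (S.σ r)} ∪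
     {c | ∃ t : B, c = .le (S.σ r t) 0})

/-! ### First algorithm: expand into constant systems -/

/-- The vertices that may have children: neither constant, nor invalid, nor redundant. -/
def Expandable (τ : CoxeterTwist cs) (S : BraidSystem B J) : Prop :=
  ¬ S.IsConstant ∧ τ.Valid S ∧ ¬ τ.Redundant S

/-- `TreeChild τ o S S'`: in a tree of the first algorithm, run with the total order `o` of the
generators, `S'` is a child of `S`. -/
inductive TreeChild (τ : CoxeterTwist cs) (o : LinearOrder B) :
    BraidSystem B J → BraidSystem B J → Prop
  | solve (S : BraidSystem B J) (ψ : MvPolynomial B ℝ →+* ℝ) :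
      τ.Expandable S → S.solutions.Finite → ψ ∈ S.solutions → TreeChild τ o S (S.subst ψ)
  | uncond_des (S : BraidSystem B J) (r : J) :
      τ.Expandable S → S.solutions.Infinite →
      BraidSystem.IsLeastGen o {s | S.IsUncondDescent s} r → TreeChild τ o S (τ.des S r)
  | uncond_hatDes (S : BraidSystem B J) (r : J) :
      τ.Expandable S → S.solutions.Infinite →
      BraidSystem.IsLeastGen o {s | S.IsUncondDescent s} r → TreeChild τ o S (τ.hatDes S r)
  | cond_asc (S : BraidSystem B J) (r : J) :
      τ.Expandable S → S.solutions.Infinite → (∀ s, ¬ S.IsUncondDescent s) →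
      BraidSystem.IsLeastGen o {s | S.IsCondDescent s} r → TreeChild τ o S (S.asc r)
  | cond_des (S : BraidSystem B J) (r : J) :
      τ.Expandable S → S.solutions.Infinite → (∀ s, ¬ S.IsUncondDescent s) →
      BraidSystem.IsLeastGen o {s | S.IsCondDescent s} r → TreeChild τ o S (τ.des S r)
  | cond_hatDes (S : BraidSystem B J) (r : J) :
      τ.Expandable S → S.solutions.Infinite → (∀ s, ¬ S.IsUncondDescent s) →
      BraidSystem.IsLeastGen o {s | S.IsCondDescent s} r → TreeChild τ o S (τ.hatDes S r)
  | loop (S : BraidSystem B J) :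
      τ.Expandable S → S.solutions.Infinite → (∀ s, ¬ S.IsUncondDescent s) →
      (∀ s, ¬ S.IsCondDescent s) → TreeChild τ o S S

/-- The tree with the given root is finite. Its vertices are the finite paths starting at the
root. -/
def TreeFinite (τ : CoxeterTwist cs) (o : LinearOrder B) (root : BraidSystem B J) : Prop :=
  {l : List (BraidSystem B J) | List.IsChain (TreeChild τ o) (root :: l)}.Finite

/-- `L` is a leaf of the tree with the given root. -/
def IsTreeLeaf (τ : CoxeterTwist cs) (o : LinearOrder B) (root L : BraidSystem B J) : Prop :=
  Relation.ReflTransGen (TreeChild τ o) root L ∧ ∀ L', ¬ TreeChild τ o L L'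

/-! ### Second algorithm: eliminate descents -/

open Classical in
/-- The next system of the loop: with `r` the least descent, it is `r •_des S` if
`σ α_r = -α_{r^*}` and `r •̂_des S` otherwise, again considered as a constant system.
(If there is no descent, then the loop has stopped, and the value is irrelevant.) -/
noncomputable def loopNext (τ : CoxeterTwist cs) (o : LinearOrder B) (S : BraidSystem B J) :
    BraidSystem B J :=
  if h : ∃ r : J, BraidSystem.IsLeastGen o S.descents r then
    if S.σ h.choose = -simpleRoot (MvPolynomial B ℝ) (τ.gen h.choose) then
      (τ.des S h.choose).dropConstraints
    else (τ.hatDes S h.choose).dropConstraints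
  else S

/-- The sequence `S₀, S₁, S₂, …` of the loop with input `S₀ = S`. -/
noncomputable def loopSeq (τ : CoxeterTwist cs) (o : LinearOrder B) (S : BraidSystem B J) :
    ℕ → BraidSystem B J
  | 0 => S
  | i + 1 => τ.loopNext o (τ.loopSeq o S i)

open Classical in
/-- The map `λ • r`: `r^* λ` if `λ α_r = -α_{r^*}`, and `r^* λ r` otherwise. -/
noncomputable def bulletMap (τ : CoxeterTwist cs) (f : J → B → ℝ) (r : J) : J → B → ℝ :=
  if f r = -simpleRoot ℝ (τ.gen r) then fun s => reflect M (τ.gen r) (f s) else τ.conjMap f r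

/-- The `i`-th system of the sequence `S₀, S₁, …` is descent-periodic. The letters are
`r 1, …, r p`, with `r (p + 1) = r 1`, and `f j s t` is the polynomial giving the coefficient of
`α_t` in `λ_j(n) α_s`. -/
def DescentPeriodic (τ : CoxeterTwist cs) (S : ℕ → BraidSystem B J) (i : ℕ) : Prop :=
  ∃ (p q : ℕ) (r : ℕ → J) (f : ℕ → J → B → Polynomial ℝ) (lam : ℕ → ℕ → J → B → ℝ),
    1 ≤ p ∧ 2 ≤ q ∧ p * q ≤ i ∧ r (p + 1) = r 1 ∧
    -- both words begin with `(r_p, …, r_2, r_1)` repeated `q` times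
    (List.replicate q ((List.range p).reverse.map fun k => (r (k + 1) : B))).flatten
      <+: (S i).word₁ ∧
    (List.replicate q ((List.range p).reverse.map fun k => (r (k + 1) : B))).flatten
      <+: (S i).word₂ ∧
    -- the interpolating polynomials and the maps `λ_j(n)`
    (∀ j ∈ Set.Icc 1 p, ∀ s t, (f j s t).degree < (q : WithBot ℕ)) ∧
    (∀ j n s t, lam j n s t = (f j s t).eval (n : ℝ)) ∧
    (∀ j ∈ Set.Icc 1 p, ∀ n < q, ∀ s t,
      (S (i - p * q + j + n * p)).σ s t = MvPolynomial.C (lam j n s t)) ∧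
    -- `λ_j(n) β_j < 0` for all `n`, and it is `-β_j^*` for all `n` or for no `n`
    (∀ j ∈ Set.Icc 1 p,
      (∀ n, IsNegVec (lam j n (r (j + 1)))) ∧
      ((∃ n, lam j n (r (j + 1)) = -simpleRoot ℝ (τ.gen (r (j + 1)))) →
        ∀ n, lam j n (r (j + 1)) = -simpleRoot ℝ (τ.gen (r (j + 1))))) ∧
    -- the recurrences
    (∀ n, lam 1 (n + 1) = τ.bulletMap (lam p n) (r 1)) ∧
    (∀ n, ∀ j ∈ Set.Icc 2 p, lam j (n + 1) = τ.bulletMap (lam (j - 1) (n + 1)) (r j))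

/-- The loop with input `S` stops without output at step `i`, if it has not stopped before. -/
def LoopRejects (τ : CoxeterTwist cs) (o : LinearOrder B) (S : BraidSystem B J) (i : ℕ) : Prop :=
  ¬ τ.Valid (τ.loopSeq o S i) ∨ τ.Redundant (τ.loopSeq o S i) ∨
    τ.DescentPeriodic (τ.loopSeq o S) i

/-- The loop with input `S` stops at step `i`, if it has not stopped before. -/
def LoopStops (τ : CoxeterTwist cs) (o : LinearOrder B) (S : BraidSystem B J) (i : ℕ) : Prop :=
  τ.LoopRejects o S i ∨ (τ.loopSeq o S i).descents = ∅

/-- The second algorithm terminates on input `S`, with or without output. -/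
def LoopTerminates (τ : CoxeterTwist cs) (o : LinearOrder B) (S : BraidSystem B J) : Prop :=
  ∃ i, τ.LoopStops o S i

/-- The second algorithm terminates on input `S` with output `S'`. -/
def LoopOutput (τ : CoxeterTwist cs) (o : LinearOrder B) (S S' : BraidSystem B J) : Prop :=
  ∃ i, (∀ j < i, ¬ τ.LoopStops o S j) ∧ ¬ τ.LoopRejects o S i ∧
    (τ.loopSeq o S i).descents = ∅ ∧ S' = τ.loopSeq o S i

/-! ### Third algorithm: the forest, and the relations it induces -/

/-- The constant system `𝓑^θ_{s,t}`, with words `(…, s, t, s)` and `(…, t, s, t)`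
of length `m_θ(s,t)` and `σ α_s = α_{θ(s)^*}`, `σ α_t = α_{θ(t)^*}`. -/
noncomputable def rootSystem (τ : CoxeterTwist cs) (s t : B) (θ : B → B) :
    BraidSystem B ({s, t} : Set B) where
  word₁ := CoxeterSystem.alternatingWord t s (mTheta M θ s t)
  word₂ := CoxeterSystem.alternatingWord s t (mTheta M θ s t)
  length_eq := by simp
  σ := fun x => simpleRoot _ (τ.gen (θ x))
  constraints := ∅

/-- The vertices of the forest of the third algorithm on input `s, t`. -/
inductive ForestVertex (τ : CoxeterTwist cs) (o : LinearOrder B) (s t : B) :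
    ∀ J : Set B, BraidSystem B J → Prop
  | root (θ : B → B) : Set.BijOn θ {s, t} {s, t} →
      ForestVertex τ o s t ({s, t} : Set B) (τ.rootSystem s t θ)
  | child (J : Set B) (S : BraidSystem B J) (r : B) (L S' : BraidSystem B (insert r J : Set B)) :
      ForestVertex τ o s t J S → r ∈ coxBoundary M J →
      τ.IsTreeLeaf o (τ.extend S r) L → L.IsConstant → τ.LoopOutput o L S' →
      ForestVertex τ o s t (insert r J : Set B) S'

/-- The third algorithm succeeds on input `s, t`: all trees of the first algorithm which it
constructs are finite, and all runs of the second algorithm which it executes terminate. (The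
domain grows with the depth, hence the forest is then finite.) -/
def ForestExists (τ : CoxeterTwist cs) (o : LinearOrder B) (s t : B) : Prop :=
  ∀ (J : Set B) (S : BraidSystem B J), τ.ForestVertex o s t J S → ∀ r ∈ coxBoundary M J,
    τ.TreeFinite o (τ.extend S r) ∧
    ∀ L, τ.IsTreeLeaf o (τ.extend S r) L → L.IsConstant → τ.LoopTerminates o L

/-- A system is trivial if its words are involution words of the same twisted involution and `σ`
is the identity on its domain. -/
def Trivial (τ : CoxeterTwist cs) (S : BraidSystem B J) : Prop :=
  (∃ z ∈ τ.twistedInvolutions,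
    S.word₁ ∈ τ.involutionWords z ∧ S.word₂ ∈ τ.involutionWords z) ∧
  ∀ s : J, S.σ s = simpleRoot _ (s : B)

/-- The relations induced by the forest on input `s, t`: those which correspond to its trivial
vertices. -/
def forestRelations (τ : CoxeterTwist cs) (o : LinearOrder B) (s t : B) : Set (WordRel B) :=
  {R | ∃ (J : Set B) (S : BraidSystem B J), τ.ForestVertex o s t J S ∧ τ.Trivial S ∧
    R = prefixRel S.word₁ S.word₂}

/-- The union of the induced relations over all `s, t` with `2 < m(s,t) < ∞`, where the order used
for the input `s, t` is `ord s t`. -/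
def inducedRelations (τ : CoxeterTwist cs) (ord : B → B → LinearOrder B) : Set (WordRel B) :=
  {R | ∃ s t : B, 2 < M s t ∧ R ∈ τ.forestRelations (ord s t) s t}

/-- `X` is a minimal subset of the induced relations which, together with the braid and half-braid
relations, implies all of them. -/
def IsReducedInducedSet (τ : CoxeterTwist cs) (ord : B → B → LinearOrder B)
    (X : Set (WordRel B)) : Prop :=
  Minimal (fun Y => Y ⊆ τ.inducedRelations ord ∧
    τ.Implies (τ.braidAndHalfBraid ∪ Y) (τ.inducedRelations ord)) X

end CoxeterTwist

/-!
The operation `z ↦ s^* ∘ z ∘ s` (`istep`) lets words act on twisted involutions, and the involution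
words of `w` are the words which lead from `1` to `w` and change the current element with each
letter (`mem_involutionWords_iff`). All words of this kind from `1` to `w` have the same length,
because each letter raises the statistic `2 ℓ(z) - tr(v ↦ (z v)^*)` by `4` (`rank_istep`). The braid
relations, the half-braid relations and the induced relations preserve the action on `1` and the
length, so the equivalence class of an involution word of `w` consists of involution words of `w`
(`generatedEquiv_sound`). It remains to show that any two involution words of `w` are equivalent.

The proof is by induction on the length, and for a given length by downward induction on `m(s,t)`,
where `s` and `t` are the last letters (`generatedEquiv_of_ifold_eq`). If `s = t`, the last letter
is removed. Otherwise `s` and `t` are descents of `w`, and there are a twisted involution `z` with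
ascents `s`, `t` and a number `n` such that both alternating words with `n` letters lead from `z` to
`w` (`exists_dihedral_decomposition`). Either `n = m(s,t)`, and a braid relation applies, or `z`
maps `{α_s, α_t}` to `{α_{s^*}, α_{t^*}}` by a bijection `θ`, and `n = m_θ(s,t)`. In the second case
the root `𝓑^θ_{s,t}` of the forest describes the situation: its map is the restriction of `z` to the
plane spanned by `α_s` and `α_t`.

From there one follows a path in the forest, keeping a system with domain `J` whose map is, for a
suitable evaluation of the variables, the restriction of a twisted involution `z` to `V_J`
(`Realizes`), and whose words lead from `z` to `w`. A descent of `z` in `J` is moved from `z` to the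
beginning of both words; this is the effect of `•_des` and `•̂_des` (`Node.descend`). A descent `r`
of `z` in `∂J` extends the domain, the variables being evaluated as the coefficients of `-z α_r`
(`ConstNode.extend`). A descent outside `J ∪ ∂J` commutes with all letters of the words and can be
moved to the end of both of them. The path cannot meet an invalid or a descent-periodic system,
since roots are positive or negative and lengths are finite (`Fits.valid`,
`ConstNode.not_descentPeriodic`). If it meets a redundant system, the induction hypotheses apply to
words with better last letters (`Fits.linked_of_redundant`). As the trees are finite, the path ends
otherwise at `z = 1`, where the system is trivial and its induced relation exchanges the two words
(`linked_of_forestVertex`).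

The forest is not available for `m(s,t) = 2`. There a half-braid relation suffices if `z = 1`, and
otherwise both words are compared with one which ends in a descent of `z`
(`LinkedBefore.of_commute`).
-/

/-! ### The geometric representation -/

section GeometricRepresentation

variable {B : Type*} (M : CoxeterMatrix B)

theorem rootForm_comm (s t : B) : rootForm M s t = rootForm M t s := by
  simp [rootForm, M.symmetric s t]

theorem rootForm_self (s : B) : rootForm M s s = 1 := by
  simp [rootForm]

theorem simpleRoot_self (A : Type*) [CommRing A] [Algebra ℝ A] (s : B) :
    simpleRoot A s s = 1 := by
  simp [simpleRoot]

theorem simpleRoot_of_ne (A : Type*) [CommRing A] [Algebra ℝ A] {s t : B} (h : t ≠ s) :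
    simpleRoot A s t = 0 := by
  simp [simpleRoot, h]

theorem simpleRoot_nonneg (s t : B) : 0 ≤ simpleRoot ℝ s t := by
  unfold simpleRoot; split_ifs <;> norm_num

theorem simpleRoot_injective : Function.Injective (simpleRoot ℝ : B → B → ℝ) := by
  intro s t h
  by_contra hne
  have := congrFun h s
  rw [simpleRoot_self, simpleRoot_of_ne ℝ hne] at this
  exact one_ne_zero this

/-- `sin (n φ) / sin φ`, as a polynomial in `c = cos φ`; this makes sense also for `φ = 0`. -/
noncomputable def sineRatio (c : ℝ) : ℕ → ℝ
  | 0 => 0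
  | 1 => 1
  | n + 2 => 2 * c * sineRatio c (n + 1) - sineRatio c n

theorem sin_mul_sineRatio (φ : ℝ) (n : ℕ) :
    Real.sin φ * sineRatio (Real.cos φ) n = Real.sin (n * φ) := by
  induction n using Nat.twoStepInduction with
  | zero => simp [sineRatio]
  | one => simp [sineRatio]
  | more n h0 h1 =>
    have e : Real.sin φ * sineRatio (Real.cos φ) (n + 2) =
        2 * Real.cos φ * (Real.sin φ * sineRatio (Real.cos φ) (n + 1)) -
          Real.sin φ * sineRatio (Real.cos φ) n := by
      rw [sineRatio]; ring
    rw [e, h0, h1]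
    have key : ∀ a, Real.sin (a + φ) = 2 * Real.cos φ * Real.sin a - Real.sin (a - φ) := by
      intro a; rw [Real.sin_add, Real.sin_sub]; ring
    rw [show ((n + 2 : ℕ) : ℝ) * φ = ((n + 1 : ℕ) : ℝ) * φ + φ by push_cast; ring, key]
    congr 2
    push_cast; ring

theorem sineRatio_one (n : ℕ) : sineRatio 1 n = n := by
  induction n using Nat.twoStepInduction with
  | zero => simp [sineRatio]
  | one => simp [sineRatio]
  | more n h0 h1 => rw [sineRatio, h0, h1]; push_cast; ring

theorem two_le_of_ne {s t : B} (h : s ≠ t) (hM : M s t ≠ 0) : 2 ≤ M s t := by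
  have := M.off_diagonal s t h
  omega

theorem sin_pi_div_pos {s t : B} (h : s ≠ t) (hM : M s t ≠ 0) :
    0 < Real.sin (Real.pi / (M s t : ℝ)) := by
  have h2 : (2 : ℝ) ≤ M s t := by exact_mod_cast two_le_of_ne M h hM
  apply Real.sin_pos_of_pos_of_lt_pi
  · exact div_pos Real.pi_pos (by linarith)
  · rw [div_lt_iff₀ (by linarith)]
    nlinarith [Real.pi_pos]

theorem sineRatio_nonneg {s t : B} (h : s ≠ t) {n : ℕ} (hn : M s t = 0 ∨ n ≤ M s t) :
    0 ≤ sineRatio (-rootForm M s t) n := by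
  rw [rootForm, neg_neg]
  by_cases hM : M s t = 0
  · simp [hM, sineRatio_one]
  · have hs := sin_pi_div_pos M h hM
    have hn' : n ≤ M s t := by tauto
    have h0 : (0 : ℝ) < M s t := by exact_mod_cast Nat.pos_of_ne_zero hM
    have : 0 ≤ Real.sin (n * (Real.pi / (M s t : ℝ))) := by
      apply Real.sin_nonneg_of_nonneg_of_le_pi
      · have := Real.pi_pos; positivity
      · have hn'' : (n : ℝ) ≤ M s t := by exact_mod_cast hn'
        rw [← mul_div_assoc, div_le_iff₀ h0]
        nlinarith [Real.pi_pos]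
    rw [← sin_mul_sineRatio] at this
    exact nonneg_of_mul_nonneg_right this hs

theorem prod_altWord_two_mul {G : Type*} [Monoid G] (f : B → G) (s t : B) (n : ℕ) :
    ((altWord s t (2 * n)).map f).prod = (f s * f t) ^ n := by
  induction n with
  | zero => simp [altWord]
  | succ n ih =>
    rw [show 2 * (n + 1) = 2 * n + 1 + 1 by ring, altWord, altWord, pow_succ', ← ih]
    simp [mul_assoc]

theorem altWord_length (s t : B) (m : ℕ) : (altWord s t m).length = m := by
  induction m generalizing s t with
  | zero => rfl
  | succ m ih => simp [altWord, ih]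

theorem altWord_succ' (s t : B) (n : ℕ) :
    altWord s t (n + 1) = altWord s t n ++ [if Even n then s else t] := by
  induction n generalizing s t with
  | zero => simp [altWord]
  | succ n ih =>
    rw [altWord, ih, altWord]
    by_cases h : Even n <;> simp [h, Nat.even_add_one]

variable [Fintype B]

/-- The linear form `v ↦ 2 (α_s, v)`. -/
noncomputable def corootForm (s : B) : (B → ℝ) →ₗ[ℝ] ℝ where
  toFun v := 2 * ∑ t, rootForm M s t * v t
  map_add' u v := by simp [mul_add, Finset.sum_add_distrib]
  map_smul' c v := by
    simp only [Pi.smul_apply, smul_eq_mul, RingHom.id_apply, Finset.mul_sum]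
    exact Finset.sum_congr rfl fun _ _ => by ring

theorem corootForm_simpleRoot (s t : B) :
    corootForm M s (simpleRoot ℝ t) = 2 * rootForm M s t := by
  classical
  simp [corootForm, simpleRoot]

theorem extForm_simpleRoot_left {A : Type*} [CommRing A] [Algebra ℝ A] (s : B) (v : B → A) :
    extForm M (simpleRoot A s) v = ∑ t, algebraMap ℝ A (rootForm M s t) * v t := by
  classical
  simp [extForm, simpleRoot]

theorem corootForm_eq_extForm (s : B) (v : B → ℝ) :
    corootForm M s v = 2 * extForm M (simpleRoot ℝ s) v := by
  rw [extForm_simpleRoot_left]; simp [corootForm]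

/-- The reflection in the simple root `α_s`, as a linear map. -/
noncomputable def simpleReflection (s : B) : Module.End ℝ (B → ℝ) :=
  LinearMap.id - (corootForm M s).smulRight (simpleRoot ℝ s)

theorem simpleReflection_apply (s : B) (v : B → ℝ) :
    simpleReflection M s v = v - corootForm M s v • simpleRoot ℝ s := rfl

theorem simpleReflection_eq_reflect (s : B) (v : B → ℝ) :
    simpleReflection M s v = reflect M s v := by
  rw [simpleReflection_apply, reflect, corootForm_eq_extForm]

theorem simpleReflection_apply_of_ne {s t : B} (h : t ≠ s) (v : B → ℝ) :
    simpleReflection M s v t = v t := by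
  simp [simpleReflection_apply, simpleRoot_of_ne ℝ h]

theorem simpleReflection_self (s : B) :
    simpleReflection M s (simpleRoot ℝ s) = -simpleRoot ℝ s := by
  rw [simpleReflection_apply, corootForm_simpleRoot, rootForm_self]
  module

theorem simpleReflection_simpleRoot (s t : B) :
    simpleReflection M s (simpleRoot ℝ t) =
      simpleRoot ℝ t - (2 * rootForm M s t) • simpleRoot ℝ s := by
  rw [simpleReflection_apply, corootForm_simpleRoot]

theorem simpleReflection_sq (s : B) (v : B → ℝ) :
    simpleReflection M s (simpleReflection M s v) = v := by
  rw [simpleReflection_apply M s v, map_sub, map_smul, simpleReflection_self,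
    simpleReflection_apply]
  module

/-- The product of the reflections of an alternating word, applied to the simple root which
continues the alternation. -/
theorem prod_altWord_simpleRoot {s t : B} (n : ℕ) :
    ((altWord s t n).map (simpleReflection M)).prod (simpleRoot ℝ (if Even n then s else t)) =
      sineRatio (-rootForm M s t) (n + 1) • simpleRoot ℝ s +
        sineRatio (-rootForm M s t) n • simpleRoot ℝ t := by
  induction n generalizing s t with
  | zero => simp [altWord, sineRatio]
  | succ n ih =>
    have e : (if Even (n + 1) then s else t) = if Even n then t else s := by
      by_cases h : Even n <;> simp [h, Nat.even_add_one]
    rw [e, altWord, List.map_cons, List.prod_cons, Module.End.mul_apply, ih, map_add, map_smul,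
      map_smul, simpleReflection_self, simpleReflection_simpleRoot, rootForm_comm M t s, sineRatio]
    module

/-- The simple reflections satisfy the Coxeter relations. For `m(s,t) < ∞` the space is the sum of
the plane spanned by the two simple roots and of its orthogonal complement. -/
theorem simpleReflection_isLiftable : M.IsLiftable (simpleReflection M) := by
  intro s t
  by_cases hst : s = t
  · subst hst
    refine LinearMap.ext fun v => ?_
    simp [simpleReflection_sq]
  by_cases hM : M s t = 0
  · simp [hM]
  have hs := sin_pi_div_pos M hst hM
  set φ := Real.pi / (M s t : ℝ) with hφ
  have hm0 : (M s t : ℝ) ≠ 0 := by exact_mod_cast hM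
  have hmφ : (M s t : ℝ) * φ = Real.pi := by rw [hφ]; field_simp
  have hform : rootForm M s t = -Real.cos φ := rfl
  set c := Real.cos φ with hc
  have r0 : sineRatio c (2 * M s t) = 0 := by
    have := sin_mul_sineRatio φ (2 * M s t)
    rw [show ((2 * M s t : ℕ) : ℝ) * φ = 2 * Real.pi by push_cast; rw [mul_assoc, hmφ],
      Real.sin_two_pi] at this
    exact (mul_eq_zero.1 this).resolve_left hs.ne'
  have r1 : sineRatio c (2 * M s t + 1) = 1 := by
    have := sin_mul_sineRatio φ (2 * M s t + 1)
    rw [show ((2 * M s t + 1 : ℕ) : ℝ) * φ = φ + 2 * Real.pi by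
      push_cast; rw [add_mul, mul_assoc, hmφ]; ring, Real.sin_add_two_pi] at this
    exact mul_left_cancel₀ hs.ne' (by rw [this, mul_one])
  have h1 : ((simpleReflection M s * simpleReflection M t) ^ M s t) (simpleRoot ℝ s) =
      simpleRoot ℝ s := by
    have := prod_altWord_simpleRoot M (s := s) (t := t) (2 * M s t)
    rw [prod_altWord_two_mul, hform, neg_neg, r0, r1] at this
    simpa using this
  have h2 : ((simpleReflection M s * simpleReflection M t) ^ M s t) (simpleRoot ℝ t) =
      simpleRoot ℝ t := by
    obtain ⟨k, hk⟩ : ∃ k, 2 * M s t = k + 1 := ⟨2 * M s t - 1, by omega⟩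
    have hodd : ¬ Even k := by
      intro h; rcases h with ⟨j, hj⟩; omega
    have r2 : sineRatio c k = -1 := by
      have e := hk ▸ r1
      rw [sineRatio, ← hk, r0] at e
      linarith
    have := prod_altWord_simpleRoot M (s := s) (t := t) k
    rw [← hk, hform, neg_neg, r0, r2, if_neg hodd] at this
    rw [← prod_altWord_two_mul, hk, altWord_succ', if_neg hodd]
    simp only [List.map_append, List.prod_append, List.map_cons, List.map_nil, List.prod_cons,
      List.prod_nil, mul_one, Module.End.mul_apply, simpleReflection_self, map_neg, this]
    module
  -- On the orthogonal complement of the plane spanned by the two roots the product is trivial.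
  have h3 : ∀ v, corootForm M s v = 0 → corootForm M t v = 0 →
      ∀ n, ((simpleReflection M s * simpleReflection M t) ^ n) v = v := by
    intro v hv1 hv2 n
    induction n with
    | zero => simp
    | succ n ih =>
      rw [pow_succ', Module.End.mul_apply, ih, Module.End.mul_apply, simpleReflection_apply M t,
        hv2, zero_smul, sub_zero, simpleReflection_apply M s, hv1, zero_smul, sub_zero]
  refine LinearMap.ext fun v => ?_
  have hd : 1 - c ^ 2 ≠ 0 := by
    have := Real.sin_sq_add_cos_sq φ
    have : 1 - c ^ 2 = Real.sin φ ^ 2 := by rw [hc]; linarith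
    rw [this]; positivity
  set x := (corootForm M s v + c * corootForm M t v) / (2 * (1 - c ^ 2)) with hx
  set y := (corootForm M t v + c * corootForm M s v) / (2 * (1 - c ^ 2)) with hy
  have hf1 : corootForm M s (v - x • simpleRoot ℝ s - y • simpleRoot ℝ t) = 0 := by
    rw [map_sub, map_sub, map_smul, map_smul, corootForm_simpleRoot, corootForm_simpleRoot,
      rootForm_self, hform, hx, hy, smul_eq_mul, smul_eq_mul]
    field_simp
    ring
  have hf2 : corootForm M t (v - x • simpleRoot ℝ s - y • simpleRoot ℝ t) = 0 := by
    rw [map_sub, map_sub, map_smul, map_smul, corootForm_simpleRoot, corootForm_simpleRoot,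
      rootForm_self, rootForm_comm M t s, hform, hx, hy, smul_eq_mul, smul_eq_mul]
    field_simp
    ring
  have h4 := h3 _ hf1 hf2 (M s t)
  rw [map_sub, map_sub, map_smul, map_smul, h1, h2] at h4
  rw [Module.End.one_apply]
  have := congrArg (fun u => u + x • simpleRoot ℝ s + y • simpleRoot ℝ t) h4
  simpa using this

end GeometricRepresentation

namespace CoxeterSystem

section Words

variable {B W : Type*} [Group W] {M : CoxeterMatrix B} (cs : CoxeterSystem M W)

theorem wordProd_altWord_eq (s t : B) :
    cs.wordProd (altWord s t (M s t)) = cs.wordProd (altWord t s (M s t)) := by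
  have h : cs.wordProd (altWord s t (2 * M s t)) = 1 := by
    rw [wordProd, prod_altWord_two_mul, cs.simple_mul_simple_pow]
  have key : ∀ (n : ℕ) (s t : B) (m : ℕ), cs.wordProd (altWord s t (n + m)) = 1 →
      cs.wordProd (altWord s t n) =
        cs.wordProd
          (altWord (if Even (n + m) then t else s) (if Even (n + m) then s else t) m) := by
    intro n s t m
    induction m generalizing n with
    | zero => intro h; simpa [altWord] using h
    | succ m ih =>
      intro h
      have := ih (n + 1) (by rwa [show n + 1 + m = n + (m + 1) by ring])
      rw [altWord_succ', wordProd_append, wordProd_singleton, show n + 1 + m = n + (m + 1) by ring]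
        at this
      rw [altWord_succ', wordProd_append, wordProd_singleton, ← this]
      have e : (if Even m then (if Even (n + (m + 1)) then t else s)
          else (if Even (n + (m + 1)) then s else t)) = if Even n then s else t := by
        by_cases h1 : Even n <;> by_cases h2 : Even m <;>
          simp [h1, h2, Nat.even_add, Nat.even_add_one]
      rw [e]; simp
  have := key (M s t) s t (M s t) (by rwa [← two_mul])
  rwa [if_pos ⟨_, rfl⟩, if_pos ⟨_, rfl⟩] at this

end Words

variable {B W : Type*} [Fintype B] [Group W] {M : CoxeterMatrix B} (cs : CoxeterSystem M W)

/-- The geometric representation of a Coxeter group. -/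
noncomputable def geom : W →* Module.End ℝ (B → ℝ) :=
  cs.lift ⟨simpleReflection M, simpleReflection_isLiftable M⟩

theorem geom_simple (s : B) : cs.geom (cs.simple s) = simpleReflection M s :=
  cs.lift_apply_simple _ s

/-- The root `w α_s`. -/
noncomputable def root (w : W) (s : B) : B → ℝ := cs.geom w (simpleRoot ℝ s)

theorem root_one (s : B) : cs.root 1 s = simpleRoot ℝ s := by simp [root]

theorem geom_mul_apply (w w' : W) (v : B → ℝ) :
    cs.geom (w * w') v = cs.geom w (cs.geom w' v) := by
  rw [map_mul, Module.End.mul_apply]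

theorem geom_inv_apply (w : W) (v : B → ℝ) : cs.geom w⁻¹ (cs.geom w v) = v := by
  rw [← geom_mul_apply, inv_mul_cancel, map_one, Module.End.one_apply]

theorem geom_apply_inv (w : W) (v : B → ℝ) : cs.geom w (cs.geom w⁻¹ v) = v := by
  rw [← geom_mul_apply, mul_inv_cancel, map_one, Module.End.one_apply]

theorem geom_injective (w : W) : Function.Injective (cs.geom w) :=
  Function.LeftInverse.injective (cs.geom_inv_apply w)

theorem root_mul_simple_self (w : W) (s : B) : cs.root (w * cs.simple s) s = -cs.root w s := by
  rw [root, geom_mul_apply, geom_simple, simpleReflection_self, map_neg, root]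

theorem root_mul_simple (w : W) (s t : B) :
    cs.root (w * cs.simple s) t = cs.root w t - (2 * rootForm M s t) • cs.root w s := by
  rw [root, geom_mul_apply, geom_simple, simpleReflection_simpleRoot, map_sub, map_smul, root, root]

theorem root_simple_mul (w : W) (s t : B) :
    cs.root (cs.simple s * w) t = simpleReflection M s (cs.root w t) := by
  rw [root, geom_mul_apply, geom_simple, root]

theorem geom_wordProd (ω : List B) :
    cs.geom (cs.wordProd ω) = (ω.map (simpleReflection M)).prod := by
  rw [wordProd, map_list_prod, List.map_map]
  congr 1
  exact List.map_congr_left fun s _ => cs.geom_simple s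

theorem root_mul_altWord (w : W) (s t : B) (n : ℕ) :
    cs.root (w * cs.wordProd (altWord s t n)) (if Even n then s else t) =
      sineRatio (-rootForm M s t) (n + 1) • cs.root w s +
        sineRatio (-rootForm M s t) n • cs.root w t := by
  rw [root, geom_mul_apply, geom_wordProd, prod_altWord_simpleRoot, map_add, map_smul, map_smul,
    root, root]

end CoxeterSystem

/-! ### Positive and negative roots -/

section PositiveVectors

variable {B : Type*}

theorem IsPosVec.not_isNegVec {v : B → ℝ} (h : IsPosVec v) : ¬ IsNegVec v := fun h' =>
  h.1 (funext fun t => le_antisymm (h'.2 t) (h.2 t))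

theorem IsPosVec.neg {v : B → ℝ} (h : IsPosVec v) : IsNegVec (-v) :=
  ⟨neg_ne_zero.2 h.1, fun t => by simpa using h.2 t⟩

theorem simpleRoot_ne_zero (s : B) : simpleRoot ℝ s ≠ 0 := fun h => by
  have := congrFun h s
  rw [simpleRoot_self] at this
  exact one_ne_zero this

theorem isPosVec_simpleRoot (s : B) : IsPosVec (simpleRoot ℝ s) :=
  ⟨simpleRoot_ne_zero s, simpleRoot_nonneg s⟩

end PositiveVectors

section BilinearForm

variable {B : Type*} [Fintype B] (M : CoxeterMatrix B)

theorem extForm_comm (u v : B → ℝ) : extForm M u v = extForm M v u := by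
  unfold extForm
  rw [Finset.sum_comm]
  refine Finset.sum_congr rfl fun s _ => Finset.sum_congr rfl fun t _ => ?_
  rw [rootForm_comm]; ring

theorem extForm_sub_left (u u' v : B → ℝ) :
    extForm M (u - u') v = extForm M u v - extForm M u' v := by
  unfold extForm
  simp only [Pi.sub_apply, ← Finset.sum_sub_distrib]
  refine Finset.sum_congr rfl fun s _ => Finset.sum_congr rfl fun t _ => by ring

theorem extForm_smul_left (c : ℝ) (u v : B → ℝ) :
    extForm M (c • u) v = c * extForm M u v := by
  unfold extForm
  simp only [Pi.smul_apply, smul_eq_mul, Finset.mul_sum]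
  refine Finset.sum_congr rfl fun s _ => Finset.sum_congr rfl fun t _ => by ring

theorem extForm_simpleRoot_simpleRoot (s t : B) :
    extForm M (simpleRoot ℝ s) (simpleRoot ℝ t) = rootForm M s t := by
  have := corootForm_eq_extForm M s (simpleRoot ℝ t)
  rw [corootForm_simpleRoot] at this
  linarith

theorem extForm_simpleReflection (s : B) (u v : B → ℝ) :
    extForm M (simpleReflection M s u) (simpleReflection M s v) = extForm M u v := by
  have hr : ∀ w, extForm M w (simpleReflection M s v) =
      extForm M w v - corootForm M s v * extForm M (simpleRoot ℝ s) w := by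
    intro w
    rw [extForm_comm, simpleReflection_apply, extForm_sub_left, extForm_smul_left,
      extForm_comm M v]
  rw [hr, simpleReflection_apply, extForm_sub_left, extForm_smul_left, extForm_comm M _ (u - _),
    extForm_sub_left, extForm_smul_left, extForm_simpleRoot_simpleRoot, rootForm_self,
    corootForm_eq_extForm, corootForm_eq_extForm, extForm_comm M u (simpleRoot ℝ s)]
  ring

end BilinearForm

namespace CoxeterSystem

section

variable {B W : Type*} [Group W] {M : CoxeterMatrix B} (cs : CoxeterSystem M W)

theorem length_wordProd_altWord_add_two_le {s t : B} (hM : M s t ≠ 0) {n : ℕ} (hn : M s t < n) :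
    cs.length (cs.wordProd (altWord s t n)) + 2 ≤ n := by
  obtain ⟨k, rfl⟩ : ∃ k, n = M s t + 1 + k := ⟨n - (M s t + 1), by omega⟩
  clear hn
  induction k generalizing s t with
  | zero =>
    obtain ⟨m, hm⟩ := Nat.exists_eq_succ_of_ne_zero hM
    have e : cs.wordProd (altWord s t (M s t + 1)) = cs.wordProd (altWord t s m) := by
      rw [altWord, wordProd_cons, ← wordProd_altWord_eq, hm,
        altWord, wordProd_cons, simple_mul_simple_cancel_left]
    have := cs.length_wordProd_le (altWord t s m)
    rw [altWord_length] at this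
    rw [add_zero, e]; omega
  | succ k ih =>
    have := ih (s := t) (t := s) (by rwa [M.symmetric])
    rw [← add_assoc, altWord, wordProd_cons]
    have h2 := cs.length_mul_le (cs.simple s) (cs.wordProd (altWord t s (M s t + 1 + k)))
    rw [length_simple] at h2
    rw [M.symmetric t s] at this
    omega

end

variable {B W : Type*} [Fintype B] [Group W] {M : CoxeterMatrix B} (cs : CoxeterSystem M W)

theorem root_ne_zero (w : W) (s : B) : cs.root w s ≠ 0 := fun h =>
  simpleRoot_ne_zero s (cs.geom_injective w (by rw [map_zero]; exact h))

/-- The fundamental positivity theorem of the geometric representation. The element is written as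
`v x`, where `x` lies in a dihedral parabolic subgroup and `v` is shortest in its coset. -/
theorem root_nonneg_of_not_isRightDescent {w : W} {s : B} (h : ¬ cs.IsRightDescent w s) (t : B) :
    0 ≤ cs.root w s t := by
  induction hk : cs.length w using Nat.strong_induction_on generalizing w s with
  | _ k ih =>
  by_cases hw : w = 1
  · subst hw; rw [root_one]; exact simpleRoot_nonneg s t
  obtain ⟨t', ht'⟩ := cs.exists_rightDescent_of_ne_one hw
  have hst : s ≠ t' := by rintro rfl; exact h ht'
  have key : ∀ (l : ℕ) (v : W) (i j : B) (n : ℕ), cs.length v = l → i ≠ j → 1 ≤ n →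
      (if Even n then i else j) = s → w = v * cs.wordProd (altWord i j n) →
      cs.length v + n = cs.length w → 0 ≤ cs.root w s t := by
    intro l
    induction l using Nat.strong_induction_on with
    | _ l ihl =>
    intro v i j n hl hij hn hs hwv hlen
    by_cases hj : cs.IsRightDescent v j
    · have hj' := cs.isRightDescent_iff.1 hj
      refine ihl _ (by omega) (v * cs.simple j) j i (n + 1) rfl hij.symm (by omega) ?_ ?_ (by omega)
      · rw [← hs]; by_cases he : Even n <;> simp [he, Nat.even_add_one]
      · rw [altWord, wordProd_cons, hwv]; simp [mul_assoc]
    have hi : ¬ cs.IsRightDescent v i := by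
      intro hi
      obtain ⟨m, rfl⟩ : ∃ m, n = m + 1 := ⟨n - 1, by omega⟩
      have h1 : w = v * cs.simple i * cs.wordProd (altWord j i m) := by
        rw [hwv, altWord, wordProd_cons, mul_assoc]
      have h2 := cs.length_mul_le (v * cs.simple i) (cs.wordProd (altWord j i m))
      have h3 := cs.length_wordProd_le (altWord j i m)
      rw [altWord_length] at h3
      rw [← h1] at h2
      have := cs.isRightDescent_iff.1 hi
      omega
    have hnM : M i j = 0 ∨ n + 1 ≤ M i j := by
      by_contra hcon
      push Not at hcon
      have h1 := cs.length_wordProd_altWord_add_two_le hcon.1 hcon.2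
      apply h
      have h2 : w * cs.simple s = v * cs.wordProd (altWord i j (n + 1)) := by
        rw [altWord_succ', wordProd_append, wordProd_singleton, hwv, hs, mul_assoc]
      have h3 := cs.length_mul_le v (cs.wordProd (altWord i j (n + 1)))
      rw [IsRightDescent, h2]
      omega
    have e := cs.root_mul_altWord v i j n
    rw [hs, ← hwv] at e
    rw [e]
    have h1 := ih (cs.length v) (by omega) hi rfl
    have h2 := ih (cs.length v) (by omega) hj rfl
    have h3 := sineRatio_nonneg M hij hnM
    have h4 := sineRatio_nonneg M hij (n := n) (by omega)
    simp only [Pi.add_apply, Pi.smul_apply, smul_eq_mul]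
    positivity
  refine key _ (w * cs.simple t') t' s 1 rfl hst.symm le_rfl (by simp) ?_ ?_
  · simp [altWord]
  · exact cs.isRightDescent_iff.1 ht'

theorem isPosVec_root_iff {w : W} {s : B} :
    IsPosVec (cs.root w s) ↔ ¬ cs.IsRightDescent w s := by
  refine ⟨fun h hd => ?_, fun h => ⟨cs.root_ne_zero w s,
    cs.root_nonneg_of_not_isRightDescent h⟩⟩
  have h1 := cs.isRightDescent_iff_not_isRightDescent_mul.1 hd
  have h2 : IsPosVec (cs.root (w * cs.simple s) s) :=
    ⟨cs.root_ne_zero _ s, cs.root_nonneg_of_not_isRightDescent h1⟩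
  rw [root_mul_simple_self] at h2
  exact h.not_isNegVec (by simpa using h2.neg)

theorem isNegVec_root_iff {w : W} {s : B} :
    IsNegVec (cs.root w s) ↔ cs.IsRightDescent w s := by
  refine ⟨fun h => ?_, fun hd => ?_⟩
  · by_contra hd
    exact (cs.isPosVec_root_iff.2 hd).not_isNegVec h
  · have h1 := cs.isRightDescent_iff_not_isRightDescent_mul.1 hd
    have := cs.isPosVec_root_iff.2 h1
    rw [root_mul_simple_self] at this
    simpa using this.neg

theorem isRightDescent_of_root_neg {w : W} {s : B} (t : B) (h : cs.root w s t < 0) :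
    cs.IsRightDescent w s := by
  by_contra hd
  exact absurd ((cs.isPosVec_root_iff.2 hd).2 t) (not_le.2 h)

theorem not_isRightDescent_of_root_pos {w : W} {s : B} (t : B) (h : 0 < cs.root w s t) :
    ¬ cs.IsRightDescent w s := by
  intro hd
  exact absurd ((cs.isNegVec_root_iff.2 hd).2 t) (not_le.2 h)

theorem root_pos_or_neg (w : W) (s : B) : IsPosVec (cs.root w s) ∨ IsNegVec (cs.root w s) := by
  by_cases h : cs.IsRightDescent w s
  · exact Or.inr (cs.isNegVec_root_iff.2 h)
  · exact Or.inl (cs.isPosVec_root_iff.2 h)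

theorem geom_faithful {w w' : W} (h : cs.geom w = cs.geom w') : w = w' := by
  rw [← inv_mul_eq_one]
  by_contra hne
  obtain ⟨s, hs⟩ := cs.exists_rightDescent_of_ne_one hne
  have h1 := cs.isNegVec_root_iff.2 hs
  have h2 : cs.geom (w⁻¹ * w') = 1 := by rw [map_mul, ← h, ← map_mul, inv_mul_cancel, map_one]
  rw [root, h2, Module.End.one_apply] at h1
  exact (isPosVec_simpleRoot s).not_isNegVec h1

theorem extForm_geom (w : W) (u v : B → ℝ) :
    extForm M (cs.geom w u) (cs.geom w v) = extForm M u v := by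
  induction w using cs.simple_induction_left with
  | one => simp
  | mul_simple_left w s ih => rw [geom_mul_apply, geom_mul_apply, geom_simple,
      extForm_simpleReflection, ih]

theorem extForm_root_root (w : W) (s t : B) :
    extForm M (cs.root w s) (cs.root w t) = rootForm M s t := by
  rw [root, root, extForm_geom, extForm_simpleRoot_simpleRoot]

/-- Roots have norm one, so a positive multiple of a simple root is a root only if it is simple. -/
theorem root_eq_simpleRoot_of_smul {w : W} {s t : B} {c : ℝ} (h : cs.root w t = c • simpleRoot ℝ s)
    (hd : ¬ cs.IsRightDescent w t) : cs.root w t = simpleRoot ℝ s := by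
  have h1 := cs.extForm_root_root w t t
  rw [rootForm_self, h, extForm_smul_left, extForm_comm, extForm_smul_left,
    extForm_simpleRoot_simpleRoot, rootForm_self, mul_one] at h1
  have h2 := cs.root_nonneg_of_not_isRightDescent hd s
  rw [h, Pi.smul_apply, simpleRoot_self, smul_eq_mul, mul_one] at h2
  have : c = 1 := by nlinarith
  rw [h, this, one_smul]

theorem mul_simple_eq_simple_mul {w : W} {s t : B} (h : cs.root w t = simpleRoot ℝ s) :
    w * cs.simple t = cs.simple s * w := by
  apply cs.geom_faithful
  refine LinearMap.ext fun v => ?_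
  rw [geom_mul_apply, geom_mul_apply, geom_simple, geom_simple, simpleReflection_apply,
    simpleReflection_apply, map_sub, map_smul, corootForm_eq_extForm, corootForm_eq_extForm, ← h,
    root, extForm_geom]

/-- A simple reflection sends no positive root to a negative one except its own simple root. -/
theorem isRightDescent_simple_mul_iff {w : W} {s t : B} (hd : ¬ cs.IsRightDescent w t) :
    cs.IsRightDescent (cs.simple s * w) t ↔ cs.root w t = simpleRoot ℝ s := by
  constructor
  · intro h
    have h1 := cs.isNegVec_root_iff.2 h
    rw [root_simple_mul] at h1
    refine cs.root_eq_simpleRoot_of_smul (c := cs.root w t s) (funext fun x => ?_) hd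
    by_cases hx : x = s
    · subst hx; simp [simpleRoot_self]
    · have h2 := h1.2 x
      rw [simpleReflection_apply_of_ne M hx] at h2
      rw [Pi.smul_apply, simpleRoot_of_ne ℝ hx, smul_zero]
      exact le_antisymm h2 (cs.root_nonneg_of_not_isRightDescent hd x)
  · intro h
    rw [← isNegVec_root_iff, root_simple_mul, h, simpleReflection_self]
    exact (isPosVec_simpleRoot s).neg

theorem simple_injective : Function.Injective cs.simple := by
  intro s t h
  by_contra hne
  have h1 := congrFun (congrArg (fun w => cs.root w s) h) s
  simp only [root, geom_simple] at h1
  rw [simpleReflection_self, simpleReflection_apply_of_ne M hne, Pi.neg_apply,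
    simpleRoot_self] at h1
  norm_num at h1

/-- The order of `s t` is divisible by `m(s,t)`, as is seen in the plane spanned by the two simple
roots: there `s t` is a rotation by `2 π / m(s,t)`, or of infinite order if `m(s,t) = ∞`. -/
theorem dvd_of_simple_mul_simple_pow_eq_one {s t : B} (hst : s ≠ t) {k : ℕ}
    (h : (cs.simple s * cs.simple t) ^ k = 1) : M s t ∣ k := by
  have e := cs.root_mul_altWord 1 s t (2 * k)
  rw [one_mul, wordProd, prod_altWord_two_mul, h, if_pos (even_two_mul k), root_one, root_one] at e
  have e1 := congrFun e s
  have e2 := congrFun e t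
  simp only [Pi.add_apply, Pi.smul_apply, smul_eq_mul, simpleRoot_self, simpleRoot_of_ne ℝ hst,
    simpleRoot_of_ne ℝ (Ne.symm hst), mul_zero, mul_one, add_zero, zero_add] at e1 e2
  by_cases hM : M s t = 0
  · rw [rootForm, hM, neg_neg] at e2
    simp [sineRatio_one] at e2
    simp [e2]
  · have hs := sin_pi_div_pos M hst hM
    rw [rootForm, neg_neg] at e1 e2
    have h1 := sin_mul_sineRatio (Real.pi / (M s t : ℝ)) (2 * k)
    have h2 := sin_mul_sineRatio (Real.pi / (M s t : ℝ)) (2 * k + 1)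
    rw [← e1, mul_one, show ((2 * k + 1 : ℕ) : ℝ) * (Real.pi / (M s t : ℝ)) =
      ((2 * k : ℕ) : ℝ) * (Real.pi / (M s t : ℝ)) + Real.pi / (M s t : ℝ) by push_cast; ring,
      Real.sin_add, ← h1, ← e2, mul_zero, zero_mul, zero_add] at h2
    have h3 : Real.cos (((2 * k : ℕ) : ℝ) * (Real.pi / (M s t : ℝ))) = 1 :=
      mul_right_cancel₀ hs.ne' (by rw [← h2, one_mul])
    obtain ⟨j, hj⟩ := (Real.cos_eq_one_iff _).1 h3
    have hm0 : (M s t : ℝ) ≠ 0 := by exact_mod_cast hM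
    have h4 : (j : ℝ) * M s t = k := by
      have := Real.pi_ne_zero
      push_cast at hj
      field_simp at hj
      linarith
    have h5 : j * (M s t : ℤ) = k := by exact_mod_cast h4
    exact Int.natCast_dvd_natCast.1 ⟨j, by rw [← h5, mul_comm]⟩

end CoxeterSystem

namespace CoxeterTwist

open CoxeterSystem

variable {B W : Type*} [Group W] {M : CoxeterMatrix B} {cs : CoxeterSystem M W}
  (τ : CoxeterTwist cs)

/-- The action of the twist on the geometric representation, permuting the simple roots. -/
noncomputable def starEnd : Module.End ℝ (B → ℝ) := LinearMap.funLeft ℝ ℝ τ.gen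

theorem starEnd_apply (v : B → ℝ) (t : B) : τ.starEnd v t = v (τ.gen t) := rfl

variable [Fintype B]

theorem gen_gen (s : B) : τ.gen (τ.gen s) = s := by
  apply cs.simple_injective
  rw [← τ.map_simple, ← τ.map_simple, τ.involutive]

theorem gen_injective : Function.Injective τ.gen := fun s t h => by
  rw [← τ.gen_gen s, h, τ.gen_gen]

theorem matrix_gen (s t : B) : M (τ.gen s) (τ.gen t) = M s t := by
  have key : ∀ s t, s ≠ t → M (τ.gen s) (τ.gen t) ∣ M s t := by
    intro s t hst
    refine cs.dvd_of_simple_mul_simple_pow_eq_one (τ.gen_injective.ne hst) ?_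
    rw [← τ.map_simple, ← τ.map_simple, ← map_mul, ← map_pow, cs.simple_mul_simple_pow, map_one]
  by_cases hst : s = t
  · simp [hst]
  · refine Nat.dvd_antisymm (key s t hst) ?_
    have := key _ _ (τ.gen_injective.ne hst)
    rwa [τ.gen_gen, τ.gen_gen] at this

theorem starEnd_starEnd (v : B → ℝ) : τ.starEnd (τ.starEnd v) = v := by
  ext t; simp [starEnd_apply, gen_gen]

theorem starEnd_simpleRoot (s : B) : τ.starEnd (simpleRoot ℝ s) = simpleRoot ℝ (τ.gen s) := by
  ext t
  rw [starEnd_apply]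
  by_cases h : t = τ.gen s
  · rw [h, gen_gen, simpleRoot_self, simpleRoot_self]
  · rw [simpleRoot_of_ne ℝ h, simpleRoot_of_ne ℝ]
    rintro rfl
    exact h (τ.gen_gen t).symm

theorem starEnd_simpleReflection (s : B) (v : B → ℝ) :
    τ.starEnd (simpleReflection M s v) = simpleReflection M (τ.gen s) (τ.starEnd v) := by
  have : corootForm M (τ.gen s) (τ.starEnd v) = corootForm M s v := by
    simp only [corootForm, LinearMap.coe_mk, AddHom.coe_mk]
    congr 1
    refine Fintype.sum_equiv ⟨τ.gen, τ.gen, τ.gen_gen, τ.gen_gen⟩ _ _ fun t => ?_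
    simp only [Equiv.coe_fn_mk, starEnd_apply]
    rw [rootForm, rootForm, ← τ.matrix_gen s, τ.gen_gen]
  rw [simpleReflection_apply, simpleReflection_apply, map_sub, map_smul, starEnd_simpleRoot, this]

theorem starEnd_geom (w : W) (v : B → ℝ) :
    τ.starEnd (cs.geom w v) = cs.geom (τ.toMulEquiv w) (τ.starEnd v) := by
  induction w using cs.simple_induction_left with
  | one => simp
  | mul_simple_left w s ih =>
    rw [geom_mul_apply, map_mul, geom_mul_apply, geom_simple, starEnd_simpleReflection, ih,
      map_simple, geom_simple]

theorem starEnd_root (w : W) (s : B) :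
    τ.starEnd (cs.root w s) = cs.root (τ.toMulEquiv w) (τ.gen s) := by
  rw [root, starEnd_geom, starEnd_simpleRoot, root]

theorem isRightDescent_gen {w : W} {s : B} :
    cs.IsRightDescent (τ.toMulEquiv w) (τ.gen s) ↔ cs.IsRightDescent w s := by
  have key : ∀ w s, cs.IsRightDescent w s → cs.IsRightDescent (τ.toMulEquiv w) (τ.gen s) := by
    intro w s h
    rw [← isNegVec_root_iff] at h ⊢
    rw [← starEnd_root]
    refine ⟨fun h0 => h.1 ?_, fun t => h.2 _⟩
    rw [← τ.starEnd_starEnd (cs.root w s), h0, map_zero]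
  refine ⟨fun h => ?_, key w s⟩
  have := key _ _ h
  rwa [τ.involutive, τ.gen_gen] at this

end CoxeterTwist

/-! ### Demazure products -/

namespace CoxeterSystem

section

variable {B W : Type*} [Group W] {M : CoxeterMatrix B} (cs : CoxeterSystem M W)

open Classical in
/-- The product `w ∘ s`. -/
noncomputable def rstep (w : W) (s : B) : W :=
  if cs.IsRightDescent w s then w else w * cs.simple s

open Classical in
/-- The product `s ∘ w`. -/
noncomputable def lstep (w : W) (s : B) : W :=
  if cs.IsLeftDescent w s then w else cs.simple s * w

/-- The product `w ∘ s₁ ∘ ⋯ ∘ sₙ`. -/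
noncomputable def rfold (w : W) (a : List B) : W := a.foldl cs.rstep w

/-- The product `sₙ ∘ ⋯ ∘ s₁ ∘ w`. -/
noncomputable def lfold (w : W) (a : List B) : W := a.foldl cs.lstep w

theorem demazureProd_eq_rfold (a : List B) : CoxeterTwist.demazureProd cs a = cs.rfold 1 a := rfl

theorem rfold_append (w : W) (a b : List B) : cs.rfold w (a ++ b) = cs.rfold (cs.rfold w a) b :=
  List.foldl_append

theorem rstep_of_isRightDescent {w : W} {s : B} (h : cs.IsRightDescent w s) : cs.rstep w s = w :=
  if_pos h

theorem rstep_of_not_isRightDescent {w : W} {s : B} (h : ¬ cs.IsRightDescent w s) :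
    cs.rstep w s = w * cs.simple s :=
  if_neg h

theorem lstep_of_isLeftDescent {w : W} {s : B} (h : cs.IsLeftDescent w s) : cs.lstep w s = w :=
  if_pos h

theorem lstep_of_not_isLeftDescent {w : W} {s : B} (h : ¬ cs.IsLeftDescent w s) :
    cs.lstep w s = cs.simple s * w :=
  if_neg h

theorem isRightDescent_rstep (w : W) (s : B) : cs.IsRightDescent (cs.rstep w s) s := by
  by_cases h : cs.IsRightDescent w s
  · rwa [rstep_of_isRightDescent cs h]
  · rw [rstep_of_not_isRightDescent cs h, cs.isRightDescent_iff_not_isRightDescent_mul]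
    simpa using h

theorem inv_rstep (w : W) (s : B) : (cs.rstep w s)⁻¹ = cs.lstep w⁻¹ s := by
  by_cases h : cs.IsRightDescent w s
  · rw [cs.rstep_of_isRightDescent h, cs.lstep_of_isLeftDescent (cs.isLeftDescent_inv_iff.2 h)]
  · rw [cs.rstep_of_not_isRightDescent h, cs.lstep_of_not_isLeftDescent
      (fun h' => h (cs.isLeftDescent_inv_iff.1 h'))]
    simp

theorem inv_lstep (w : W) (s : B) : (cs.lstep w s)⁻¹ = cs.rstep w⁻¹ s := by
  rw [← inv_inv (cs.rstep w⁻¹ s), inv_rstep, inv_inv]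

theorem inv_rfold (w : W) (a : List B) : (cs.rfold w a)⁻¹ = cs.lfold w⁻¹ a := by
  induction a generalizing w with
  | nil => rfl
  | cons s a ih => rw [rfold, List.foldl_cons, ← rfold, ih, inv_rstep]; rfl

theorem rfold_eq_self {w : W} {a : List B} (h : ∀ x ∈ a, cs.IsRightDescent w x) :
    cs.rfold w a = w := by
  induction a with
  | nil => rfl
  | cons s a ih =>
    rw [rfold, List.foldl_cons, cs.rstep_of_isRightDescent (h s (by simp)), ← rfold,
      ih fun x hx => h x (by simp [hx])]

theorem exists_lfold_eq (w : W) : ∃ c, cs.lfold 1 c = w := by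
  induction hk : cs.length w using Nat.strong_induction_on generalizing w with
  | _ k ih =>
  by_cases hw : w = 1
  · exact ⟨[], hw.symm⟩
  obtain ⟨s, hs⟩ := cs.exists_leftDescent_of_ne_one hw
  obtain ⟨c, hc⟩ := ih _ (by rw [← hk]; exact hs) (cs.simple s * w) rfl
  refine ⟨c ++ [s], ?_⟩
  rw [lfold, List.foldl_append]
  change cs.lstep (cs.lfold 1 c) s = w
  rw [hc, lstep_of_not_isLeftDescent cs (cs.isLeftDescent_iff_not_isLeftDescent_mul.1 hs),
    simple_mul_simple_cancel_left]

end

variable {B W : Type*} [Fintype B] [Group W] {M : CoxeterMatrix B} (cs : CoxeterSystem M W)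

/-- Left and right Demazure multiplication commute: a case of the associativity of `∘`. -/
theorem rstep_lstep (w : W) (s t : B) :
    cs.rstep (cs.lstep w s) t = cs.lstep (cs.rstep w t) s := by
  have hlen : cs.length (cs.simple s * w * cs.simple t) =
    cs.length (cs.simple s * (w * cs.simple t)) := by rw [mul_assoc]
  by_cases hs : cs.IsLeftDescent w s <;> by_cases ht : cs.IsRightDescent w t
  · rw [lstep_of_isLeftDescent cs hs, rstep_of_isRightDescent cs ht, lstep_of_isLeftDescent cs hs]
  · rw [lstep_of_isLeftDescent cs hs, rstep_of_not_isRightDescent cs ht, lstep_of_isLeftDescent]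
    have h1 := cs.isLeftDescent_iff.1 hs
    have h2 := cs.not_isRightDescent_iff.1 ht
    have h3 := cs.length_mul_le (cs.simple s * w) (cs.simple t)
    rw [length_simple] at h3
    rw [IsLeftDescent]; omega
  · rw [lstep_of_not_isLeftDescent cs hs, rstep_of_isRightDescent cs ht,
      lstep_of_not_isLeftDescent cs hs, rstep_of_isRightDescent]
    have h1 := cs.not_isLeftDescent_iff.1 hs
    have h2 := cs.isRightDescent_iff.1 ht
    have h3 := cs.length_mul_le (cs.simple s) (w * cs.simple t)
    rw [length_simple] at h3
    rw [IsRightDescent]; omega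
  · rw [lstep_of_not_isLeftDescent cs hs, rstep_of_not_isRightDescent cs ht]
    have h1 := cs.not_isLeftDescent_iff.1 hs
    have h2 := cs.not_isRightDescent_iff.1 ht
    by_cases hr : cs.IsRightDescent (cs.simple s * w) t
    · have e := cs.mul_simple_eq_simple_mul ((cs.isRightDescent_simple_mul_iff ht).1 hr)
      rw [rstep_of_isRightDescent cs hr, lstep_of_isLeftDescent, e]
      rw [IsLeftDescent, e, simple_mul_simple_cancel_left]; omega
    · have h3 := cs.not_isRightDescent_iff.1 hr
      rw [rstep_of_not_isRightDescent cs hr, lstep_of_not_isLeftDescent, mul_assoc]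
      rw [IsLeftDescent]; omega

theorem rfold_lstep (w : W) (s : B) (a : List B) :
    cs.rfold (cs.lstep w s) a = cs.lstep (cs.rfold w a) s := by
  induction a generalizing w with
  | nil => rfl
  | cons t a ih => rw [rfold, List.foldl_cons, rstep_lstep, ← rfold, ih]; rfl

theorem rfold_lfold (w : W) (a b : List B) :
    cs.rfold (cs.lfold w a) b = cs.lfold (cs.rfold w b) a := by
  induction a generalizing w with
  | nil => rfl
  | cons t a ih => rw [lfold, List.foldl_cons, ← lfold, ih, rfold_lstep]; rfl

/-- The effect of right Demazure multiplication by a word depends only on its Demazure product. -/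
theorem rfold_congr {a b : List B} (h : cs.rfold 1 a = cs.rfold 1 b) (w : W) :
    cs.rfold w a = cs.rfold w b := by
  obtain ⟨c, rfl⟩ := cs.exists_lfold_eq w
  rw [rfold_lfold, rfold_lfold, h]

theorem lfold_congr {a b : List B} (h : cs.rfold 1 a = cs.rfold 1 b) (w : W) :
    cs.lfold w a = cs.lfold w b := by
  rw [← inv_inv w, ← inv_rfold, ← inv_rfold, cs.rfold_congr h]

theorem rfold_one_reverse (a : List B) : cs.rfold 1 a.reverse = cs.lfold 1 a := by
  induction a with
  | nil => rfl
  | cons s a ih =>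
    have e : cs.lstep 1 s = cs.rstep 1 s := by
      rw [lstep_of_not_isLeftDescent cs (cs.not_isLeftDescent_one s),
        rstep_of_not_isRightDescent cs (cs.not_isRightDescent_one s), mul_one, one_mul]
    rw [List.reverse_cons, rfold_append, ih, lfold, lfold, List.foldl_cons, e]
    exact cs.rfold_lfold 1 a [s]

/-- Multiplying an element shortest in its coset by an alternating word increases the length at
each step, as long as the word is not longer than `m(s,t)`. -/
theorem not_isRightDescent_mul_altWord {w : W} {s t : B} (hst : s ≠ t)
    (hs : ¬ cs.IsRightDescent w s) (ht : ¬ cs.IsRightDescent w t) {n : ℕ}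
    (hn : M s t = 0 ∨ n < M s t) :
    ¬ cs.IsRightDescent (w * cs.wordProd (altWord s t n)) (if Even n then s else t) := by
  rw [← isPosVec_root_iff]
  refine ⟨cs.root_ne_zero _ _, fun x => ?_⟩
  rw [root_mul_altWord]
  have h1 := (cs.isPosVec_root_iff.2 hs).2 x
  have h2 := (cs.isPosVec_root_iff.2 ht).2 x
  have h3 := sineRatio_nonneg M hst (n := n + 1) (by omega)
  have h4 := sineRatio_nonneg M hst (n := n) (by omega)
  simp only [Pi.add_apply, Pi.smul_apply, smul_eq_mul]
  positivity

theorem rfold_altWord {w : W} {s t : B} (hst : s ≠ t)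
    (hs : ¬ cs.IsRightDescent w s) (ht : ¬ cs.IsRightDescent w t) {n : ℕ}
    (hn : M s t = 0 ∨ n ≤ M s t) :
    cs.rfold w (altWord s t n) = w * cs.wordProd (altWord s t n) := by
  induction n with
  | zero => simp [altWord, rfold]
  | succ n ih =>
    rw [altWord_succ', rfold_append, ih (by omega), rfold, List.foldl_cons, List.foldl_nil,
      rstep_of_not_isRightDescent cs (cs.not_isRightDescent_mul_altWord hst hs ht (by omega)),
      wordProd_append, wordProd_singleton, mul_assoc]

/-- Both alternating words with `m(s,t)` letters have the same Demazure product. -/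
theorem rfold_one_altWord_comm (s t : B) :
    cs.rfold 1 (altWord s t (M s t)) = cs.rfold 1 (altWord t s (M s t)) := by
  by_cases hst : s = t
  · rw [hst]
  · rw [cs.rfold_altWord hst (cs.not_isRightDescent_one s) (cs.not_isRightDescent_one t)
      (Or.inr le_rfl), cs.rfold_altWord (Ne.symm hst) (cs.not_isRightDescent_one t)
      (cs.not_isRightDescent_one s) (Or.inr (M.symmetric s t).le), wordProd_altWord_eq]

/-- The Demazure product of any word in `s` and `t` which ends with an alternating word of `m(s,t)`
letters is the longest element of the dihedral parabolic subgroup. -/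
theorem rfold_one_append_altWord {s t : B} (hM : M s t ≠ 0) {b : List B}
    (hb : ∀ x ∈ b, x = s ∨ x = t) :
    cs.rfold 1 (b ++ altWord s t (M s t)) = cs.rfold 1 (altWord s t (M s t)) := by
  have hd : ∀ x, x = s ∨ x = t → cs.IsRightDescent (cs.rfold 1 (altWord s t (M s t))) x := by
    have key : ∀ s t : B, M s t ≠ 0 → ∃ y, (y = if Even (M s t - 1) then s else t) ∧
        cs.IsRightDescent (cs.rfold 1 (altWord s t (M s t))) y := by
      intro s t hM
      obtain ⟨n, hn⟩ := Nat.exists_eq_succ_of_ne_zero hM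
      refine ⟨_, rfl, ?_⟩
      rw [hn, altWord_succ', rfold_append]
      exact cs.isRightDescent_rstep _ _
    obtain ⟨y, hy, h1⟩ := key s t hM
    obtain ⟨y', hy', h2⟩ := key t s (by rwa [M.symmetric])
    rw [M.symmetric t s] at hy' h2
    rw [← cs.rfold_one_altWord_comm s t] at h2
    intro x hx
    by_cases he : Even (M s t - 1)
    · rw [if_pos he] at hy hy'; rcases hx with rfl | rfl
      · exact hy ▸ h1
      · exact hy' ▸ h2
    · rw [if_neg he] at hy hy'; rcases hx with rfl | rfl
      · exact hy' ▸ h2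
      · exact hy ▸ h1
  induction b using List.reverseRecOn with
  | nil => rfl
  | append_singleton b x ih =>
    have hb' : ∀ y ∈ b, y = s ∨ y = t := fun y hy => hb y (by simp [hy])
    obtain ⟨n, hn⟩ := Nat.exists_eq_succ_of_ne_zero hM
    rcases hb x (by simp) with rfl | rfl
    · have e : ∀ w, cs.rfold w (x :: altWord x t (M x t)) = cs.rfold w (altWord x t (M x t)) := by
        intro w
        rw [hn, altWord, rfold, rfold, List.foldl_cons, List.foldl_cons, List.foldl_cons,
          rstep_of_isRightDescent cs (cs.isRightDescent_rstep w x)]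
      rw [List.append_assoc, rfold_append, List.singleton_append, e, ← rfold_append]
      exact ih hb'
    · have e : x :: altWord s x (M s x) =
          altWord x s (M s x) ++ [if Even (M s x) then x else s] := by
        rw [← altWord_succ', altWord]
      have h1 : cs.rfold 1 (b ++ altWord x s (M s x)) = cs.rfold 1 (altWord s x (M s x)) := by
        rw [rfold_append, ← cs.rfold_congr (cs.rfold_one_altWord_comm s x), ← rfold_append]
        exact ih hb'
      rw [List.append_assoc, List.singleton_append, e, ← List.append_assoc, rfold_append, h1]
      exact rstep_of_isRightDescent cs (hd _ (by split_ifs <;> simp))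

end CoxeterSystem

/-! ### The action of words on twisted involutions -/

namespace CoxeterTwist

open CoxeterSystem

section

variable {B W : Type*} [Group W] {M : CoxeterMatrix B} {cs : CoxeterSystem M W}
  (τ : CoxeterTwist cs)

/-- The element `s^* ∘ z ∘ s`. -/
noncomputable def istep (z : W) (s : B) : W := cs.lstep (cs.rstep z s) (τ.gen s)

/-- The element `sₙ^* ∘ ⋯ ∘ s₁^* ∘ z ∘ s₁ ∘ ⋯ ∘ sₙ`. -/
noncomputable def ifold (z : W) (a : List B) : W := a.foldl τ.istep z

/-- Each letter of the word changes the current element, when the letters of the word are applied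
in turn to `z` by the operation `istep`. -/
def Ascends : W → List B → Prop
  | _, [] => True
  | z, s :: a => ¬ cs.IsRightDescent z s ∧ Ascends (τ.istep z s) a

theorem ifold_nil (z : W) : τ.ifold z [] = z := rfl

theorem ifold_cons (z : W) (s : B) (a : List B) :
    τ.ifold z (s :: a) = τ.ifold (τ.istep z s) a := rfl

theorem ifold_append (z : W) (a b : List B) : τ.ifold z (a ++ b) = τ.ifold (τ.ifold z a) b :=
  List.foldl_append

theorem ascends_append {z : W} {a b : List B} :
    τ.Ascends z (a ++ b) ↔ τ.Ascends z a ∧ τ.Ascends (τ.ifold z a) b := by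
  induction a generalizing z with
  | nil => simp [Ascends, ifold_nil]
  | cons s a ih => rw [List.cons_append, Ascends, Ascends, ih, ifold_cons, and_assoc]

theorem ascends_singleton {z : W} {s : B} : τ.Ascends z [s] ↔ ¬ cs.IsRightDescent z s := by
  simp [Ascends]

theorem one_mem_twistedInvolutions : (1 : W) ∈ τ.twistedInvolutions := by
  simp [twistedInvolutions]

end

variable {B W : Type*} [Fintype B] [Group W] {M : CoxeterMatrix B} {cs : CoxeterSystem M W}
  (τ : CoxeterTwist cs)

theorem ifold_eq_lfold_rfold (z : W) (a : List B) :
    τ.ifold z a = cs.lfold (cs.rfold z a) (a.map τ.gen) := by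
  induction a generalizing z with
  | nil => rfl
  | cons s a ih => rw [ifold_cons, ih, istep, rfold_lstep]; rfl

theorem involutionProd_eq_ifold (a : List B) : τ.involutionProd a = τ.ifold 1 a := by
  rw [involutionProd, demazureProd_eq_rfold, rfold_append, rfold_one_reverse, rfold_lfold,
    ifold_eq_lfold_rfold]

theorem rfold_map_gen (w : W) (a : List B) :
    cs.rfold (τ.toMulEquiv w) (a.map τ.gen) = τ.toMulEquiv (cs.rfold w a) := by
  induction a generalizing w with
  | nil => rfl
  | cons s a ih =>
    have : cs.rstep (τ.toMulEquiv w) (τ.gen s) = τ.toMulEquiv (cs.rstep w s) := by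
      by_cases h : cs.IsRightDescent w s
      · rw [cs.rstep_of_isRightDescent h, cs.rstep_of_isRightDescent (τ.isRightDescent_gen.2 h)]
      · rw [cs.rstep_of_not_isRightDescent h,
          cs.rstep_of_not_isRightDescent (fun h' => h (τ.isRightDescent_gen.1 h')), map_mul,
          map_simple]
    rw [List.map_cons, rfold, List.foldl_cons, this]
    exact ih _

/-- Words with the same Demazure product act in the same way on twisted involutions. -/
theorem ifold_congr {a b : List B} (h : cs.rfold 1 a = cs.rfold 1 b) (z : W) :
    τ.ifold z a = τ.ifold z b := by
  rw [ifold_eq_lfold_rfold, ifold_eq_lfold_rfold, cs.rfold_congr h]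
  apply cs.lfold_congr
  have := fun a => τ.rfold_map_gen 1 a
  simp only [map_one] at this
  rw [this, this, h]

theorem istep_mem {z : W} (hz : z ∈ τ.twistedInvolutions) (s : B) :
    τ.istep z s ∈ τ.twistedInvolutions := by
  have e : ∀ w, τ.toMulEquiv (cs.rstep w s) = cs.rstep (τ.toMulEquiv w) (τ.gen s) := fun w =>
    (τ.rfold_map_gen w [s]).symm
  have e' : ∀ w, τ.toMulEquiv (cs.lstep w (τ.gen s)) = cs.lstep (τ.toMulEquiv w) s := by
    intro w
    have := τ.rfold_map_gen w⁻¹ [τ.gen s]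
    rw [← inv_inj, inv_rfold, map_inv, inv_inv, ← map_inv, inv_rfold, inv_inv] at this
    simp only [List.map_cons, List.map_nil, gen_gen] at this
    exact this.symm
  change τ.toMulEquiv _ = _
  rw [istep, e', e, hz, inv_lstep, inv_rstep, rstep_lstep]

end CoxeterTwist

namespace CoxeterTwist

open CoxeterSystem

variable {B W : Type*} [Fintype B] [Group W] {M : CoxeterMatrix B} {cs : CoxeterSystem M W}
  (τ : CoxeterTwist cs)

theorem ifold_mem {z : W} (hz : z ∈ τ.twistedInvolutions) (a : List B) :
    τ.ifold z a ∈ τ.twistedInvolutions := by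
  induction a generalizing z with
  | nil => exact hz
  | cons s a ih => exact ih (τ.istep_mem hz s)

theorem isLeftDescent_gen_iff {z : W} (hz : z ∈ τ.twistedInvolutions) (s : B) :
    cs.IsLeftDescent z (τ.gen s) ↔ cs.IsRightDescent z s := by
  rw [← isRightDescent_inv_iff, ← hz, isRightDescent_gen]

theorem istep_of_isRightDescent {z : W} (hz : z ∈ τ.twistedInvolutions) {s : B}
    (h : cs.IsRightDescent z s) : τ.istep z s = z := by
  rw [istep, rstep_of_isRightDescent cs h,
    lstep_of_isLeftDescent cs ((τ.isLeftDescent_gen_iff hz s).2 h)]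

theorem istep_of_root_eq {z : W} {s : B} (h : cs.root z s = simpleRoot ℝ (τ.gen s)) :
    τ.istep z s = z * cs.simple s := by
  have hd : ¬ cs.IsRightDescent z s := by
    rw [← isPosVec_root_iff, h]; exact isPosVec_simpleRoot _
  have e := cs.mul_simple_eq_simple_mul h
  rw [istep, rstep_of_not_isRightDescent cs hd, lstep_of_isLeftDescent]
  have := cs.not_isRightDescent_iff.1 hd
  rw [IsLeftDescent, this, e, simple_mul_simple_cancel_left]
  omega

theorem length_simple_mul_mul_simple {z : W} (hz : z ∈ τ.twistedInvolutions) {s : B}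
    (hd : ¬ cs.IsRightDescent z s) (h : cs.root z s ≠ simpleRoot ℝ (τ.gen s)) :
    cs.length (cs.simple (τ.gen s) * z * cs.simple s) = cs.length z + 2 := by
  have h1 := cs.not_isLeftDescent_iff.1 (fun h' => hd ((τ.isLeftDescent_gen_iff hz s).1 h'))
  have h2 := cs.not_isRightDescent_iff.1
    (fun h' => h ((cs.isRightDescent_simple_mul_iff (s := τ.gen s) hd).1 h'))
  omega

theorem istep_of_root_ne {z : W} (hz : z ∈ τ.twistedInvolutions) {s : B}
    (hd : ¬ cs.IsRightDescent z s) (h : cs.root z s ≠ simpleRoot ℝ (τ.gen s)) :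
    τ.istep z s = cs.simple (τ.gen s) * z * cs.simple s := by
  have h1 := τ.length_simple_mul_mul_simple hz hd h
  have h2 := cs.not_isRightDescent_iff.1 hd
  rw [istep, rstep_of_not_isRightDescent cs hd, lstep_of_not_isLeftDescent, mul_assoc]
  rw [IsLeftDescent, ← mul_assoc]
  omega

theorem isRightDescent_istep (z : W) (s : B) :
    cs.IsRightDescent (τ.istep z s) s := by
  rw [istep, ← rstep_lstep]
  exact cs.isRightDescent_rstep _ _

theorem length_lt_length_istep {z : W} (hz : z ∈ τ.twistedInvolutions) {s : B}
    (hd : ¬ cs.IsRightDescent z s) : cs.length z < cs.length (τ.istep z s) := by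
  by_cases h : cs.root z s = simpleRoot ℝ (τ.gen s)
  · rw [τ.istep_of_root_eq h, cs.not_isRightDescent_iff.1 hd]; omega
  · rw [τ.istep_of_root_ne hz hd h, τ.length_simple_mul_mul_simple hz hd h]; omega

/-- The image of `α_s` under `istep z s` tells whether that element is `z s` or `s^* z s`. -/
theorem root_istep_self_eq_iff {z : W} (hz : z ∈ τ.twistedInvolutions) {s : B}
    (hd : ¬ cs.IsRightDescent z s) :
    cs.root (τ.istep z s) s = -simpleRoot ℝ (τ.gen s) ↔
      cs.root z s = simpleRoot ℝ (τ.gen s) := by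
  by_cases h : cs.root z s = simpleRoot ℝ (τ.gen s)
  · simp [τ.istep_of_root_eq h, root_mul_simple_self, h]
  · rw [τ.istep_of_root_ne hz hd h, root_mul_simple_self, root_simple_mul, neg_inj]
    refine ⟨fun h' => ?_, fun h' => absurd h' h⟩
    have h2 := congrArg (simpleReflection M (τ.gen s)) h'
    rw [simpleReflection_sq, simpleReflection_self] at h2
    exact absurd (cs.isPosVec_root_iff.2 hd)
      (fun h3 => h3.not_isNegVec (h2 ▸ (isPosVec_simpleRoot _).neg))

theorem istep_cancel {y z : W} (hy : y ∈ τ.twistedInvolutions) (hz : z ∈ τ.twistedInvolutions)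
    {s : B} (hdy : ¬ cs.IsRightDescent y s) (hdz : ¬ cs.IsRightDescent z s)
    (h : τ.istep y s = τ.istep z s) : y = z := by
  have h1 := τ.root_istep_self_eq_iff hy hdy
  rw [h, τ.root_istep_self_eq_iff hz hdz] at h1
  by_cases hr : cs.root z s = simpleRoot ℝ (τ.gen s)
  · rw [τ.istep_of_root_eq hr, τ.istep_of_root_eq (h1.1 hr)] at h
    exact mul_right_cancel h
  · rw [τ.istep_of_root_ne hz hdz hr, τ.istep_of_root_ne hy hdy (fun h' => hr (h1.2 h'))] at h
    exact mul_left_cancel (mul_right_cancel h)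

/-- The element `z` with `istep z s = w`, for a descent `s` of `w`. -/
theorem exists_istep_eq {w : W} (hw : w ∈ τ.twistedInvolutions) {s : B}
    (hd : cs.IsRightDescent w s) :
    ∃ z ∈ τ.twistedInvolutions, ¬ cs.IsRightDescent z s ∧ τ.istep z s = w ∧
      ((cs.root w s = -simpleRoot ℝ (τ.gen s) ∧ z = w * cs.simple s ∧
        z = cs.simple (τ.gen s) * w) ∨
       (cs.root w s ≠ -simpleRoot ℝ (τ.gen s) ∧ z = cs.simple (τ.gen s) * w * cs.simple s)) := by
  have hd' := cs.isRightDescent_iff_not_isRightDescent_mul.1 hd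
  by_cases h : cs.root w s = -simpleRoot ℝ (τ.gen s)
  · have hr : cs.root (w * cs.simple s) s = simpleRoot ℝ (τ.gen s) := by
      rw [root_mul_simple_self, h, neg_neg]
    have e : w * cs.simple s = cs.simple (τ.gen s) * w := by
      have := cs.mul_simple_eq_simple_mul hr
      rw [simple_mul_simple_cancel_right] at this
      rw [this, simple_mul_simple_cancel_left, ← this]
    refine ⟨w * cs.simple s, ?_, hd', ?_, Or.inl ⟨h, rfl, e⟩⟩
    · change τ.toMulEquiv _ = _
      rw [e, map_mul, map_simple, gen_gen, hw, mul_inv_rev, inv_simple, ← inv_simple cs s,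
        ← mul_inv_rev, e, mul_inv_rev, inv_simple]
    · rw [τ.istep_of_root_eq hr, simple_mul_simple_cancel_right]
  · have hmem : cs.simple (τ.gen s) * w * cs.simple s ∈ τ.twistedInvolutions := by
      change τ.toMulEquiv _ = _
      rw [map_mul, map_mul, map_simple, map_simple, gen_gen, hw]
      simp [mul_assoc]
    have hn : ¬ cs.IsRightDescent (cs.simple (τ.gen s) * w * cs.simple s) s := by
      rw [mul_assoc]
      intro h'
      have h2 := (cs.isRightDescent_simple_mul_iff hd').1 h'
      rw [root_mul_simple_self] at h2
      exact h (by rw [← h2, neg_neg])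
    have hr : cs.root (cs.simple (τ.gen s) * w * cs.simple s) s ≠ simpleRoot ℝ (τ.gen s) := by
      intro h'
      rw [root_mul_simple_self, root_simple_mul, ← map_neg] at h'
      have h2 := congrArg (simpleReflection M (τ.gen s)) h'
      rw [simpleReflection_sq, simpleReflection_self, neg_inj] at h2
      have h3 := cs.isNegVec_root_iff.2 hd
      rw [h2] at h3
      exact (isPosVec_simpleRoot _).not_isNegVec h3
    refine ⟨_, hmem, hn, ?_, Or.inr ⟨h, rfl⟩⟩
    rw [τ.istep_of_root_ne hmem hn hr]
    simp [mul_assoc]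

/-! ### The rank of a twisted involution -/

/-- A statistic on twisted involutions which grows by `4` with each letter of an involution word:
the step from `z` to `z s` raises the length by `1` and lowers the trace of `v ↦ (z v)^*` by `2`,
and the step from `z` to `s^* z s` raises the length by `2` and preserves the trace. -/
noncomputable def rank (z : W) : ℝ :=
  2 * cs.length z - LinearMap.trace ℝ (B → ℝ) (τ.starEnd * cs.geom z)

theorem starEnd_mul_geom_simple (s : B) :
    τ.starEnd * cs.geom (cs.simple (τ.gen s)) = cs.geom (cs.simple s) * τ.starEnd := by
  refine LinearMap.ext fun v => ?_
  rw [Module.End.mul_apply, Module.End.mul_apply, geom_simple, geom_simple,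
    starEnd_simpleReflection, gen_gen]

theorem rank_istep {z : W} (hz : z ∈ τ.twistedInvolutions) {s : B}
    (hd : ¬ cs.IsRightDescent z s) : τ.rank (τ.istep z s) = τ.rank z + 4 := by
  by_cases h : cs.root z s = simpleRoot ℝ (τ.gen s)
  · have e : τ.starEnd * cs.geom (z * cs.simple s) =
        τ.starEnd * cs.geom z - (corootForm M s).smulRight (simpleRoot ℝ s) := by
      refine LinearMap.ext fun v => ?_
      rw [Module.End.mul_apply, geom_mul_apply, geom_simple, simpleReflection_apply, map_sub,
        map_sub, map_smul, map_smul, ← root, h, starEnd_simpleRoot, gen_gen]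
      rfl
    rw [τ.istep_of_root_eq h, rank, rank, e, map_sub, LinearMap.trace_smulRight,
      corootForm_simpleRoot, rootForm_self, cs.not_isRightDescent_iff.1 hd]
    push_cast; ring
  · have e : LinearMap.trace ℝ (B → ℝ)
        (τ.starEnd * cs.geom (cs.simple (τ.gen s) * z * cs.simple s)) =
        LinearMap.trace ℝ (B → ℝ) (τ.starEnd * cs.geom z) := by
      rw [MonoidHom.map_mul, MonoidHom.map_mul, ← mul_assoc, ← mul_assoc, starEnd_mul_geom_simple,
        LinearMap.trace_mul_comm, ← mul_assoc, ← mul_assoc, ← map_mul, simple_mul_simple_self,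
        map_one, one_mul]
    rw [τ.istep_of_root_ne hz hd h, rank, rank, e, τ.length_simple_mul_mul_simple hz hd h]
    push_cast; ring

theorem rank_ifold_le {z : W} (hz : z ∈ τ.twistedInvolutions) (a : List B) :
    τ.rank (τ.ifold z a) ≤ τ.rank z + 4 * a.length := by
  induction a generalizing z with
  | nil => simp [ifold_nil]
  | cons s a ih =>
    have := ih (τ.istep_mem hz s)
    rw [ifold_cons]
    by_cases hd : cs.IsRightDescent z s
    · rw [τ.istep_of_isRightDescent hz hd] at this ⊢
      push_cast [List.length_cons]; linarith
    · rw [τ.rank_istep hz hd] at this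
      push_cast [List.length_cons]; linarith

theorem ascends_iff_rank {z : W} (hz : z ∈ τ.twistedInvolutions) (a : List B) :
    τ.Ascends z a ↔ τ.rank (τ.ifold z a) = τ.rank z + 4 * a.length := by
  induction a generalizing z with
  | nil => simp [ifold_nil, Ascends]
  | cons s a ih =>
    rw [Ascends, ih (τ.istep_mem hz s), ifold_cons]
    by_cases hd : cs.IsRightDescent z s
    · have := τ.rank_ifold_le hz a
      rw [τ.istep_of_isRightDescent hz hd]
      simp only [hd, not_true_eq_false, false_and, false_iff]
      push_cast [List.length_cons]; intro h; linarith
    · rw [τ.rank_istep hz hd]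
      simp only [hd, not_false_eq_true, true_and]
      push_cast [List.length_cons]
      constructor <;> intro h <;> linarith

theorem exists_ascends {w : W} (hw : w ∈ τ.twistedInvolutions) :
    ∃ a, τ.Ascends 1 a ∧ τ.ifold 1 a = w := by
  induction hk : cs.length w using Nat.strong_induction_on generalizing w with
  | _ k ih =>
  by_cases h1 : w = 1
  · exact ⟨[], trivial, h1.symm⟩
  obtain ⟨s, hs⟩ := cs.exists_rightDescent_of_ne_one h1
  obtain ⟨z, hz, hd, rfl, -⟩ := τ.exists_istep_eq hw hs
  obtain ⟨a, ha, rfl⟩ := ih _ (hk ▸ τ.length_lt_length_istep hz hd) hz rfl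
  exact ⟨a ++ [s], by rw [ascends_append, ascends_singleton]; exact ⟨ha, hd⟩,
    by rw [ifold_append]; rfl⟩

/-- The involution words are the words which ascend from the identity. -/
theorem mem_involutionWords_iff {w : W} {a : List B} :
    a ∈ τ.involutionWords w ↔ τ.Ascends 1 a ∧ τ.ifold 1 a = w := by
  have h1 := τ.one_mem_twistedInvolutions
  constructor
  · rintro ⟨h, hmin⟩
    rw [involutionProd_eq_ifold] at h
    refine ⟨?_, h⟩
    have hw : w ∈ τ.twistedInvolutions := h ▸ τ.ifold_mem h1 a
    obtain ⟨b, hb, hbw⟩ := τ.exists_ascends hw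
    have hlen := hmin b (by rw [involutionProd_eq_ifold, hbw])
    rw [ascends_iff_rank _ h1] at hb ⊢
    have hle := τ.rank_ifold_le h1 a
    have : (a.length : ℝ) ≤ b.length := by exact_mod_cast hlen
    rw [hbw, ← h] at hb
    linarith
  · rintro ⟨ha, h⟩
    refine ⟨by rw [involutionProd_eq_ifold, h], fun b hb => ?_⟩
    rw [involutionProd_eq_ifold] at hb
    have hle := τ.rank_ifold_le h1 b
    rw [ascends_iff_rank _ h1] at ha
    rw [hb, ← h, ha] at hle
    have : (a.length : ℝ) ≤ b.length := by linarith
    exact_mod_cast this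

theorem isInvolutionWord_iff {a : List B} : τ.IsInvolutionWord a ↔ τ.Ascends 1 a := by
  constructor
  · rintro ⟨w, -, h⟩
    exact (τ.mem_involutionWords_iff.1 h).1
  · intro h
    exact ⟨_, τ.ifold_mem τ.one_mem_twistedInvolutions a, τ.mem_involutionWords_iff.2 ⟨h, rfl⟩⟩

theorem length_eq_of_ascends {z : W} (hz : z ∈ τ.twistedInvolutions) {a b : List B}
    (ha : τ.Ascends z a) (hb : τ.Ascends z b) (h : τ.ifold z a = τ.ifold z b) :
    a.length = b.length := by
  rw [ascends_iff_rank _ hz] at ha hb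
  have : (a.length : ℝ) = b.length := by rw [h] at ha; linarith
  exact_mod_cast this

theorem ascends_of_length_le {z : W} (hz : z ∈ τ.twistedInvolutions) {a b : List B}
    (ha : τ.Ascends z a) (h : τ.ifold z b = τ.ifold z a) (hl : b.length ≤ a.length) :
    τ.Ascends z b := by
  have hle := τ.rank_ifold_le hz b
  rw [ascends_iff_rank _ hz] at ha ⊢
  have : (b.length : ℝ) ≤ a.length := by exact_mod_cast hl
  rw [h] at hle ⊢
  linarith

/-- A word which ascends from a twisted involution is reduced. Otherwise it could be shortened
without changing its Demazure product. -/
theorem isReduced_of_ascends {z : W} {a : List B}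
    (ha : τ.Ascends z a) : cs.IsReduced a := by
  have key : cs.rfold 1 a = cs.wordProd a ∧ cs.IsReduced a := by
    induction a using List.reverseRecOn with
    | nil => simp [rfold, CoxeterSystem.IsReduced]
    | append_singleton a s ih =>
      rw [ascends_append, ascends_singleton] at ha
      obtain ⟨h1, h2⟩ := ih ha.1
      have hd : ¬ cs.IsRightDescent (cs.wordProd a) s := by
        intro hd
        have e : cs.rfold 1 (a ++ [s]) = cs.rfold 1 a := by
          rw [rfold_append, h1]; exact cs.rstep_of_isRightDescent hd
        have e2 := τ.ifold_congr e z
        rw [ifold_append] at e2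
        have := τ.isRightDescent_istep (τ.ifold z a) s
        rw [show τ.istep (τ.ifold z a) s = τ.ifold z a from e2] at this
        exact ha.2 this
      refine ⟨?_, ?_⟩
      · rw [rfold_append, h1, wordProd_append, wordProd_singleton]
        exact cs.rstep_of_not_isRightDescent hd
      · rw [CoxeterSystem.IsReduced, wordProd_append, wordProd_singleton,
          cs.not_isRightDescent_iff.1 hd, h2.eq]
        simp
  exact key.2

end CoxeterTwist

/-! ### Twisted involutions and dihedral parabolic subgroups -/

namespace CoxeterSystem

section

variable {B : Type*} (M : CoxeterMatrix B)

theorem mem_altWord {s t x : B} {n : ℕ} (h : x ∈ altWord s t n) : x = s ∨ x = t := by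
  induction n generalizing s t with
  | zero => simp [altWord] at h
  | succ n ih =>
    rw [altWord, List.mem_cons] at h
    rcases h with rfl | h
    · exact Or.inl rfl
    · exact (ih h).symm

theorem sineRatio_pos {s t : B} (hst : s ≠ t) {n : ℕ} (h0 : 1 ≤ n) (hn : n < M s t) :
    0 < sineRatio (-rootForm M s t) n := by
  have hM : M s t ≠ 0 := by omega
  have hs := sin_pi_div_pos M hst hM
  have hm : (0 : ℝ) < M s t := by exact_mod_cast Nat.pos_of_ne_zero hM
  have h1 : (1 : ℝ) ≤ n := by exact_mod_cast h0
  have h2 : (n : ℝ) < M s t := by exact_mod_cast hn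
  have : 0 < Real.sin (n * (Real.pi / (M s t : ℝ))) := by
    apply Real.sin_pos_of_pos_of_lt_pi
    · have := Real.pi_pos; positivity
    · rw [← mul_div_assoc, div_lt_iff₀ hm]
      nlinarith [Real.pi_pos]
  rw [← sin_mul_sineRatio] at this
  rw [rootForm, neg_neg]
  exact pos_of_mul_pos_right this hs.le

theorem sineRatio_self {s t : B} (hst : s ≠ t) (hM : M s t ≠ 0) :
    sineRatio (-rootForm M s t) (M s t) = 0 := by
  have hs := sin_pi_div_pos M hst hM
  have hm : (M s t : ℝ) ≠ 0 := by exact_mod_cast hM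
  have := sin_mul_sineRatio (Real.pi / (M s t : ℝ)) (M s t)
  rw [mul_div_cancel₀ _ hm, Real.sin_pi] at this
  rw [rootForm, neg_neg]
  exact (mul_eq_zero.1 this).resolve_left hs.ne'

theorem sineRatio_self_sub_one {s t : B} (hst : s ≠ t) (hM : M s t ≠ 0) :
    sineRatio (-rootForm M s t) (M s t - 1) = 1 := by
  have hs := sin_pi_div_pos M hst hM
  have hm : (M s t : ℝ) ≠ 0 := by exact_mod_cast hM
  have := sin_mul_sineRatio (Real.pi / (M s t : ℝ)) (M s t - 1)
  rw [Nat.cast_sub (Nat.one_le_iff_ne_zero.2 hM), sub_mul, mul_div_cancel₀ _ hm, Nat.cast_one,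
    one_mul, Real.sin_pi_sub] at this
  rw [rootForm, neg_neg]
  exact mul_left_cancel₀ hs.ne' (by rw [this, mul_one])

end

variable {B W : Type*} [Fintype B] [Group W] {M : CoxeterMatrix B} (cs : CoxeterSystem M W)

/-- If `s` and `t` are descents of an element, then they generate a finite group. -/
theorem matrix_ne_zero_of_isRightDescent {w : W} {s t : B} (hst : s ≠ t)
    (hs : cs.IsRightDescent w s) (ht : cs.IsRightDescent w t) : M s t ≠ 0 := by
  intro hM
  have key : ∀ n, cs.length (w * cs.wordProd (altWord s t n)) + n = cs.length w := by
    intro n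
    induction n with
    | zero => simp [altWord]
    | succ n ih =>
      have hd : cs.IsRightDescent (w * cs.wordProd (altWord s t n)) (if Even n then s else t) := by
        rw [← isNegVec_root_iff]
        refine ⟨cs.root_ne_zero _ _, fun x => ?_⟩
        rw [root_mul_altWord]
        have h1 := (cs.isNegVec_root_iff.2 hs).2 x
        have h2 := (cs.isNegVec_root_iff.2 ht).2 x
        have h3 := sineRatio_nonneg M hst (n := n + 1) (Or.inl hM)
        have h4 := sineRatio_nonneg M hst (n := n) (Or.inl hM)
        simp only [Pi.add_apply, Pi.smul_apply, smul_eq_mul]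
        have := mul_nonpos_of_nonneg_of_nonpos h3 h1
        have := mul_nonpos_of_nonneg_of_nonpos h4 h2
        linarith
      have := cs.isRightDescent_iff.1 hd
      rw [altWord_succ', wordProd_append, wordProd_singleton, ← mul_assoc]
      omega
  have := key (cs.length w + 1)
  omega

/-- The group generated by a set of simple reflections only changes the corresponding
coordinates. -/
theorem geom_wordProd_apply_of_notMem {c : List B} {x : B} (hx : x ∉ c) (v : B → ℝ) :
    cs.geom (cs.wordProd c) v x = v x := by
  induction c with
  | nil => simp
  | cons s c ih =>
    rw [List.mem_cons, not_or] at hx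
    rw [wordProd_cons, geom_mul_apply, geom_simple, simpleReflection_apply_of_ne M hx.1, ih hx.2]

/-- An element of the parabolic subgroup generated by `s` and `t` which has both descents is the
longest element. -/
theorem eq_wordProd_altWord {s t : B} (hst : s ≠ t) {c : List B} (hc : ∀ x ∈ c, x = s ∨ x = t)
    (hs : cs.IsRightDescent (cs.wordProd c) s) (ht : cs.IsRightDescent (cs.wordProd c) t) :
    cs.wordProd c = cs.wordProd (altWord s t (M s t)) := by
  have hM := cs.matrix_ne_zero_of_isRightDescent hst hs ht
  have key : ∀ (k : ℕ) (c : List B), (∀ x ∈ c, x = s ∨ x = t) → cs.length (cs.wordProd c) = k →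
      ∃ b, (∀ x ∈ b, x = s ∨ x = t) ∧ cs.rfold 1 b = cs.wordProd c := by
    intro k
    induction k using Nat.strong_induction_on with
    | _ k ih =>
    intro c hc hk
    by_cases h1 : cs.wordProd c = 1
    · exact ⟨[], by simp, h1.symm⟩
    obtain ⟨x, hx⟩ := cs.exists_rightDescent_of_ne_one h1
    have hxst : x = s ∨ x = t := by
      by_contra hcon
      push Not at hcon
      refine cs.not_isRightDescent_of_root_pos x ?_ hx
      rw [root, cs.geom_wordProd_apply_of_notMem, simpleRoot_self]
      · exact one_pos
      · intro hxc
        rcases hc x hxc with h | h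
        · exact hcon.1 h
        · exact hcon.2 h
    have hx' := cs.isRightDescent_iff.1 hx
    obtain ⟨b, hb, hbc⟩ := ih (cs.length (cs.wordProd (c ++ [x])))
      (by rw [wordProd_append, wordProd_singleton]; omega) (c ++ [x])
      (by simpa [or_imp, forall_and] using ⟨hc, hxst⟩) rfl
    refine ⟨b ++ [x], by simpa [or_imp, forall_and] using ⟨hb, hxst⟩, ?_⟩
    rw [rfold_append, hbc, wordProd_append, wordProd_singleton]
    have := cs.isRightDescent_iff_not_isRightDescent_mul.1 hx
    exact (cs.rstep_of_not_isRightDescent this).trans (by simp)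
  obtain ⟨b, hb, hbc⟩ := key _ c hc rfl
  have h1 : cs.rfold (cs.wordProd c) (altWord s t (M s t)) = cs.wordProd c := by
    refine cs.rfold_eq_self fun x hx => ?_
    rcases mem_altWord hx with rfl | rfl <;> assumption
  rw [← h1, ← hbc, ← rfold_append, cs.rfold_one_append_altWord hM hb,
    cs.rfold_altWord hst (cs.not_isRightDescent_one s) (cs.not_isRightDescent_one t)
      (Or.inr le_rfl), one_mul]

/-- The longest element of a finite dihedral parabolic subgroup negates the two simple roots, and
exchanges them if `m(s,t)` is odd. -/
theorem root_wordProd_altWord_self {s t : B} (hst : s ≠ t) (hM : M s t ≠ 0) :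
    cs.root (cs.wordProd (altWord s t (M s t))) t =
      -simpleRoot ℝ (if Even (M s t) then t else s) := by
  have key : ∀ s t : B, s ≠ t → M s t ≠ 0 →
      cs.root (cs.wordProd (altWord s t (M s t))) (if Even (M s t - 1) then s else t) =
        -simpleRoot ℝ t := by
    intro s t hst hM
    obtain ⟨m, hm⟩ := Nat.exists_eq_succ_of_ne_zero hM
    have e := cs.root_mul_altWord 1 s t m
    have h1 := sineRatio_self M hst hM
    have h2 := sineRatio_self_sub_one M hst hM
    rw [hm, Nat.succ_eq_add_one] at h1
    rw [hm, Nat.succ_eq_add_one, Nat.add_sub_cancel] at h2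
    rw [one_mul, root_one, root_one, h1, h2, zero_smul, one_smul, zero_add] at e
    rw [hm, Nat.succ_eq_add_one, Nat.add_sub_cancel, altWord_succ', wordProd_append,
      wordProd_singleton, root_mul_simple_self, e]
  by_cases he : Even (M s t)
  · have h1 := key s t hst hM
    have : ¬ Even (M s t - 1) := by
      rw [Nat.even_iff] at he ⊢; omega
    rw [if_neg this] at h1
    rw [if_pos he]
    exact h1
  · have h1 := key t s (Ne.symm hst) (by rwa [M.symmetric])
    have : Even (M s t - 1) := by
      rw [Nat.even_iff] at he ⊢; omega
    rw [M.symmetric t s, if_pos this, ← wordProd_altWord_eq] at h1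
    rw [if_neg he]
    exact h1

end CoxeterSystem

namespace CoxeterTwist

open CoxeterSystem

variable {B W : Type*} [Fintype B] [Group W] {M : CoxeterMatrix B} {cs : CoxeterSystem M W}
  (τ : CoxeterTwist cs)

theorem ifold_eq_self {z : W} (hz : z ∈ τ.twistedInvolutions) {a : List B}
    (h : ∀ x ∈ a, cs.IsRightDescent z x) : τ.ifold z a = z := by
  induction a with
  | nil => rfl
  | cons s a ih =>
    rw [ifold_cons, τ.istep_of_isRightDescent hz (h s (by simp)),
      ih fun x hx => h x (by simp [hx])]

theorem ifold_altWord_comm (z : W) (s t : B) :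
    τ.ifold z (altWord s t (M s t)) = τ.ifold z (altWord t s (M s t)) :=
  τ.ifold_congr (cs.rfold_one_altWord_comm s t) z

theorem isRightDescent_ifold_altWord (z : W) {s t : B} (hM : M s t ≠ 0) :
    cs.IsRightDescent (τ.ifold z (altWord s t (M s t))) s ∧
      cs.IsRightDescent (τ.ifold z (altWord s t (M s t))) t := by
  have key : ∀ s t : B, M s t ≠ 0 → cs.IsRightDescent (τ.ifold z (altWord s t (M s t)))
      (if Even (M s t - 1) then s else t) := by
    intro s t hM
    obtain ⟨m, hm⟩ := Nat.exists_eq_succ_of_ne_zero hM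
    rw [hm, altWord_succ', ifold_append]
    exact τ.isRightDescent_istep _ _
  have h1 := key s t hM
  have h2 := key t s (by rwa [M.symmetric])
  rw [M.symmetric t s, ← ifold_altWord_comm] at h2
  by_cases he : Even (M s t - 1)
  · rw [if_pos he] at h1 h2; exact ⟨h1, h2⟩
  · rw [if_neg he] at h1 h2; exact ⟨h2, h1⟩

/-- Starting from a twisted involution for which `s` and `t` are ascents, both alternating words
reach the element with descents `s` and `t` after the same number of letters. -/
theorem exists_ascends_altWord {z : W} (hz : z ∈ τ.twistedInvolutions) {s t : B}
    (hs : ¬ cs.IsRightDescent z s) (ht : ¬ cs.IsRightDescent z t) (hM : M s t ≠ 0) :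
    ∃ n, 1 ≤ n ∧ n ≤ M s t ∧ τ.Ascends z (altWord s t n) ∧ τ.Ascends z (altWord t s n) ∧
      τ.ifold z (altWord s t n) = τ.ifold z (altWord s t (M s t)) ∧
      τ.ifold z (altWord t s n) = τ.ifold z (altWord s t (M s t)) := by
  have key : ∀ s t : B, ¬ cs.IsRightDescent z s → ¬ cs.IsRightDescent z t → M s t ≠ 0 →
      ∃ n, 1 ≤ n ∧ n ≤ M s t ∧ τ.Ascends z (altWord s t n) ∧
        τ.ifold z (altWord s t n) = τ.ifold z (altWord s t (M s t)) := by
    intro s t hs ht hM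
    classical
    let P : ℕ → Prop := fun n => τ.Ascends z (altWord s t n)
    have h1 : P 1 := by simpa [P, altWord, Ascends] using hs
    have hM1 : 1 ≤ M s t := Nat.one_le_iff_ne_zero.2 hM
    set n := Nat.findGreatest P (M s t) with hn
    have hn1 : 1 ≤ n := Nat.le_findGreatest hM1 h1
    have hnM : n ≤ M s t := Nat.findGreatest_le _
    have hPn : P n := Nat.findGreatest_spec (P := P) hM1 h1
    refine ⟨n, hn1, hnM, hPn, ?_⟩
    rcases hnM.eq_or_lt with h | h
    · rw [h]
    have hnot : ¬ P (n + 1) := Nat.findGreatest_is_greatest (Nat.lt_succ_self _) h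
    obtain ⟨k, hk⟩ : ∃ k, n = k + 1 := ⟨n - 1, by omega⟩
    have hd1 : cs.IsRightDescent (τ.ifold z (altWord s t n)) (if Even n then s else t) := by
      by_contra hcon
      apply hnot
      change τ.Ascends z (altWord s t (n + 1))
      rw [altWord_succ', ascends_append, ascends_singleton]
      exact ⟨hPn, hcon⟩
    have hd2 : cs.IsRightDescent (τ.ifold z (altWord s t n)) (if Even n then t else s) := by
      have e : (if Even n then t else s) = if Even k then s else t := by
        by_cases h : Even k <;> simp [h, hk, Nat.even_add_one]
      rw [e, hk, altWord_succ', ifold_append]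
      exact τ.isRightDescent_istep _ _
    have hd : ∀ x, x = s ∨ x = t → cs.IsRightDescent (τ.ifold z (altWord s t n)) x := by
      by_cases he : Even n
      · rw [if_pos he] at hd1 hd2; rintro x (rfl | rfl) <;> assumption
      · rw [if_neg he] at hd1 hd2; rintro x (rfl | rfl) <;> assumption
    have hstab : ∀ j, τ.ifold z (altWord s t (n + j)) = τ.ifold z (altWord s t n) := by
      intro j
      induction j with
      | zero => rfl
      | succ j ih =>
        rw [← add_assoc, altWord_succ', ifold_append, ih]
        refine τ.ifold_eq_self (τ.ifold_mem hz _) fun x hx => hd x ?_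
        rw [List.mem_singleton] at hx
        rw [hx]; split_ifs <;> simp
    rw [← hstab (M s t - n)]
    congr 2; omega
  obtain ⟨n, h1, h2, h3, h4⟩ := key s t hs ht hM
  obtain ⟨n', h1', h2', h3', h4'⟩ := key t s ht hs (by rwa [M.symmetric])
  rw [M.symmetric t s, ← ifold_altWord_comm] at h4'
  have hnn := τ.length_eq_of_ascends hz h3 h3' (h4.trans h4'.symm)
  rw [altWord_length, altWord_length] at hnn
  subst hnn
  exact ⟨n, h1, h2, h3, h3', h4, h4'⟩

/-- The twisted involutions with descents `s` and `t` arise from those with ascents `s` and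
`t`. -/
theorem exists_eq_ifold_altWord {w : W} (hw : w ∈ τ.twistedInvolutions) {s t : B} (hst : s ≠ t)
    (hs : cs.IsRightDescent w s) (ht : cs.IsRightDescent w t) :
    ∃ z ∈ τ.twistedInvolutions, ¬ cs.IsRightDescent z s ∧ ¬ cs.IsRightDescent z t ∧
      τ.ifold z (altWord s t (M s t)) = w := by
  have hM := cs.matrix_ne_zero_of_isRightDescent hst hs ht
  have key : ∀ (k : ℕ) (w : W), w ∈ τ.twistedInvolutions → cs.length w = k →
      ∃ z ∈ τ.twistedInvolutions, ¬ cs.IsRightDescent z s ∧ ¬ cs.IsRightDescent z t ∧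
        ∃ b : List B, (∀ x ∈ b, x = s ∨ x = t) ∧ τ.ifold z b = w := by
    intro k
    induction k using Nat.strong_induction_on with
    | _ k ih =>
    intro w hw hk
    by_cases h : ∃ x, (x = s ∨ x = t) ∧ cs.IsRightDescent w x
    · obtain ⟨x, hx, hd⟩ := h
      obtain ⟨y, hy, hyd, rfl, -⟩ := τ.exists_istep_eq hw hd
      obtain ⟨z, hz, hzs, hzt, b, hb, rfl⟩ :=
        ih _ (hk ▸ τ.length_lt_length_istep hy hyd) y hy rfl
      refine ⟨z, hz, hzs, hzt, b ++ [x], by simpa [or_imp, forall_and] using ⟨hb, hx⟩, ?_⟩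
      rw [ifold_append]; rfl
    · push Not at h
      exact ⟨w, hw, h s (Or.inl rfl), h t (Or.inr rfl), [], by simp, rfl⟩
  obtain ⟨z, hz, hzs, hzt, b, hb, hbw⟩ := key _ w hw rfl
  refine ⟨z, hz, hzs, hzt, ?_⟩
  rw [← τ.ifold_congr (cs.rfold_one_append_altWord hM hb), ifold_append, hbw]
  refine τ.ifold_eq_self hw fun x hx => ?_
  rcases mem_altWord hx with rfl | rfl <;> assumption

/-- The element reached from `z` lies in the double coset of `z`, and the left factor is a word in
the images of the letters under the twist. -/
theorem exists_ifold_eq_mul {z : W} (hz : z ∈ τ.twistedInvolutions) {a : List B}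
    (ha : τ.Ascends z a) : ∃ c : List B, (∀ x ∈ c, ∃ y ∈ a, x = τ.gen y) ∧
      τ.ifold z a = cs.wordProd c * z * cs.wordProd a := by
  induction a using List.reverseRecOn with
  | nil => exact ⟨[], by simp, by simp [ifold_nil]⟩
  | append_singleton a s ih =>
    rw [ascends_append, ascends_singleton] at ha
    obtain ⟨c, hc, e⟩ := ih ha.1
    have hc' : ∀ x ∈ c, ∃ y ∈ a ++ [s], x = τ.gen y := fun x hx => by
      obtain ⟨y, hy, h⟩ := hc x hx
      exact ⟨y, by simp [hy], h⟩
    rw [ifold_append, wordProd_append, wordProd_singleton]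
    change ∃ c, _ ∧ τ.istep (τ.ifold z a) s = _
    by_cases h : cs.root (τ.ifold z a) s = simpleRoot ℝ (τ.gen s)
    · exact ⟨c, hc', by rw [τ.istep_of_root_eq h, e]; simp [mul_assoc]⟩
    · refine ⟨τ.gen s :: c, ?_, ?_⟩
      · intro x hx
        rcases List.mem_cons.1 hx with rfl | hx
        · exact ⟨s, by simp, rfl⟩
        · exact hc' x hx
      · rw [τ.istep_of_root_ne (τ.ifold_mem hz a) ha.2 h, e, wordProd_cons]
        simp [mul_assoc]

/-- If fewer than `m(s,t)` letters suffice, then `z` maps the plane spanned by the two simple roots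
to the one spanned by their images under the twist. -/
theorem root_apply_eq_zero {z : W} (hz : z ∈ τ.twistedInvolutions) {s t : B} (hst : s ≠ t)
    (hs : ¬ cs.IsRightDescent z s) (ht : ¬ cs.IsRightDescent z t) {n : ℕ} (hn1 : 1 ≤ n)
    (hn : n < M s t) (ha : τ.Ascends z (altWord s t n))
    (hd : ∀ x, x = s ∨ x = t → cs.IsRightDescent (τ.ifold z (altWord s t n)) x) {x : B}
    (hxs : x ≠ τ.gen s) (hxt : x ≠ τ.gen t) : cs.root z t x = 0 := by
  obtain ⟨c, hc, e⟩ := τ.exists_ifold_eq_mul hz ha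
  have h1 := cs.isNegVec_root_iff.2 (hd (if Even n then s else t) (by split_ifs <;> simp))
  have h2 := h1.2 x
  have hxc : x ∉ c := by
    intro h
    obtain ⟨y, hy, rfl⟩ := hc x h
    rcases mem_altWord hy with rfl | rfl
    · exact hxs rfl
    · exact hxt rfl
  rw [e, mul_assoc, root, geom_mul_apply, cs.geom_wordProd_apply_of_notMem hxc, ← root,
    root_mul_altWord, Pi.add_apply, Pi.smul_apply, Pi.smul_apply, smul_eq_mul, smul_eq_mul] at h2
  have h3 := cs.root_nonneg_of_not_isRightDescent hs x
  have h4 := cs.root_nonneg_of_not_isRightDescent ht x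
  have h5 := sineRatio_nonneg M hst (n := n + 1) (by omega)
  have h6 := sineRatio_pos M hst hn1 hn
  have := mul_nonneg h5 h3
  by_contra hne
  have := mul_pos h6 (lt_of_le_of_ne h4 (Ne.symm hne))
  linarith

end CoxeterTwist

/-! ### The number of letters above a dihedral double coset -/

namespace CoxeterTwist

open CoxeterSystem

variable {B W : Type*} [Fintype B] [Group W] {M : CoxeterMatrix B} {cs : CoxeterSystem M W}
  (τ : CoxeterTwist cs)

theorem eq_smul_add_smul {B : Type*} {s t : B} (hst : s ≠ t) {v : B → ℝ}
    (h : ∀ x, x ≠ s → x ≠ t → v x = 0) :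
    v = v s • simpleRoot ℝ s + v t • simpleRoot ℝ t := by
  ext x
  simp only [Pi.add_apply, Pi.smul_apply, smul_eq_mul]
  by_cases hs : x = s
  · subst hs; rw [simpleRoot_self, simpleRoot_of_ne ℝ hst]; ring
  by_cases ht : x = t
  · subst ht; rw [simpleRoot_self, simpleRoot_of_ne ℝ hs]; ring
  rw [simpleRoot_of_ne ℝ hs, simpleRoot_of_ne ℝ ht, h x hs ht]; ring

/-- If `z` maps the plane spanned by the simple roots of two ascents `s`, `t` to the plane spanned
by their images under the twist, then it permutes these simple roots up to the twist: both `z` and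
its inverse are given by nonnegative matrices. -/
theorem root_eq_simpleRoot_gen {z : W} (hz : z ∈ τ.twistedInvolutions) {s t : B} (hst : s ≠ t)
    (hs : ¬ cs.IsRightDescent z s) (ht : ¬ cs.IsRightDescent z t)
    (hss : ∀ x, x ≠ τ.gen s → x ≠ τ.gen t → cs.root z s x = 0)
    (htt : ∀ x, x ≠ τ.gen s → x ≠ τ.gen t → cs.root z t x = 0) :
    (cs.root z s = simpleRoot ℝ (τ.gen s) ∧ cs.root z t = simpleRoot ℝ (τ.gen t)) ∨
      (cs.root z s = simpleRoot ℝ (τ.gen t) ∧ cs.root z t = simpleRoot ℝ (τ.gen s)) := by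
  have hst' := τ.gen_injective.ne hst
  have es := eq_smul_add_smul hst' hss
  have et := eq_smul_add_smul hst' htt
  have ha := (cs.isPosVec_root_iff.2 hs).2 (τ.gen s)
  have hb := (cs.isPosVec_root_iff.2 hs).2 (τ.gen t)
  have hc := (cs.isPosVec_root_iff.2 ht).2 (τ.gen s)
  have hd := (cs.isPosVec_root_iff.2 ht).2 (τ.gen t)
  set a := cs.root z s (τ.gen s)
  set b := cs.root z s (τ.gen t)
  set c := cs.root z t (τ.gen s)
  set d := cs.root z t (τ.gen t)
  have key : ∀ (x : B) (p q : ℝ),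
      cs.root z x = p • simpleRoot ℝ (τ.gen s) + q • simpleRoot ℝ (τ.gen t) →
      simpleRoot ℝ (τ.gen x) = p • cs.root z s + q • cs.root z t := by
    intro x p q h
    have h1 := congrArg τ.starEnd h
    rw [starEnd_root, hz, map_add, map_smul, map_smul, starEnd_simpleRoot, starEnd_simpleRoot,
      gen_gen, gen_gen] at h1
    have h2 := congrArg (cs.geom z) h1
    rw [root, geom_apply_inv, map_add, map_smul, map_smul] at h2
    exact h2
  have k1 := key s a b es
  have k2 := key t c d et
  have k1s := congrFun k1 (τ.gen s)
  have k1t := congrFun k1 (τ.gen t)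
  have k2s := congrFun k2 (τ.gen s)
  have k2t := congrFun k2 (τ.gen t)
  simp only [Pi.add_apply, Pi.smul_apply, smul_eq_mul, simpleRoot_self,
    simpleRoot_of_ne ℝ hst', simpleRoot_of_ne ℝ hst'.symm] at k1s k1t k2s k2t
  change 1 = a * a + b * c at k1s
  change 0 = a * b + b * d at k1t
  change 0 = c * a + d * c at k2s
  change 1 = c * b + d * d at k2t
  by_cases hb0 : b = 0
  · left
    have ha0 : a ≠ 0 := by rintro h; rw [hb0, h] at k1s; norm_num at k1s
    have hc0 : c = 0 := by
      have h1 : 0 < a := lt_of_le_of_ne ha (Ne.symm ha0)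
      nlinarith [mul_nonneg hd hc, mul_nonneg hc ha]
    rw [hb0, zero_smul, add_zero] at es
    rw [hc0, zero_smul, zero_add] at et
    exact ⟨cs.root_eq_simpleRoot_of_smul es hs, cs.root_eq_simpleRoot_of_smul et ht⟩
  · right
    have h1 : 0 < b := lt_of_le_of_ne hb (Ne.symm hb0)
    have ha0 : a = 0 := by nlinarith [mul_nonneg hb hd, mul_nonneg ha hb]
    have hd0 : d = 0 := by nlinarith [mul_nonneg hb hd, mul_nonneg ha hb]
    rw [ha0, zero_smul, zero_add] at es
    rw [hd0, zero_smul, add_zero] at et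
    exact ⟨cs.root_eq_simpleRoot_of_smul es hs, cs.root_eq_simpleRoot_of_smul et ht⟩

theorem exists_wordProd_mul_eq {z : W} {s t : B}
    (hz : ∀ x, x = s ∨ x = t → ∃ y, (y = s ∨ y = t) ∧ cs.root z y = simpleRoot ℝ (τ.gen x))
    {c : List B} (hc : ∀ x ∈ c, ∃ y, (y = s ∨ y = t) ∧ x = τ.gen y) :
    ∃ c' : List B, (∀ x ∈ c', x = s ∨ x = t) ∧ cs.wordProd c * z = z * cs.wordProd c' := by
  induction c with
  | nil => exact ⟨[], by simp, by simp⟩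
  | cons x c ih =>
    obtain ⟨c', hc', e⟩ := ih fun x hx => hc x (by simp [hx])
    obtain ⟨y, hy, rfl⟩ := hc x (by simp)
    obtain ⟨y', hy', h⟩ := hz y hy
    refine ⟨y' :: c', by simpa [or_imp, forall_and] using ⟨hy', hc'⟩, ?_⟩
    rw [wordProd_cons, mul_assoc, e, wordProd_cons, ← mul_assoc, ← mul_assoc,
      cs.mul_simple_eq_simple_mul h]

/-- If `z` permutes the two simple roots up to the twist, then the top element of its double coset
is `z` times the longest element of the dihedral group. -/
theorem ifold_altWord_eq_mul {z : W} (hz : z ∈ τ.twistedInvolutions) {s t : B} (hst : s ≠ t)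
    (hM : M s t ≠ 0)
    (h : (cs.root z s = simpleRoot ℝ (τ.gen s) ∧ cs.root z t = simpleRoot ℝ (τ.gen t)) ∨
      (cs.root z s = simpleRoot ℝ (τ.gen t) ∧ cs.root z t = simpleRoot ℝ (τ.gen s)))
    {a : List B} (ha : τ.Ascends z a) (hmem : ∀ x ∈ a, x = s ∨ x = t)
    (hd : ∀ x, x = s ∨ x = t → cs.IsRightDescent (τ.ifold z a) x) :
    τ.ifold z a = z * cs.wordProd (altWord s t (M s t)) := by
  obtain ⟨c, hc, e⟩ := τ.exists_ifold_eq_mul hz ha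
  obtain ⟨c', hc', e'⟩ := τ.exists_wordProd_mul_eq (s := s) (t := t) (z := z) (by
    rcases h with ⟨h1, h2⟩ | ⟨h1, h2⟩
    · rintro x (rfl | rfl)
      exacts [⟨x, Or.inl rfl, h1⟩, ⟨x, Or.inr rfl, h2⟩]
    · rintro x (rfl | rfl)
      exacts [⟨t, Or.inr rfl, h2⟩, ⟨s, Or.inl rfl, h1⟩]) (c := c) fun x hx => by
    obtain ⟨y, hy, rfl⟩ := hc x hx
    exact ⟨y, hmem y hy, rfl⟩
  rw [e', mul_assoc, ← wordProd_append] at e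
  have hb : ∀ x ∈ c' ++ a, x = s ∨ x = t := by
    intro x hx
    rcases List.mem_append.1 hx with hx | hx
    exacts [hc' x hx, hmem x hx]
  set b := c' ++ a
  have hdesc : ∀ x, x = s ∨ x = t → cs.IsRightDescent (cs.wordProd b) x := by
    intro x hx
    have h0 : ∀ y, y ≠ s → y ≠ t → cs.root (cs.wordProd b) x y = 0 := by
      intro y hys hyt
      rw [root, cs.geom_wordProd_apply_of_notMem, simpleRoot_of_ne]
      · rintro rfl; tauto
      · intro hy; have := hb y hy; tauto
    have h1 := eq_smul_add_smul hst h0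
    set p := cs.root (cs.wordProd b) x s
    set q := cs.root (cs.wordProd b) x t
    have h2 := cs.isNegVec_root_iff.2 (hd x hx)
    rw [e, root, geom_mul_apply, ← root, h1, map_add, map_smul, map_smul, ← root, ← root] at h2
    have h3 := h2.2 (τ.gen s)
    have h4 := h2.2 (τ.gen t)
    have hst' := τ.gen_injective.ne hst
    have hpq : p ≤ 0 ∧ q ≤ 0 := by
      rcases h with ⟨r1, r2⟩ | ⟨r1, r2⟩ <;>
      · rw [r1, r2] at h3 h4
        simp only [Pi.add_apply, Pi.smul_apply, smul_eq_mul, simpleRoot_self,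
          simpleRoot_of_ne ℝ hst', simpleRoot_of_ne ℝ hst'.symm] at h3 h4
        constructor <;> linarith
    rw [← isNegVec_root_iff]
    refine ⟨cs.root_ne_zero _ _, fun y => ?_⟩
    rw [h1, Pi.add_apply, Pi.smul_apply, Pi.smul_apply, smul_eq_mul, smul_eq_mul]
    have := mul_nonpos_of_nonpos_of_nonneg hpq.1 (simpleRoot_nonneg s y)
    have := mul_nonpos_of_nonpos_of_nonneg hpq.2 (simpleRoot_nonneg t y)
    linarith
  rw [e, cs.eq_wordProd_altWord hst hb (hdesc s (Or.inl rfl)) (hdesc t (Or.inr rfl))]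

theorem length_mul_wordProd_altWord {z : W} {s t : B} (hst : s ≠ t)
    (hs : ¬ cs.IsRightDescent z s) (ht : ¬ cs.IsRightDescent z t) {n : ℕ} (hn : n ≤ M s t) :
    cs.length (z * cs.wordProd (altWord s t n)) = cs.length z + n := by
  induction n with
  | zero => simp [altWord]
  | succ n ih =>
    have := cs.not_isRightDescent_iff.1
      (cs.not_isRightDescent_mul_altWord hst hs ht (n := n) (Or.inr (by omega)))
    rw [altWord_succ', wordProd_append, wordProd_singleton, ← mul_assoc, this, ih (by omega),
      add_assoc]

/-- The number of letters needed to reach the top of the double coset, as a difference of ranks.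
The trace only sees the plane spanned by the two simple roots. -/
theorem rank_mul_wordProd_altWord {z : W} {s t : B} (hst : s ≠ t)
    (hs : ¬ cs.IsRightDescent z s) (ht : ¬ cs.IsRightDescent z t) :
    τ.rank (z * cs.wordProd (altWord s t (M s t))) = τ.rank z + 2 * M s t +
      (τ.starEnd (cs.root z s) - cs.geom (cs.wordProd (altWord s t (M s t)))
        (τ.starEnd (cs.root z s))) s +
      (τ.starEnd (cs.root z t) - cs.geom (cs.wordProd (altWord s t (M s t)))
        (τ.starEnd (cs.root z t))) t := by
  set y := cs.wordProd (altWord s t (M s t)) with hy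
  let f : B → (B → ℝ) →ₗ[ℝ] ℝ := fun x => LinearMap.proj x ∘ₗ (LinearMap.id - cs.geom y)
  have e : τ.starEnd * cs.geom (z * y) = τ.starEnd * cs.geom z -
      (f s).smulRight (τ.starEnd (cs.root z s)) - (f t).smulRight (τ.starEnd (cs.root z t)) := by
    refine LinearMap.ext fun v => ?_
    have h0 : ∀ x, x ≠ s → x ≠ t → (v - cs.geom y v) x = 0 := by
      intro x hxs hxt
      rw [Pi.sub_apply, hy, cs.geom_wordProd_apply_of_notMem, sub_self]
      intro hx
      rcases mem_altWord hx with h | h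
      exacts [hxs h, hxt h]
    have h1 := eq_smul_add_smul hst h0
    have h2 : cs.geom y v = v - (v - cs.geom y v) := by abel
    rw [Module.End.mul_apply, geom_mul_apply, h2, h1, map_sub, map_add, map_sub, map_add, map_smul,
      map_smul, map_smul, map_smul, ← root, ← root]
    simp only [f, LinearMap.sub_apply, LinearMap.smulRight_apply, Module.End.mul_apply,
      LinearMap.comp_apply, LinearMap.proj_apply, LinearMap.id_apply]
    abel
  rw [rank, rank, e, map_sub, map_sub, LinearMap.trace_smulRight, LinearMap.trace_smulRight, hy,
    length_mul_wordProd_altWord hst hs ht le_rfl]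
  simp only [f, LinearMap.comp_apply, LinearMap.proj_apply, LinearMap.sub_apply, LinearMap.id_apply]
  push_cast; ring

theorem bijOn_pair {B : Type*} {θ : B → B} {s t : B} (hst : s ≠ t)
    (h : Set.BijOn θ {s, t} {s, t}) : (θ s = s ∧ θ t = t) ∨ (θ s = t ∧ θ t = s) := by
  have h1 : θ s = s ∨ θ s = t := h.mapsTo (Set.mem_insert s _)
  have h2 : θ t = s ∨ θ t = t := h.mapsTo (Set.mem_insert_of_mem s rfl)
  have h3 : θ s ≠ θ t := fun e => hst (h.injOn (by simp) (by simp) e)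
  rcases h1 with h1 | h1 <;> rcases h2 with h2 | h2
  · exact absurd (h1.trans h2.symm) h3
  · exact Or.inl ⟨h1, h2⟩
  · exact Or.inr ⟨h1, h2⟩
  · exact absurd (h1.trans h2.symm) h3

/-- If `z` maps the two simple roots to simple roots, as given by `θ`, then `m_θ(s,t)` is the number
of letters which lead from `z` to the top of its double coset: it is a quarter of the difference of
the ranks. -/
theorem eq_mTheta {z : W} (hz : z ∈ τ.twistedInvolutions) {s t : B} (hst : s ≠ t)
    (hM : M s t ≠ 0) {θ : B → B} (hθ : Set.BijOn θ {s, t} {s, t})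
    (hs : cs.root z s = simpleRoot ℝ (τ.gen (θ s))) (ht : cs.root z t = simpleRoot ℝ (τ.gen (θ t)))
    {n : ℕ} (ha : τ.Ascends z (altWord s t n))
    (hd : ∀ x, x = s ∨ x = t → cs.IsRightDescent (τ.ifold z (altWord s t n)) x) :
    n = mTheta M θ s t := by
  have hsd : ¬ cs.IsRightDescent z s := by
    rw [← isPosVec_root_iff, hs]; exact isPosVec_simpleRoot _
  have htd : ¬ cs.IsRightDescent z t := by
    rw [← isPosVec_root_iff, ht]; exact isPosVec_simpleRoot _
  have h : (cs.root z s = simpleRoot ℝ (τ.gen s) ∧ cs.root z t = simpleRoot ℝ (τ.gen t)) ∨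
      (cs.root z s = simpleRoot ℝ (τ.gen t) ∧ cs.root z t = simpleRoot ℝ (τ.gen s)) := by
    rcases bijOn_pair hst hθ with ⟨h1, h2⟩ | ⟨h1, h2⟩
    · left; rw [hs, ht, h1, h2]; simp
    · right; rw [hs, ht, h1, h2]; simp
  have e := τ.ifold_altWord_eq_mul hz hst hM h ha (fun x hx => mem_altWord hx) hd
  have h1 := (τ.ascends_iff_rank hz _).1 ha
  rw [e, τ.rank_mul_wordProd_altWord hst hsd htd, altWord_length, hs, ht, starEnd_simpleRoot,
    starEnd_simpleRoot, gen_gen, gen_gen] at h1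
  have r1 := cs.root_wordProd_altWord_self hst hM
  have r2 := cs.root_wordProd_altWord_self (Ne.symm hst) (by rwa [M.symmetric])
  rw [M.symmetric t s, ← wordProd_altWord_eq] at r2
  unfold root at r1 r2
  have key : ∀ k : ℕ, (4 * n : ℝ) = 2 * M s t + k → 4 * n = 2 * M s t + k := fun k h => by
    exact_mod_cast h
  unfold mTheta
  rw [if_neg hM]
  by_cases he : Even (M s t)
  · have ho : ¬ Odd (M s t) := Nat.not_odd_iff_even.2 he
    rw [if_pos he] at r1 r2
    rw [if_neg (fun h => ho h.1)]
    rcases bijOn_pair hst hθ with ⟨h2, h3⟩ | ⟨h2, h3⟩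
    · rw [if_pos ⟨he, h2, h3⟩]
      rw [h2, h3, r1, r2] at h1
      simp only [Pi.sub_apply, Pi.neg_apply, simpleRoot_self] at h1
      have := key 4 (by push_cast; linarith)
      omega
    · rw [if_neg (fun h => hst (h.2.1.symm.trans h2)), if_pos ⟨he, h2, h3⟩]
      rw [h2, h3, r1, r2] at h1
      simp only [Pi.sub_apply, Pi.neg_apply, simpleRoot_of_ne ℝ hst,
        simpleRoot_of_ne ℝ hst.symm] at h1
      have := key 0 (by push_cast; linarith)
      omega
  · have ho : Odd (M s t) := Nat.not_even_iff_odd.1 he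
    rw [if_neg he] at r1 r2
    rw [if_pos ⟨ho, hθ.image_eq⟩]
    obtain ⟨j, hj⟩ := ho
    rcases bijOn_pair hst hθ with ⟨h2, h3⟩ | ⟨h2, h3⟩ <;>
    · rw [h2, h3, r1, r2] at h1
      simp only [Pi.sub_apply, Pi.neg_apply, simpleRoot_self, simpleRoot_of_ne ℝ hst,
        simpleRoot_of_ne ℝ hst.symm] at h1
      have := key 2 (by push_cast; linarith)
      omega

end CoxeterTwist

/-! ### The dihedral decomposition of a twisted involution -/

namespace CoxeterTwist

open CoxeterSystem

theorem alternatingWord_eq_altWord {B : Type*} (s t : B) (n : ℕ) :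
    alternatingWord s t n = if Even n then altWord s t n else altWord t s n := by
  induction n with
  | zero => simp [altWord, alternatingWord]
  | succ n ih =>
    rw [alternatingWord_succ', ih]
    by_cases h : Even n <;> simp [h, Nat.even_add_one, altWord]

section Dihedral

variable {B W : Type*} [Fintype B] [Group W] {M : CoxeterMatrix B} {cs : CoxeterSystem M W}
  (τ : CoxeterTwist cs)

/-- The analysis of two ascents `s`, `t` of a twisted involution: both alternating words lead to
the same element after `n` letters, and if `n < m(s,t)` then `n = m_θ(s,t)` for a bijection `θ`. -/
theorem exists_dihedral_ascent {z : W} (hz : z ∈ τ.twistedInvolutions) {s t : B} (hst : s ≠ t)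
    (hs : ¬ cs.IsRightDescent z s) (ht : ¬ cs.IsRightDescent z t) (hM : M s t ≠ 0) :
    ∃ n, 1 ≤ n ∧ τ.Ascends z (altWord s t n) ∧ τ.Ascends z (altWord t s n) ∧
      τ.ifold z (altWord s t n) = τ.ifold z (altWord s t (M s t)) ∧
      τ.ifold z (altWord t s n) = τ.ifold z (altWord s t (M s t)) ∧
      (∀ x, x = s ∨ x = t → cs.IsRightDescent (τ.ifold z (altWord s t n)) x) ∧
      (n = M s t ∨ n < M s t ∧ ∃ θ : B → B, Set.BijOn θ {s, t} {s, t} ∧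
        cs.root z s = simpleRoot ℝ (τ.gen (θ s)) ∧ cs.root z t = simpleRoot ℝ (τ.gen (θ t)) ∧
        n = mTheta M θ s t) := by
  obtain ⟨n, h1, h2, h3, h4, h5, h6⟩ := τ.exists_ascends_altWord hz hs ht hM
  have hd : ∀ x, x = s ∨ x = t → cs.IsRightDescent (τ.ifold z (altWord s t n)) x := by
    obtain ⟨ds, dt⟩ := τ.isRightDescent_ifold_altWord z hM
    rw [h5]
    rintro x (rfl | rfl) <;> assumption
  refine ⟨n, h1, h3, h4, h5, h6, hd, ?_⟩
  rcases h2.eq_or_lt with h | h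
  · exact Or.inl h
  refine Or.inr ⟨h, ?_⟩
  have hts : ∀ x, x ≠ τ.gen s → x ≠ τ.gen t → cs.root z t x = 0 := fun x hxs hxt =>
    τ.root_apply_eq_zero hz hst hs ht h1 h h3 hd hxs hxt
  have hss : ∀ x, x ≠ τ.gen s → x ≠ τ.gen t → cs.root z s x = 0 := fun x hxs hxt =>
    τ.root_apply_eq_zero hz hst.symm ht hs h1 (by rwa [M.symmetric]) h4
      (fun y hy => by rw [h6, ← h5]; exact hd y hy.symm) hxt hxs
  have hid : Set.BijOn id {s, t} {s, t} := Set.bijOn_id _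
  classical
  have hsw : Set.BijOn (Equiv.swap s t) {s, t} {s, t} := by
    refine ⟨?_, (Equiv.swap s t).injective.injOn, ?_⟩
    · rintro x (rfl | rfl) <;> simp
    · rintro x (rfl | rfl)
      · exact ⟨t, by simp⟩
      · exact ⟨s, by simp⟩
  rcases τ.root_eq_simpleRoot_gen hz hst hs ht hss hts with ⟨r1, r2⟩ | ⟨r1, r2⟩
  · exact ⟨id, hid, r1, r2, τ.eq_mTheta hz hst hM hid r1 r2 h3 hd⟩
  · have r1' : cs.root z s = simpleRoot ℝ (τ.gen (Equiv.swap s t s)) := by simpa using r1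
    have r2' : cs.root z t = simpleRoot ℝ (τ.gen (Equiv.swap s t t)) := by simpa using r2
    exact ⟨_, hsw, r1', r2', τ.eq_mTheta hz hst hM hsw r1' r2' h3 hd⟩

/-- The analysis of two descents `s`, `t` of a twisted involution. The alternating words are written
so that they end in `s` and `t`, respectively. -/
theorem exists_dihedral_decomposition {w : W} (hw : w ∈ τ.twistedInvolutions) {s t : B}
    (hst : s ≠ t) (hs : cs.IsRightDescent w s) (ht : cs.IsRightDescent w t) :
    ∃ z ∈ τ.twistedInvolutions, ∃ n, τ.Ascends z (alternatingWord t s (n + 1)) ∧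
      τ.Ascends z (alternatingWord s t (n + 1)) ∧
      τ.ifold z (alternatingWord t s (n + 1)) = w ∧ τ.ifold z (alternatingWord s t (n + 1)) = w ∧
      (n + 1 = M s t ∨ n + 1 < M s t ∧ ∃ θ : B → B, Set.BijOn θ {s, t} {s, t} ∧
        cs.root z s = simpleRoot ℝ (τ.gen (θ s)) ∧ cs.root z t = simpleRoot ℝ (τ.gen (θ t)) ∧
        n + 1 = mTheta M θ s t) := by
  have hM := cs.matrix_ne_zero_of_isRightDescent hst hs ht
  obtain ⟨z, hz, hzs, hzt, rfl⟩ := τ.exists_eq_ifold_altWord hw hst hs ht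
  obtain ⟨n, h1, h2, h3, h4, h5, -, h7⟩ := τ.exists_dihedral_ascent hz hst hzs hzt hM
  obtain ⟨n, rfl⟩ : ∃ k, n = k + 1 := ⟨n - 1, by omega⟩
  refine ⟨z, hz, n, ?_⟩
  rw [alternatingWord_eq_altWord, alternatingWord_eq_altWord]
  split_ifs
  exacts [⟨h3, h2, h5, h4, h7⟩, ⟨h2, h3, h4, h5, h7⟩]

end Dihedral

/-! ### The equivalence relation on words -/

section Equivalence

variable {B W : Type*} [Group W] {M : CoxeterMatrix B} {cs : CoxeterSystem M W}
  (τ : CoxeterTwist cs)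

theorem generatedEquiv_of_braid {τ : CoxeterTwist cs} {X : Set (WordRel B)}
    {R : WordRel B} (hR : R ∈ braidRelations M) {a b : List B}
    (h : R a b) (d : List B) : generatedEquiv (τ.braidAndHalfBraid ∪ X) (d ++ a) (d ++ b) := by
  refine Relation.EqvGen.rel _ _ ⟨R, Or.inl (Or.inl hR), ?_⟩
  obtain ⟨s, t, -, rfl⟩ := hR
  obtain ⟨d', c, ⟨rfl, rfl⟩ | ⟨rfl, rfl⟩⟩ := h
  · exact ⟨d ++ d', c, Or.inl (by simp)⟩
  · exact ⟨d ++ d', c, Or.inr (by simp)⟩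

theorem generatedEquiv_alternatingWord {τ : CoxeterTwist cs} {X : Set (WordRel B)}
    {s t : B} (hM : M s t ≠ 0) (d : List B) :
    generatedEquiv (τ.braidAndHalfBraid ∪ X) (d ++ alternatingWord t s (M s t))
      (d ++ alternatingWord s t (M s t)) := by
  refine generatedEquiv_of_braid ⟨s, t, hM, rfl⟩ ⟨[], [], ?_⟩ d
  rw [alternatingWord_eq_altWord, alternatingWord_eq_altWord]
  split_ifs <;> simp

/-- A letter can be moved past a word all of whose letters commute with it. -/
theorem generatedEquiv_commute {τ : CoxeterTwist cs} {X : Set (WordRel B)}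
    {r : B} {c : List B} (hc : ∀ x ∈ c, M r x = 2) (d : List B) :
    generatedEquiv (τ.braidAndHalfBraid ∪ X) (d ++ r :: c) (d ++ c ++ [r]) := by
  induction c generalizing d with
  | nil =>
    rw [List.append_nil]
    exact Relation.EqvGen.refl _
  | cons x c ih =>
    have h2 := hc x (by simp)
    have h1 : generatedEquiv (τ.braidAndHalfBraid ∪ X) (d ++ r :: x :: c) (d ++ x :: r :: c) := by
      refine generatedEquiv_of_braid ⟨r, x, by rw [h2]; norm_num, rfl⟩ ⟨[], c, Or.inl ?_⟩ d
      rw [h2]; simp [altWord]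
    have h3 := ih (fun y hy => hc y (by simp [hy])) (d ++ [x])
    rw [show d ++ [x] ++ r :: c = d ++ x :: r :: c by simp,
      show d ++ [x] ++ c ++ [r] = d ++ x :: c ++ [r] by simp] at h3
    exact h1.trans _ _ _ h3

variable [Fintype B]

/-- The word relation exchanges two initial segments of the same length which have the same effect
on the identity. -/
def IsSoundPrefixRel (R : WordRel B) : Prop :=
  ∃ u v : List B, u.length = v.length ∧ τ.ifold 1 u = τ.ifold 1 v ∧ R = prefixRel u v

theorem isSoundPrefixRel_of_mem {z : W} {u v : List B} (hu : u ∈ τ.involutionWords z)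
    (hv : v ∈ τ.involutionWords z) : τ.IsSoundPrefixRel (prefixRel u v) := by
  rw [mem_involutionWords_iff] at hu hv
  have e := hu.2.trans hv.2.symm
  exact ⟨u, v, τ.length_eq_of_ascends τ.one_mem_twistedInvolutions hu.1 hv.1 e, e, rfl⟩

theorem isSoundPrefixRel_of_inducedRelations {ord : B → B → LinearOrder B} {R : WordRel B}
    (hR : R ∈ τ.inducedRelations ord) : τ.IsSoundPrefixRel R := by
  obtain ⟨s, t, -, J, S, -, ⟨⟨z, -, h1, h2⟩, -⟩, rfl⟩ := hR
  exact τ.isSoundPrefixRel_of_mem h1 h2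

variable {τ} {X : Set (WordRel B)}

theorem braidAndHalfBraid_cases (hX : ∀ R ∈ X, τ.IsSoundPrefixRel R) {R : WordRel B}
    (hR : R ∈ τ.braidAndHalfBraid ∪ X) : R ∈ braidRelations M ∨ τ.IsSoundPrefixRel R := by
  rcases hR with (hR | ⟨s, t, m, -, -, ⟨z, -, h1, h2⟩, rfl⟩) | hR
  · exact Or.inl hR
  · exact Or.inr (τ.isSoundPrefixRel_of_mem h1 h2)
  · exact Or.inr (hX R hR)

theorem braidRelations_sound {R : WordRel B} (hR : R ∈ braidRelations M) {a b : List B}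
    (h : R a b) (z : W) : τ.ifold z a = τ.ifold z b ∧ a.length = b.length := by
  obtain ⟨s, t, -, rfl⟩ := hR
  obtain ⟨d, c, ⟨rfl, rfl⟩ | ⟨rfl, rfl⟩⟩ := h <;>
    simp [ifold_append, altWord_length, τ.ifold_altWord_comm _ s t]

/-- The equivalence relation on words preserves the element given by a word. -/
theorem generatedEquiv_sound (hX : ∀ R ∈ X, τ.IsSoundPrefixRel R) {a b : List B}
    (h : generatedEquiv (τ.braidAndHalfBraid ∪ X) a b) :
    τ.ifold 1 a = τ.ifold 1 b ∧ a.length = b.length := by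
  induction h with
  | rel a b h =>
    obtain ⟨R, hR, h⟩ := h
    rcases braidAndHalfBraid_cases hX hR with hR | ⟨u, v, hl, hf, rfl⟩
    · exact braidRelations_sound hR h 1
    · obtain ⟨c, ⟨rfl, rfl⟩ | ⟨rfl, rfl⟩⟩ := h <;> simp [ifold_append, hl, hf]
  | refl => exact ⟨rfl, rfl⟩
  | symm _ _ _ ih => exact ⟨ih.1.symm, ih.2.symm⟩
  | trans _ _ _ _ _ ih1 ih2 => exact ⟨ih1.1.trans ih2.1, ih1.2.trans ih2.2⟩

theorem generatedEquiv_append (hX : ∀ R ∈ X, τ.IsSoundPrefixRel R) {a b : List B}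
    (h : generatedEquiv (τ.braidAndHalfBraid ∪ X) a b) (e : List B) :
    generatedEquiv (τ.braidAndHalfBraid ∪ X) (a ++ e) (b ++ e) := by
  induction h with
  | rel a b h =>
    obtain ⟨R, hR, h⟩ := h
    refine Relation.EqvGen.rel _ _ ⟨R, hR, ?_⟩
    rcases braidAndHalfBraid_cases hX hR with ⟨s, t, -, rfl⟩ | ⟨u, v, -, -, rfl⟩
    · obtain ⟨d, c, ⟨rfl, rfl⟩ | ⟨rfl, rfl⟩⟩ := h
      · exact ⟨d, c ++ e, Or.inl (by simp)⟩
      · exact ⟨d, c ++ e, Or.inr (by simp)⟩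
    · obtain ⟨c, ⟨rfl, rfl⟩ | ⟨rfl, rfl⟩⟩ := h
      · exact ⟨c ++ e, Or.inl (by simp)⟩
      · exact ⟨c ++ e, Or.inr (by simp)⟩
  | refl => exact Relation.EqvGen.refl _
  | symm _ _ _ ih => exact ih.symm
  | trans _ _ _ _ _ ih1 ih2 => exact ih1.trans _ _ _ ih2

variable (τ) in
/-- The hypotheses of a double induction: `E` links any two involution words of the same element
if they have fewer than `N` letters, or if they have `N` letters and their last letters `s'`, `t'`
satisfy `m(s,t) < m(s',t')`. -/
structure LinkedBefore (E : WordRel B) (N : ℕ) (s t : B) : Prop where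
  of_length_lt : ∀ a b, τ.Ascends 1 a → τ.Ascends 1 b → τ.ifold 1 a = τ.ifold 1 b →
    a.length < N → E a b
  of_matrix_lt : ∀ s' t', M s t < M s' t' → ∀ a b, τ.Ascends 1 (a ++ [s']) →
    τ.Ascends 1 (b ++ [t']) → τ.ifold 1 (a ++ [s']) = τ.ifold 1 (b ++ [t']) →
    a.length + 1 = N → E (a ++ [s']) (b ++ [t'])

theorem LinkedBefore.of_last_eq (hX : ∀ R ∈ X, τ.IsSoundPrefixRel R) {N : ℕ}
    {s t : B} (H : τ.LinkedBefore (generatedEquiv (τ.braidAndHalfBraid ∪ X)) N s t) {x : B}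
    {a b : List B} (ha : τ.Ascends 1 (a ++ [x])) (hb : τ.Ascends 1 (b ++ [x]))
    (h : τ.ifold 1 (a ++ [x]) = τ.ifold 1 (b ++ [x])) (hN : a.length + 1 = N) :
    generatedEquiv (τ.braidAndHalfBraid ∪ X) (a ++ [x]) (b ++ [x]) := by
  rw [ascends_append, ascends_singleton] at ha hb
  rw [ifold_append, ifold_append] at h
  have h1 := τ.one_mem_twistedInvolutions
  have e := τ.istep_cancel (τ.ifold_mem h1 a) (τ.ifold_mem h1 b) ha.2 hb.2 h
  exact generatedEquiv_append hX (H.of_length_lt a b ha.1 hb.1 e (by omega)) [x]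

end Equivalence

/-! ### Braid systems realized by twisted involutions -/

section Systems

variable {B W : Type*} [Group W] {M : CoxeterMatrix B} {cs : CoxeterSystem M W}
  (τ : CoxeterTwist cs) {J : Set B}

/-- The words of the system, with last letters `s` and `t`, lead from `z` to the same element by
the same number of strict steps. -/
structure Fits (s t : B) (S : BraidSystem B J) (z : W) : Prop where
  mem : z ∈ τ.twistedInvolutions
  asc₁ : τ.Ascends z S.word₁
  asc₂ : τ.Ascends z S.word₂
  ifold_eq : τ.ifold z S.word₁ = τ.ifold z S.word₂
  sub₁ : ∀ x ∈ S.word₁, x ∈ J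
  sub₂ : ∀ x ∈ S.word₂, x ∈ J
  last₁ : S.word₁.getLast? = some s
  last₂ : S.word₂.getLast? = some t

/-- The words of the system become equivalent after involution words of `z`, if their total length
is `N`. -/
def Linked (E : WordRel B) (N : ℕ) (S : BraidSystem B J) (z : W) : Prop :=
  ∀ u, τ.Ascends 1 u → τ.ifold 1 u = z → u.length + S.word₁.length = N →
    E (u ++ S.word₁) (u ++ S.word₂)

variable {τ} {X : Set (WordRel B)} {N : ℕ} {s t : B}

theorem Fits.word_ne_nil {S : BraidSystem B J} {z : W} (h : τ.Fits s t S z) :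
    S.word₁ ≠ [] := by
  intro h0
  have := h.last₁
  rw [h0] at this
  simp at this

theorem Fits.cons {S S' : BraidSystem B J} {z z' : W} (h : τ.Fits s t S z) {r : J}
    (hz' : z' ∈ τ.twistedInvolutions) (hd : ¬ cs.IsRightDescent z' r) (hstep : τ.istep z' r = z)
    (h₁ : S'.word₁ = (r : B) :: S.word₁) (h₂ : S'.word₂ = (r : B) :: S.word₂) :
    τ.Fits s t S' z' where
  mem := hz'
  asc₁ := by rw [h₁, Ascends, hstep]; exact ⟨hd, h.asc₁⟩
  asc₂ := by rw [h₂, Ascends, hstep]; exact ⟨hd, h.asc₂⟩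
  ifold_eq := by rw [h₁, h₂, ifold_cons, ifold_cons, hstep, h.ifold_eq]
  sub₁ := by
    rw [h₁]; intro x hx
    rcases List.mem_cons.1 hx with rfl | hx
    exacts [r.2, h.sub₁ x hx]
  sub₂ := by
    rw [h₂]; intro x hx
    rcases List.mem_cons.1 hx with rfl | hx
    exacts [r.2, h.sub₂ x hx]
  last₁ := by rw [h₁, List.getLast?_cons, h.last₁]; rfl
  last₂ := by rw [h₂, List.getLast?_cons, h.last₂]; rfl

variable [Fintype B]

/-- It suffices to link the words after a descent has been moved from `z` to the words. -/
theorem Linked.of_cons (hX : ∀ R ∈ X, τ.IsSoundPrefixRel R)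
    (H : τ.LinkedBefore (generatedEquiv (τ.braidAndHalfBraid ∪ X)) N s t)
    {S S' : BraidSystem B J} {z z' : W} (h : τ.Fits s t S z) {r : J}
    (hz' : z' ∈ τ.twistedInvolutions) (hd : ¬ cs.IsRightDescent z' r) (hstep : τ.istep z' r = z)
    (h₁ : S'.word₁ = (r : B) :: S.word₁) (h₂ : S'.word₂ = (r : B) :: S.word₂)
    (hL : τ.Linked (generatedEquiv (τ.braidAndHalfBraid ∪ X)) N S' z') :
    τ.Linked (generatedEquiv (τ.braidAndHalfBraid ∪ X)) N S z := by
  intro u hu huz hN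
  obtain ⟨u', hu', hu'z⟩ := τ.exists_ascends hz'
  have hur : τ.Ascends 1 (u' ++ [(r : B)]) := by
    rw [ascends_append, ascends_singleton, hu'z]; exact ⟨hu', hd⟩
  have hurz : τ.ifold 1 (u' ++ [(r : B)]) = z := by rw [ifold_append, hu'z]; exact hstep
  have hlen := τ.length_eq_of_ascends τ.one_mem_twistedInvolutions hu hur (huz.trans hurz.symm)
  have hpos := List.length_pos_of_ne_nil h.word_ne_nil
  have hE := H.of_length_lt u (u' ++ [(r : B)]) hu hur (huz.trans hurz.symm) (by omega)
  have hE' := hL u' hu' hu'z (by rw [h₁]; simp at hlen ⊢; omega)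
  rw [h₁, h₂] at hE'
  have hE₁ := generatedEquiv_append hX hE S.word₁
  have hE₂ := generatedEquiv_append hX hE S.word₂
  rw [List.append_assoc, List.singleton_append] at hE₁ hE₂
  exact (hE₁.trans _ _ _ hE').trans _ _ _ hE₂.symm

theorem map_reflect {A A' : Type*} [CommRing A] [Algebra ℝ A] [CommRing A'] [Algebra ℝ A']
    (ψ : A →+* A') (hψ : ∀ c, ψ (algebraMap ℝ A c) = algebraMap ℝ A' c) (s : B) (v : B → A) :
    (fun t => ψ (reflect M s v t)) = reflect M s fun t => ψ (v t) := by
  have h : ∀ x y : B, ψ (simpleRoot A x y) = simpleRoot A' x y := by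
    intro x y; unfold simpleRoot; split_ifs <;> simp
  ext t
  simp [reflect, extForm_simpleRoot_left, h, hψ, map_sum, show ψ 2 = 2 from map_ofNat ψ 2]

/-- The homomorphism turns the map of the system into the restriction of `z`. -/
def Realizes (cs : CoxeterSystem M W) (ψ : MvPolynomial B ℝ →+* ℝ) (S : BraidSystem B J) (z : W) :
    Prop :=
  (∀ c, ψ (MvPolynomial.C c) = c) ∧ ∀ (s : J) (t : B), ψ (S.σ s t) = cs.root z s t

theorem Realizes.root_eq_of_eq_simpleRoot {ψ : MvPolynomial B ℝ →+* ℝ} {S : BraidSystem B J} {z : W}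
    (h : Realizes cs ψ S z) {x : J} {y : B} (hx : S.σ x = simpleRoot _ y) :
    cs.root z x = simpleRoot ℝ y := by
  ext t
  rw [← h.2, hx]
  unfold simpleRoot; split_ifs <;> simp

theorem Realizes.des {ψ : MvPolynomial B ℝ →+* ℝ} {S : BraidSystem B J} {z : W}
    (h : Realizes cs ψ S z) (r : J) : Realizes cs ψ (τ.des S r) (cs.simple (τ.gen r) * z) := by
  refine ⟨h.1, fun x t => ?_⟩
  have e := congrFun (map_reflect (M := M) ψ (fun c => h.1 c) (τ.gen r) (S.σ x)) t
  have e2 : (fun t => ψ (S.σ x t)) = cs.root z x := funext fun t => h.2 x t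
  rw [e2, ← simpleReflection_eq_reflect, ← root_simple_mul] at e
  exact e

theorem Realizes.hatDes {ψ : MvPolynomial B ℝ →+* ℝ} {S : BraidSystem B J} {z : W}
    (h : Realizes cs ψ S z) (r : J) :
    Realizes cs ψ (τ.hatDes S r) (cs.simple (τ.gen r) * z * cs.simple r) := by
  refine ⟨h.1, fun x t => ?_⟩
  have e := congrFun (map_reflect (M := M) ψ (fun c => h.1 c) (τ.gen r)
    (S.σ x - algebraMap ℝ (MvPolynomial B ℝ) (2 * rootForm M r x) • S.σ r)) t
  have e2 : (fun t => ψ ((S.σ x - algebraMap ℝ (MvPolynomial B ℝ) (2 * rootForm M r x) • S.σ r) t))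
      = cs.root (z * cs.simple r) x := by
    funext t
    rw [root_mul_simple, Pi.sub_apply, Pi.smul_apply, smul_eq_mul, map_sub, map_mul, h.2, h.2]
    change _ - ψ (MvPolynomial.C _) * _ = _
    rw [h.1]; rfl
  rw [e2, ← simpleReflection_eq_reflect, ← root_simple_mul, ← mul_assoc] at e
  exact e

theorem Fits.valid {S : BraidSystem B J} {z : W} (h : τ.Fits s t S z)
    {ψ : MvPolynomial B ℝ →+* ℝ} (hψ : Realizes cs ψ S z) (hf : S.Feasible ψ) : τ.Valid S := by
  refine ⟨τ.isReduced_of_ascends h.asc₁, τ.isReduced_of_ascends h.asc₂, ψ, hf, fun x => ?_⟩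
  have e : (fun t => ψ (S.σ x t)) = cs.root z x := funext fun t => hψ.2 x t
  rw [e]
  exact cs.root_pos_or_neg z x

/-- The equivalence generated by braid relations and `σ`-relations is sound for words that are
applied to an element which realizes `σ`. -/
theorem sigmaEquiv_sound (hX : ∀ R ∈ X, τ.IsSoundPrefixRel R)
    (H : τ.LinkedBefore (generatedEquiv (τ.braidAndHalfBraid ∪ X)) N s t)
    {S : BraidSystem B J} {z : W} (hz : z ∈ τ.twistedInvolutions)
    {ψ : MvPolynomial B ℝ →+* ℝ} (hψ : Realizes cs ψ S z) {u : List B} (hu : τ.Ascends 1 u)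
    (huz : τ.ifold 1 u = z) {a b : List B} (h : τ.SigmaEquiv S.σ a b) :
    τ.ifold z a = τ.ifold z b ∧ a.length = b.length ∧
      (τ.Ascends z a → u.length + a.length = N →
        generatedEquiv (τ.braidAndHalfBraid ∪ X) (u ++ a) (u ++ b)) := by
  induction h with
  | rel a b h =>
    rcases h with ⟨R, hR, h⟩ | ⟨r, x, y, θ, c, hθ, hr, hx, hlt, rfl, rfl⟩
    · have := braidRelations_sound (τ := τ) hR h z
      exact ⟨this.1, this.2, fun _ _ => generatedEquiv_of_braid hR h u⟩
    · have hrz := hψ.root_eq_of_eq_simpleRoot hr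
      have hxz := hψ.root_eq_of_eq_simpleRoot hx
      have hrx : (r : B) ≠ x := by
        intro e
        rw [← e] at hlt hθ
        have h1 : M (r : B) r = 1 := M.diagonal r
        have h2 : mTheta M θ (r : B) r = 1 := by
          unfold mTheta
          rw [if_neg (by rw [h1]; norm_num), if_pos ⟨by rw [h1]; exact odd_one, hθ.image_eq⟩, h1]
        omega
      have hrd : ¬ cs.IsRightDescent z r := by
        rw [← isPosVec_root_iff, hrz]; exact isPosVec_simpleRoot _
      have hxd : ¬ cs.IsRightDescent z x := by
        rw [← isPosVec_root_iff, hxz]; exact isPosVec_simpleRoot _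
      have hM : M (r : B) x ≠ 0 := by omega
      obtain ⟨n, -, h2, h3, h4, h5, h6, -⟩ := τ.exists_dihedral_ascent hz hrx hrd hxd hM
      have hn := τ.eq_mTheta hz hrx hM hθ hrz hxz h2 h6
      rw [← hn]
      refine ⟨?_, by simp [altWord_length], fun ha hN => ?_⟩
      · rw [ifold_append, ifold_append, h4, h5]
      · simp only [List.length_append, List.length_cons, altWord_length] at hN
        have hE := H.of_length_lt (u ++ altWord (r : B) x n) (u ++ altWord (x : B) r n)
          (by rw [ascends_append, huz]; exact ⟨hu, h2⟩)
          (by rw [ascends_append, huz]; exact ⟨hu, h3⟩)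
          (by rw [ifold_append, ifold_append, huz, h4, h5])
          (by simp only [List.length_append, altWord_length]; omega)
        have := generatedEquiv_append hX hE ((y : B) :: c)
        simpa using this
  | refl => exact ⟨rfl, rfl, fun _ _ => Relation.EqvGen.refl _⟩
  | symm a b _ ih =>
    refine ⟨ih.1.symm, ih.2.1.symm, fun hb hN => (ih.2.2 ?_ (by rw [ih.2.1, hN])).symm⟩
    exact τ.ascends_of_length_le hz hb ih.1 ih.2.1.le
  | trans a b c _ _ ih1 ih2 =>
    refine ⟨ih1.1.trans ih2.1, ih1.2.1.trans ih2.2.1, fun ha hN => ?_⟩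
    refine (ih1.2.2 ha hN).trans _ _ _ (ih2.2.2 ?_ (by rw [← ih1.2.1, hN]))
    exact τ.ascends_of_length_le hz ha ih1.1.symm ih1.2.1.ge

theorem Fits.linked_of_redundant (hX : ∀ R ∈ X, τ.IsSoundPrefixRel R)
    (H : τ.LinkedBefore (generatedEquiv (τ.braidAndHalfBraid ∪ X)) N s t)
    {S : BraidSystem B J} {z : W} (h : τ.Fits s t S z)
    {ψ : MvPolynomial B ℝ →+* ℝ} (hψ : Realizes cs ψ S z) (hr : τ.Redundant S) :
    τ.Linked (generatedEquiv (τ.braidAndHalfBraid ∪ X)) N S z := by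
  intro u hu huz hN
  obtain ⟨a, b, s₀, t₀, s', t', hs₀, ht₀, hSa, hSb, hs', ht', hcase⟩ := hr
  obtain rfl : s = s₀ := Option.some.inj (h.last₁.symm.trans hs₀)
  obtain rfl : t = t₀ := Option.some.inj (h.last₂.symm.trans ht₀)
  obtain ⟨ha1, ha2, ha3⟩ := sigmaEquiv_sound hX H h.mem hψ hu huz hSa
  obtain ⟨hb1, hb2, hb3⟩ := sigmaEquiv_sound hX H h.mem hψ hu huz hSb
  have hEa := ha3 h.asc₁ hN
  have hEb := hb3 h.asc₂ (by rw [← S.length_eq, hN])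
  have haA := τ.ascends_of_length_le h.mem h.asc₁ ha1.symm ha2.ge
  have hbA := τ.ascends_of_length_le h.mem h.asc₂ hb1.symm hb2.ge
  obtain ⟨a', rfl⟩ := List.getLast?_eq_some_iff.1 hs'
  obtain ⟨b', rfl⟩ := List.getLast?_eq_some_iff.1 ht'
  have hA : τ.Ascends 1 (u ++ a' ++ [s']) := by
    rw [List.append_assoc, ascends_append, huz]; exact ⟨hu, haA⟩
  have hB : τ.Ascends 1 (u ++ b' ++ [t']) := by
    rw [List.append_assoc, ascends_append, huz]; exact ⟨hu, hbA⟩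
  have hAB : τ.ifold 1 (u ++ a' ++ [s']) = τ.ifold 1 (u ++ b' ++ [t']) := by
    rw [List.append_assoc, List.append_assoc, ifold_append, τ.ifold_append 1 u, huz, ← ha1, ← hb1,
      h.ifold_eq]
  have hl : (u ++ a').length + 1 = N := by
    rw [ha2] at hN; simpa [add_assoc] using hN
  have key : generatedEquiv (τ.braidAndHalfBraid ∪ X) (u ++ a' ++ [s']) (u ++ b' ++ [t']) := by
    rcases hcase with rfl | ⟨-, hlt⟩
    · exact H.of_last_eq hX hA hB hAB hl
    · exact H.of_matrix_lt s' t' hlt _ _ hA hB hAB hl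
  rw [List.append_assoc, List.append_assoc] at key
  exact (hEa.trans _ _ _ key).trans _ _ _ hEb.symm

end Systems

end CoxeterTwist

/-! ### The three algorithms -/

namespace CoxeterTwist

open CoxeterSystem

variable {B W : Type*} [Fintype B] [Group W] {M : CoxeterMatrix B} {cs : CoxeterSystem M W}
  {τ : CoxeterTwist cs} {J : Set B} {X : Set (WordRel B)} {N : ℕ} {s t : B}

theorem exists_isLeastGen (o : LinearOrder B) {D : Set J} (hD : D.Nonempty) :
    ∃ r, BraidSystem.IsLeastGen o D r := by
  obtain ⟨r, hr, h⟩ := @Set.exists_min_image J B o D (fun x => (x : B)) (Set.toFinite D) hD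
  exact ⟨r, hr, h⟩

variable (τ) in
/-- A vertex of a tree of the first algorithm that is realized by `z`, the polynomial variables
being evaluated by `ψ`. -/
structure Node (s t : B) (ψ : MvPolynomial B ℝ →+* ℝ) (S : BraidSystem B J) (z : W) : Prop where
  fits : τ.Fits s t S z
  realizes : Realizes cs ψ S z
  feasible : S.Feasible ψ

section Tree

variable {ψ : MvPolynomial B ℝ →+* ℝ} {S : BraidSystem B J} {z : W}

/-- A realized vertex stays realized by one of the operations `•_des` and `•̂_des` if a descent of
`z` is moved to the words. -/
theorem Node.descend (hX : ∀ R ∈ X, τ.IsSoundPrefixRel R)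
    (H : τ.LinkedBefore (generatedEquiv (τ.braidAndHalfBraid ∪ X)) N s t)
    (h : τ.Node s t ψ S z) {r : J} (hr : cs.IsRightDescent z r) :
    ∃ S' z', (S' = τ.des S r ∨ S' = τ.hatDes S r) ∧ τ.Node s t ψ S' z' ∧
      (τ.Linked (generatedEquiv (τ.braidAndHalfBraid ∪ X)) N S' z' →
        τ.Linked (generatedEquiv (τ.braidAndHalfBraid ∪ X)) N S z) := by
  have hψ := h.realizes
  have e : (fun t => ψ (S.σ r t)) = cs.root z r := funext fun t => hψ.2 r t
  have e' : (fun t => ψ ((-simpleRoot (MvPolynomial B ℝ) (τ.gen r)) t)) =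
      -simpleRoot ℝ (τ.gen r) := by
    ext t
    rw [Pi.neg_apply, Pi.neg_apply, map_neg]
    unfold simpleRoot; split_ifs <;> simp
  obtain ⟨z', hz', hd, hstep, ⟨hroot, -, hz'e⟩ | ⟨hroot, hz'e⟩⟩ := τ.exists_istep_eq h.fits.mem hr
  · refine ⟨_, z', Or.inl rfl, ⟨h.fits.cons hz' hd hstep rfl rfl, hz'e ▸ hψ.des r, ?_⟩,
      Linked.of_cons hX H h.fits hz' hd hstep rfl rfl⟩
    rintro c (hc | ⟨t, rfl⟩)
    · exact h.feasible c hc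
    · rw [← e, ← e'] at hroot
      exact congrFun hroot t
  · refine ⟨_, z', Or.inr rfl, ⟨h.fits.cons hz' hd hstep rfl rfl, hz'e ▸ hψ.hatDes r, ?_⟩,
      Linked.of_cons hX H h.fits hz' hd hstep rfl rfl⟩
    rintro c (hc | rfl | ⟨t, rfl⟩)
    · exact h.feasible c hc
    · change _ ≠ _
      rw [e, e']
      exact Ne.symm hroot
    · change ψ _ ≤ ψ 0
      rw [map_zero, hψ.2]
      exact (cs.isNegVec_root_iff.2 hr).2 t

/-- A realized vertex which may have children has a realized child. -/
theorem Node.exists_treeChild (hX : ∀ R ∈ X, τ.IsSoundPrefixRel R)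
    (H : τ.LinkedBefore (generatedEquiv (τ.braidAndHalfBraid ∪ X)) N s t) (o : LinearOrder B)
    (h : τ.Node s t ψ S z) (hexp : τ.Expandable S) :
    ∃ S' z', τ.TreeChild o S S' ∧ τ.Node s t ψ S' z' ∧
      (τ.Linked (generatedEquiv (τ.braidAndHalfBraid ∪ X)) N S' z' →
        τ.Linked (generatedEquiv (τ.braidAndHalfBraid ∪ X)) N S z) := by
  have hψ := h.realizes
  have hsol : ψ ∈ S.solutions := by
    refine ⟨h.feasible, fun x => ?_⟩
    have e : (fun t => ψ (S.σ x t)) = cs.root z x := funext fun t => hψ.2 x t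
    rw [e]
    exact cs.root_pos_or_neg z x
  by_cases hfin : S.solutions.Finite
  · refine ⟨S.subst ψ, z, .solve S ψ hexp hfin hsol, ⟨?_, ?_, ?_⟩, fun hL => hL⟩
    · exact ⟨h.fits.mem, h.fits.asc₁, h.fits.asc₂, h.fits.ifold_eq, h.fits.sub₁, h.fits.sub₂,
        h.fits.last₁, h.fits.last₂⟩
    · exact ⟨hψ.1, fun x y => (hψ.1 _).trans (hψ.2 x y)⟩
    · exact fun c hc => hc.elim
  have hinf : S.solutions.Infinite := hfin
  by_cases hun : {x | S.IsUncondDescent x}.Nonempty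
  · obtain ⟨r, hr⟩ := exists_isLeastGen o hun
    have hd : cs.IsRightDescent z r := by
      obtain ⟨y, hy⟩ := hr.1
      push Not at hy
      refine cs.isRightDescent_of_root_neg y ?_
      rw [← hψ.2]
      exact hy ψ h.feasible
    obtain ⟨S', z', rfl | rfl, hnode, hL⟩ := h.descend hX H hd
    · exact ⟨_, z', .uncond_des S r hexp hinf hr, hnode, hL⟩
    · exact ⟨_, z', .uncond_hatDes S r hexp hinf hr, hnode, hL⟩
  have hun' : ∀ x, ¬ S.IsUncondDescent x := fun x hx => hun ⟨x, hx⟩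
  by_cases hco : {x | S.IsCondDescent x}.Nonempty
  · obtain ⟨r, hr⟩ := exists_isLeastGen o hco
    by_cases hd : cs.IsRightDescent z r
    · obtain ⟨S', z', rfl | rfl, hnode, hL⟩ := h.descend hX H hd
      · exact ⟨_, z', .cond_des S r hexp hinf hun' hr, hnode, hL⟩
      · exact ⟨_, z', .cond_hatDes S r hexp hinf hun' hr, hnode, hL⟩
    · refine ⟨S.asc r, z, .cond_asc S r hexp hinf hun' hr, ⟨?_, hψ, ?_⟩, fun hL => hL⟩
      · exact ⟨h.fits.mem, h.fits.asc₁, h.fits.asc₂, h.fits.ifold_eq, h.fits.sub₁, h.fits.sub₂,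
          h.fits.last₁, h.fits.last₂⟩
      · rintro c (hc | ⟨y, rfl⟩)
        · exact h.feasible c hc
        · change ψ 0 ≤ ψ _
          rw [map_zero, hψ.2]
          exact cs.root_nonneg_of_not_isRightDescent hd y
  · exact ⟨S, z, .loop S hexp hinf hun' fun x hx => hco ⟨x, hx⟩, h, fun hL => hL⟩

theorem not_treeChild_of_not_expandable {o : LinearOrder B} (h : ¬ τ.Expandable S)
    (S' : BraidSystem B J) : ¬ τ.TreeChild o S S' := by
  intro hc
  cases hc <;> exact h ‹_›

/-- In a finite tree, the path of realized vertices starting at the root ends at a constant leaf,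
unless it meets a redundant vertex. -/
theorem Node.exists_leaf (hX : ∀ R ∈ X, τ.IsSoundPrefixRel R)
    (H : τ.LinkedBefore (generatedEquiv (τ.braidAndHalfBraid ∪ X)) N s t) (o : LinearOrder B)
    (h : τ.Node s t ψ S z) (hfin : τ.TreeFinite o S) :
    τ.Linked (generatedEquiv (τ.braidAndHalfBraid ∪ X)) N S z ∨
      ∃ L z', τ.IsTreeLeaf o S L ∧ L.IsConstant ∧ τ.Node s t ψ L z' ∧
        (τ.Linked (generatedEquiv (τ.braidAndHalfBraid ∪ X)) N L z' →
          τ.Linked (generatedEquiv (τ.braidAndHalfBraid ∪ X)) N S z) := by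
  have key : ∀ (n : ℕ) (S : BraidSystem B J) (z : W), τ.Node s t ψ S z →
      (∃ L z', Relation.ReflTransGen (τ.TreeChild o) S L ∧ ¬ τ.Expandable L ∧
        τ.Node s t ψ L z' ∧ (τ.Linked (generatedEquiv (τ.braidAndHalfBraid ∪ X)) N L z' →
          τ.Linked (generatedEquiv (τ.braidAndHalfBraid ∪ X)) N S z)) ∨
      ∃ l : List (BraidSystem B J), l.length = n ∧ List.IsChain (τ.TreeChild o) (S :: l) := by
    intro n
    induction n with
    | zero => exact fun S z _ => Or.inr ⟨[], rfl, List.isChain_singleton _⟩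
    | succ n ih =>
      intro S z hS
      by_cases hexp : τ.Expandable S
      · obtain ⟨S', z', hc, hS', hL⟩ := hS.exists_treeChild hX H o hexp
        rcases ih S' z' hS' with ⟨L, y, h1, h2, h3, h4⟩ | ⟨l, h1, h2⟩
        · exact Or.inl ⟨L, y, h1.head hc, h2, h3, fun h => hL (h4 h)⟩
        · exact Or.inr ⟨S' :: l, by simp [h1], List.isChain_cons_cons.2 ⟨hc, h2⟩⟩
      · exact Or.inl ⟨S, z, .refl, hexp, hS, fun h => h⟩
  obtain ⟨b, hb⟩ := (hfin.image List.length).bddAbove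
  rcases key (b + 1) S z h with ⟨L, z', h1, h2, h3, h4⟩ | ⟨l, h1, h2⟩
  · by_cases hred : τ.Redundant L
    · exact Or.inl (h4 (h3.fits.linked_of_redundant hX H h3.realizes hred))
    · have hval := h3.fits.valid h3.realizes h3.feasible
      have hconst : L.IsConstant := by
        by_contra hcon
        exact h2 ⟨hcon, hval, hred⟩
      exact Or.inr ⟨L, z', ⟨h1, not_treeChild_of_not_expandable h2⟩, hconst, h3, h4⟩
  · have := hb ⟨l, h2, h1⟩
    omega

end Tree

variable (τ) in
/-- A constant system whose map is the restriction of `z`. -/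
structure ConstNode (s t : B) (S : BraidSystem B J) (z : W) : Prop where
  fits : τ.Fits s t S z
  constraints : S.constraints = ∅
  σ_eq : ∀ x y, S.σ x y = MvPolynomial.C (cs.root z x y)

theorem Node.constNode {ψ : MvPolynomial B ℝ →+* ℝ} {S : BraidSystem B J} {z : W}
    (h : τ.Node s t ψ S z) (hc : S.IsConstant) : τ.ConstNode s t S z := by
  refine ⟨h.fits, hc.2, fun x y => ?_⟩
  obtain ⟨c, hc⟩ := hc.1 x y
  rw [← h.realizes.2, hc, h.realizes.1]

section Loop

variable {S : BraidSystem B J} {z : W}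

theorem ConstNode.node (h : τ.ConstNode s t S z) {ψ : MvPolynomial B ℝ →+* ℝ}
    (hψ : ∀ c, ψ (MvPolynomial.C c) = c) : τ.Node s t ψ S z :=
  ⟨h.fits, ⟨hψ, fun x y => by rw [h.σ_eq, hψ]⟩, fun c hc => by
    rw [h.constraints] at hc; exact hc.elim⟩

theorem ConstNode.mem_descents_iff (h : τ.ConstNode s t S z) (r : J) :
    r ∈ S.descents ↔ cs.IsRightDescent z r := by
  rw [← isNegVec_root_iff]
  constructor
  · rintro ⟨v, hv, hneg⟩
    have : cs.root z r = v := funext fun y => by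
      have := hv y
      rw [h.σ_eq] at this
      exact MvPolynomial.C_injective B ℝ this
    rwa [this]
  · exact fun hneg => ⟨_, h.σ_eq r, hneg⟩

theorem C_simpleRoot {B : Type*} (x y : B) :
    (MvPolynomial.C (simpleRoot ℝ x y) : MvPolynomial B ℝ) = simpleRoot (MvPolynomial B ℝ) x y := by
  unfold simpleRoot; split_ifs <;> simp

theorem C_reflect (s : B) (v : B → ℝ) (t : B) :
    (MvPolynomial.C (reflect M s v t) : MvPolynomial B ℝ) =
      reflect M s (fun y => MvPolynomial.C (v y)) t :=
  congrFun (map_reflect (M := M) (MvPolynomial.C : ℝ →+* MvPolynomial B ℝ) (fun _ => rfl) s v) t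

/-- One pass of the loop moves a descent from `z` to the words, so `z` becomes shorter. -/
theorem ConstNode.loopNext (hX : ∀ R ∈ X, τ.IsSoundPrefixRel R)
    (H : τ.LinkedBefore (generatedEquiv (τ.braidAndHalfBraid ∪ X)) N s t) (o : LinearOrder B)
    (h : τ.ConstNode s t S z) (hne : S.descents ≠ ∅) :
    ∃ z', cs.length z' < cs.length z ∧ τ.ConstNode s t (τ.loopNext o S) z' ∧
      (τ.Linked (generatedEquiv (τ.braidAndHalfBraid ∪ X)) N (τ.loopNext o S) z' →
        τ.Linked (generatedEquiv (τ.braidAndHalfBraid ∪ X)) N S z) := by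
  have hex := exists_isLeastGen o (Set.nonempty_iff_ne_empty.2 hne)
  unfold CoxeterTwist.loopNext
  rw [dif_pos hex]
  set r := hex.choose
  have hr : cs.IsRightDescent z r := (h.mem_descents_iff r).1 hex.choose_spec.1
  have hσ : S.σ r = -simpleRoot (MvPolynomial B ℝ) (τ.gen r) ↔
      cs.root z r = -simpleRoot ℝ (τ.gen r) := by
    rw [funext_iff, funext_iff]
    refine forall_congr' fun y => ?_
    rw [h.σ_eq, Pi.neg_apply, Pi.neg_apply, ← C_simpleRoot, ← map_neg]
    exact (MvPolynomial.C_injective B ℝ).eq_iff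
  have hfun : ∀ x, S.σ x = fun y => MvPolynomial.C (cs.root z x y) := fun x =>
    funext fun y => h.σ_eq x y
  obtain ⟨z', hz', hd, hstep, ⟨hroot, -, hz'e⟩ | ⟨hroot, hz'e⟩⟩ := τ.exists_istep_eq h.fits.mem hr
  · rw [if_pos (hσ.2 hroot)]
    refine ⟨z', by rw [← hstep]; exact τ.length_lt_length_istep hz' hd,
      ⟨h.fits.cons hz' hd hstep rfl rfl, rfl, fun x y => ?_⟩,
      Linked.of_cons hX H h.fits hz' hd hstep rfl rfl⟩
    change reflect M (τ.gen r) (S.σ x) y = _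
    rw [hfun, ← C_reflect, hz'e, root_simple_mul, simpleReflection_eq_reflect]
  · rw [if_neg (fun h' => hroot (hσ.1 h'))]
    refine ⟨z', by rw [← hstep]; exact τ.length_lt_length_istep hz' hd,
      ⟨h.fits.cons hz' hd hstep rfl rfl, rfl, fun x y => ?_⟩,
      Linked.of_cons hX H h.fits hz' hd hstep rfl rfl⟩
    change reflect M (τ.gen r) (S.σ x - algebraMap ℝ _ (2 * rootForm M r x) • S.σ r) y = _
    have e : S.σ x - algebraMap ℝ (MvPolynomial B ℝ) (2 * rootForm M r x) • S.σ r =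
        fun y => MvPolynomial.C (cs.root (z * cs.simple r) x y) := by
      ext1 y
      rw [hfun, hfun, root_mul_simple]
      simp only [Pi.sub_apply, Pi.smul_apply, smul_eq_mul, MvPolynomial.algebraMap_eq, map_sub,
        map_mul]
    rw [e, ← C_reflect, hz'e, mul_assoc, root_simple_mul, simpleReflection_eq_reflect]

/-- In a descent-periodic sequence the descents never come to an end. So it cannot be realized by
an element, since the length of an element is finite. -/
theorem ConstNode.not_descentPeriodic {Q : ℕ → BraidSystem B J} {i : ℕ}
    (h : τ.ConstNode s t (Q i) z) : ¬ τ.DescentPeriodic Q i := by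
  rintro ⟨p, q, r, f, lam, hp, hq, hpq, hr1, -, -, -, -, hval, hneg, hrec1, hrec⟩
  have key : ∀ (k : ℕ) (z : W), cs.length z = k → z ∈ τ.twistedInvolutions → ∀ n j, 1 ≤ j →
      j ≤ p → (∀ x : J, lam j (n + 1) x = cs.root z x) → False := by
    intro k
    induction k using Nat.strong_induction_on with
    | _ k ih =>
    intro z hk hz n j hj hjp hlam
    have hd : cs.IsRightDescent z (r (j + 1)) := by
      rw [← isNegVec_root_iff, ← hlam]
      exact (hneg j ⟨hj, hjp⟩).1 (n + 1)
    obtain ⟨z', hz', hd', hstep, hcase⟩ := τ.exists_istep_eq hz hd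
    have hlt : cs.length z' < k := by
      rw [← hk, ← hstep]; exact τ.length_lt_length_istep hz' hd'
    have hb : ∀ x, τ.bulletMap (lam j (n + 1)) (r (j + 1)) x = cs.root z' x := by
      intro x
      unfold bulletMap
      rcases hcase with ⟨hroot, -, hz'e⟩ | ⟨hroot, hz'e⟩
      · rw [if_pos (by rw [hlam, hroot]), hz'e, root_simple_mul, simpleReflection_eq_reflect, hlam]
      · rw [if_neg (by rw [hlam]; exact hroot), hz'e, mul_assoc, root_simple_mul,
          simpleReflection_eq_reflect, root_mul_simple, conjMap, hlam, hlam]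
        rfl
    rcases hjp.eq_or_lt with rfl | hjp'
    · refine ih _ hlt z' rfl hz' (n + 1) 1 le_rfl hp fun x => ?_
      rw [hrec1, ← hb, hr1]
    · refine ih _ hlt z' rfl hz' n (j + 1) (by omega) hjp' fun x => ?_
      rw [hrec n (j + 1) ⟨by omega, hjp'⟩, ← hb, Nat.add_sub_cancel]
  obtain ⟨k, rfl⟩ : ∃ k, q = k + 2 := ⟨q - 2, by omega⟩
  refine key _ z rfl h.fits.mem k p hp le_rfl fun x => funext fun y => ?_
  have h1 := hval p ⟨hp, le_rfl⟩ (k + 1) (by omega) x y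
  have e : i - p * (k + 2) + p + (k + 1) * p = i := by
    have : p * (k + 2) = p + (k + 1) * p := by ring
    omega
  rw [e, h.σ_eq] at h1
  exact (MvPolynomial.C_injective B ℝ h1).symm

/-- On a system realized by an element, the second algorithm has an output, again realized and
without descents, unless it meets a redundant system. -/
theorem ConstNode.exists_output (hX : ∀ R ∈ X, τ.IsSoundPrefixRel R)
    (H : τ.LinkedBefore (generatedEquiv (τ.braidAndHalfBraid ∪ X)) N s t) (o : LinearOrder B)
    (h : τ.ConstNode s t S z) :
    τ.Linked (generatedEquiv (τ.braidAndHalfBraid ∪ X)) N S z ∨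
      ∃ S' z', τ.LoopOutput o S S' ∧ τ.ConstNode s t S' z' ∧
        (∀ r : J, ¬ cs.IsRightDescent z' r) ∧
        (τ.Linked (generatedEquiv (τ.braidAndHalfBraid ∪ X)) N S' z' →
          τ.Linked (generatedEquiv (τ.braidAndHalfBraid ∪ X)) N S z) := by
  have key : ∀ (k i : ℕ) (z : W), cs.length z = k → τ.ConstNode s t (τ.loopSeq o S i) z →
      (∀ j < i, ¬ τ.LoopStops o S j) →
      τ.Linked (generatedEquiv (τ.braidAndHalfBraid ∪ X)) N (τ.loopSeq o S i) z ∨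
        ∃ S' z', τ.LoopOutput o S S' ∧ τ.ConstNode s t S' z' ∧
          (∀ r : J, ¬ cs.IsRightDescent z' r) ∧
          (τ.Linked (generatedEquiv (τ.braidAndHalfBraid ∪ X)) N S' z' →
            τ.Linked (generatedEquiv (τ.braidAndHalfBraid ∪ X)) N (τ.loopSeq o S i) z) := by
    intro k
    induction k using Nat.strong_induction_on with
    | _ k ih =>
    intro i z hk hz hrun
    have hnode := hz.node (ψ := MvPolynomial.eval 0) (fun c => by simp)
    by_cases hred : τ.Redundant (τ.loopSeq o S i)
    · exact Or.inl (hnode.fits.linked_of_redundant hX H hnode.realizes hred)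
    have hrej : ¬ τ.LoopRejects o S i := by
      rintro (h' | h' | h')
      · exact h' (hnode.fits.valid hnode.realizes hnode.feasible)
      · exact hred h'
      · exact hz.not_descentPeriodic h'
    by_cases hdes : (τ.loopSeq o S i).descents = ∅
    · refine Or.inr ⟨_, z, ⟨i, hrun, hrej, hdes, rfl⟩, hz, fun r hr => ?_, fun h' => h'⟩
      have := (hz.mem_descents_iff r).2 hr
      rw [hdes] at this
      exact this
    · obtain ⟨z', hlt, hz', hL⟩ := hz.loopNext hX H o hdes
      have hrun' : ∀ j < i + 1, ¬ τ.LoopStops o S j := by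
        intro j hj
        rcases Nat.lt_succ_iff_lt_or_eq.1 hj with hj | rfl
        · exact hrun j hj
        · rintro (h' | h')
          exacts [hrej h', hdes h']
      rcases ih _ (hk ▸ hlt) (i + 1) z' rfl hz' hrun' with h' | ⟨S', y, h1, h2, h3, h4⟩
      · exact Or.inl (hL h')
      · exact Or.inr ⟨S', y, h1, h2, h3, fun h' => hL (h4 h')⟩
  exact key _ 0 z rfl h (by simp)

end Loop

section Forest

variable {S : BraidSystem B J} {z : W}

theorem abs_det_geom (w : W) : |LinearMap.det (cs.geom w)| = 1 := by
  induction w using cs.simple_induction_left with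
  | one => simp
  | mul_simple_left w s ih =>
    have h1 : LinearMap.det (cs.geom (cs.simple s)) *
        LinearMap.det (cs.geom (cs.simple s)) = 1 := by
      rw [← map_mul, ← map_mul, simple_mul_simple_self, map_one, map_one]
    have h2 : |LinearMap.det (cs.geom (cs.simple s))| = 1 := by
      rw [← sq_eq_sq₀ (abs_nonneg _) zero_le_one, sq_abs, sq, h1, one_pow]
    rw [map_mul, map_mul, abs_mul, ih, h2, mul_one]

theorem map_extForm {ψ : MvPolynomial B ℝ →+* ℝ} (hψ : ∀ c, ψ (MvPolynomial.C c) = c)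
    (u v : B → MvPolynomial B ℝ) :
    ψ (extForm M u v) = extForm M (fun x => ψ (u x)) fun x => ψ (v x) := by
  simp [extForm, map_sum, hψ]

/-- The system `S ↓ r` is realized by `z` if `S` is, for a descent `r` of `z`: the variable `x_s` is
evaluated as the coefficient of `α_s` in the positive root `-z α_r`. -/
theorem ConstNode.extend (h : τ.ConstNode s t S z) {r : B}
    (hr : cs.IsRightDescent z r) :
    τ.Node s t (MvPolynomial.eval fun y => -cs.root z r y) (τ.extend S r) z := by
  set ψ : MvPolynomial B ℝ →+* ℝ := MvPolynomial.eval fun y => -cs.root z r y with hψdef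
  have hψ : ∀ c, ψ (MvPolynomial.C c) = c := fun c => by simp [hψdef]
  have hσ : ∀ (x : ↥(insert r J : Set B)) (y : B), ψ (extendSigma S r x y) = cs.root z x y := by
    intro x y
    unfold extendSigma
    split_ifs with hx
    · rw [h.σ_eq, hψ]
    · have : (x : B) = r := (Set.mem_insert_iff.1 x.2).resolve_right hx
      rw [this, map_neg, hψdef, MvPolynomial.eval_X, neg_neg]
  refine ⟨⟨h.fits.mem, h.fits.asc₁, h.fits.asc₂, h.fits.ifold_eq,
    fun x hx => Set.mem_insert_of_mem r (h.fits.sub₁ x hx),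
    fun x hx => Set.mem_insert_of_mem r (h.fits.sub₂ x hx), h.fits.last₁, h.fits.last₂⟩,
    ⟨hψ, hσ⟩, ?_⟩
  rintro c ((⟨x, rfl⟩ | ⟨x, rfl⟩) | ⟨hall, rfl⟩)
  · change ψ 0 ≤ ψ _
    rw [map_zero, hψdef, MvPolynomial.eval_X, neg_nonneg]
    exact (cs.isNegVec_root_iff.2 hr).2 x
  · change ψ _ = ψ _
    rw [map_extForm hψ, hψ]
    simp only [hσ]
    exact cs.extForm_root_root z r x
  · classical
    change |ψ _| = ψ 1
    rw [map_one, RingHom.map_det]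
    have e : ψ.mapMatrix (Matrix.of fun x y : B => extendSigma S r ⟨x, hall x⟩ y) =
        (LinearMap.toMatrix' (cs.geom z)).transpose := by
      ext x y
      rw [RingHom.mapMatrix_apply, Matrix.map_apply, Matrix.of_apply, hσ, Matrix.transpose_apply,
        LinearMap.toMatrix'_apply, root]
      have hx : simpleRoot ℝ x = Pi.single x 1 := by
        ext w
        by_cases hw : w = x <;> simp [simpleRoot, hw]
      rw [hx]
    rw [e, Matrix.det_transpose, LinearMap.det_toMatrix']
    exact abs_det_geom z

/-- Every vertex of the forest is linked for all elements by which it is realized. -/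
theorem linked_of_forestVertex (hX : ∀ R ∈ X, τ.IsSoundPrefixRel R)
    (H : τ.LinkedBefore (generatedEquiv (τ.braidAndHalfBraid ∪ X)) N s t) (o : LinearOrder B)
    (hF : τ.ForestExists o s t)
    (hrel : ∀ R ∈ τ.forestRelations o s t, ∀ a b, τ.Ascends 1 a → τ.Ascends 1 b → R a b →
      generatedEquiv (τ.braidAndHalfBraid ∪ X) a b)
    (J : Set B) (S : BraidSystem B J) (hS : τ.ForestVertex o s t J S) (z : W)
    (h : τ.ConstNode s t S z) (hd : ∀ r : J, ¬ cs.IsRightDescent z r) :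
    τ.Linked (generatedEquiv (τ.braidAndHalfBraid ∪ X)) N S z := by
  have h1 := τ.one_mem_twistedInvolutions
  induction hk : (Jᶜ).ncard using Nat.strong_induction_on generalizing J z with
  | _ k ih =>
  by_cases hz1 : z = 1
  · subst hz1
    intro u hu huz hN
    have hu0 : u = [] := List.eq_nil_of_length_eq_zero
      (τ.length_eq_of_ascends h1 hu (b := []) trivial huz)
    subst hu0
    have hw₁ := τ.mem_involutionWords_iff.2 ⟨h.fits.asc₁, rfl⟩
    have hw₂ := τ.mem_involutionWords_iff.2 ⟨h.fits.asc₂, h.fits.ifold_eq.symm⟩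
    refine hrel (prefixRel S.word₁ S.word₂) ⟨J, S, hS, ⟨⟨_, τ.ifold_mem h1 _, hw₁, hw₂⟩,
      fun x => ?_⟩, rfl⟩ _ _ h.fits.asc₁ h.fits.asc₂ ⟨[], by simp⟩
    ext1 y
    rw [h.σ_eq, root_one, C_simpleRoot]
  obtain ⟨r, hr⟩ := cs.exists_rightDescent_of_ne_one hz1
  have hrJ : r ∉ J := fun hrJ => hd ⟨r, hrJ⟩ hr
  by_cases hb : r ∈ coxBoundary M J
  · have hnode := h.extend hr
    have hext : τ.Linked (generatedEquiv (τ.braidAndHalfBraid ∪ X)) N (τ.extend S r) z →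
        τ.Linked (generatedEquiv (τ.braidAndHalfBraid ∪ X)) N S z := fun hL => hL
    rcases hnode.exists_leaf hX H o (hF J S hS r hb).1 with hL | ⟨L, y, hleaf, hconst, hLn, hL⟩
    · exact hext hL
    rcases (hLn.constNode hconst).exists_output hX H o with hL' | ⟨S', y', hout, hS', hd', hL'⟩
    · exact hext (hL hL')
    refine hext (hL (hL' ?_))
    refine ih _ ?_ _ S' (.child J S r L S' hS hb hleaf hconst hout) y' hS' hd' rfl
    rw [← hk]
    refine Set.ncard_lt_ncard ?_ (Set.toFinite _)
    refine ⟨fun x hx hxJ => hx (Set.mem_insert_of_mem r hxJ), fun hsub => ?_⟩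
    exact hsub hrJ (Set.mem_insert r J)
  -- A descent that commutes with all letters of the words can be moved to the end of both words.
  · intro u hu huz hN
    have hcomm : ∀ x ∈ J, M r x = 2 := by
      intro x hx
      have h2 : ¬ (M r x = 0 ∨ 2 < M r x) := fun h' => hb ⟨hrJ, x, hx, h'⟩
      have h3 : M r x ≠ 1 := M.off_diagonal r x (by rintro rfl; exact hrJ hx)
      omega
    obtain ⟨y, hy, hyd, hstep, -⟩ := τ.exists_istep_eq h.fits.mem hr
    obtain ⟨v, hv, hvy⟩ := τ.exists_ascends hy
    have hvr : τ.Ascends 1 (v ++ [r]) := by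
      rw [ascends_append, ascends_singleton, hvy]; exact ⟨hv, hyd⟩
    have hvrz : τ.ifold 1 (v ++ [r]) = z := by rw [ifold_append, hvy]; exact hstep
    have hlen := τ.length_eq_of_ascends h1 hu hvr (huz.trans hvrz.symm)
    have hpos := List.length_pos_of_ne_nil h.fits.word_ne_nil
    have hE := H.of_length_lt u (v ++ [r]) hu hvr (huz.trans hvrz.symm) (by omega)
    have key : ∀ w : List B, (∀ x ∈ w, x ∈ J) → τ.Ascends z w → u.length + w.length = N →
        generatedEquiv (τ.braidAndHalfBraid ∪ X) (u ++ w) (v ++ w ++ [r]) ∧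
          τ.Ascends 1 (v ++ w ++ [r]) ∧ τ.ifold 1 (v ++ w ++ [r]) = τ.ifold z w := by
      intro w hw hzw hl
      have e1 := generatedEquiv_append hX hE w
      rw [List.append_assoc, List.singleton_append] at e1
      have e2 := e1.trans _ _ _
        (generatedEquiv_commute (τ := τ) (X := X) (fun x hx => hcomm x (hw x hx)) v)
      obtain ⟨e3, e4⟩ := generatedEquiv_sound hX e2
      have e5 : τ.Ascends 1 (u ++ w) := by rw [ascends_append, huz]; exact ⟨hu, hzw⟩
      refine ⟨e2, τ.ascends_of_length_le h1 e5 e3.symm e4.ge, ?_⟩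
      rw [← e3, ifold_append, huz]
    obtain ⟨a1, a2, a3⟩ := key _ h.fits.sub₁ h.fits.asc₁ hN
    obtain ⟨b1, b2, b3⟩ := key _ h.fits.sub₂ h.fits.asc₂ (by rw [← S.length_eq, hN])
    have := H.of_last_eq hX a2 b2 (by rw [a3, b3, h.fits.ifold_eq])
      (by simp at hlen ⊢; omega)
    exact (a1.trans _ _ _ this).trans _ _ _ b1.symm

end Forest

end CoxeterTwist

namespace CoxeterTwist

open CoxeterSystem

/-! ### Involution words of the same element are equivalent -/

section Main

variable {B W : Type*} [Group W] {M : CoxeterMatrix B} {cs : CoxeterSystem M W}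
  {τ : CoxeterTwist cs}

theorem generatedEquiv_of_connects {L : List (WordRel B)} {Y : Set (WordRel B)}
    (hL : ∀ Q ∈ L, Q ∈ Y) {a b : List B} (h : τ.Connects L a b) : generatedEquiv Y a b := by
  induction L generalizing a with
  | nil => rw [show a = b from h]; exact Relation.EqvGen.refl _
  | cons R L ih =>
    obtain ⟨c, -, hR, hc⟩ := h
    exact (Relation.EqvGen.rel _ _ ⟨R, hL R (by simp), hR⟩).trans _ _ _
      (ih (fun Q hQ => hL Q (by simp [hQ])) hc)

variable [Fintype B] {X : Set (WordRel B)} {N : ℕ} {s t : B}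

/-- Any involution word with last letter `x` is equivalent to one which ends in a given
alternating word with last letter `x`. -/
theorem LinkedBefore.of_alternatingWord (hX : ∀ R ∈ X, τ.IsSoundPrefixRel R)
    (H : τ.LinkedBefore (generatedEquiv (τ.braidAndHalfBraid ∪ X)) N s t) {x y : B}
    {a v : List B} {n : ℕ} (ha : τ.Ascends 1 (a ++ [x])) (hv : τ.Ascends 1 v)
    (hvn : τ.Ascends (τ.ifold 1 v) (alternatingWord y x (n + 1)))
    (h : τ.ifold (τ.ifold 1 v) (alternatingWord y x (n + 1)) = τ.ifold 1 (a ++ [x]))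
    (hN : a.length + 1 = N) :
    generatedEquiv (τ.braidAndHalfBraid ∪ X) (a ++ [x]) (v ++ alternatingWord y x (n + 1)) := by
  have e : v ++ alternatingWord y x (n + 1) = v ++ alternatingWord x y n ++ [x] := by
    rw [alternatingWord_succ, List.concat_eq_append, List.append_assoc]
  have hb : τ.Ascends 1 (v ++ alternatingWord y x (n + 1)) := τ.ascends_append.2 ⟨hv, hvn⟩
  rw [← ifold_append] at h
  rw [e] at hb h ⊢
  exact H.of_last_eq hX ha hb h.symm hN

/-- The case that `s` and `t` commute and are exchanged by `z`, up to `*`. If `z = 1`, this is a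
half-braid relation. Otherwise a descent `r` of `z` is a third descent of the element, and both
words are compared with a word which ends in `r`. -/
theorem LinkedBefore.of_commute (hX : ∀ R ∈ X, τ.IsSoundPrefixRel R)
    (H : τ.LinkedBefore (generatedEquiv (τ.braidAndHalfBraid ∪ X)) N s t) (hM : M s t = 2) {z : W}
    (hz : z ∈ τ.twistedInvolutions) (hs : cs.root z s = simpleRoot ℝ (τ.gen t))
    (ht : cs.root z t = simpleRoot ℝ (τ.gen s)) (he : τ.istep z s = τ.istep z t) {u : List B}
    (hu : τ.Ascends 1 u) (huz : τ.ifold 1 u = z) (hN : u.length + 1 = N) :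
    generatedEquiv (τ.braidAndHalfBraid ∪ X) (u ++ [s]) (u ++ [t]) := by
  have h1 := τ.one_mem_twistedInvolutions
  have hst : s ≠ t := by
    rintro rfl
    rw [M.diagonal] at hM
    omega
  have hds : ¬ cs.IsRightDescent z s := cs.isPosVec_root_iff.1 (hs ▸ isPosVec_simpleRoot _)
  have hdt : ¬ cs.IsRightDescent z t := cs.isPosVec_root_iff.1 (ht ▸ isPosVec_simpleRoot _)
  have hua : ∀ x, ¬ cs.IsRightDescent z x → τ.Ascends 1 (u ++ [x]) := fun x hx => by
    rw [ascends_append, ascends_singleton, huz]; exact ⟨hu, hx⟩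
  have huf : ∀ x, τ.ifold 1 (u ++ [x]) = τ.istep z x := fun x => by
    rw [ifold_append, huz]; rfl
  by_cases hz1 : z = 1
  · have hu0 : u = [] := List.eq_nil_of_length_eq_zero
      (τ.length_eq_of_ascends h1 hu (b := []) trivial (huz.trans hz1))
    subst hu0
    have hw : ∀ x, ¬ cs.IsRightDescent z x → τ.istep z x = τ.istep z s →
        [x] ∈ τ.involutionWords (τ.istep z s) := fun x hx hxs =>
      τ.mem_involutionWords_iff.2 ⟨hua x hx, (huf x).trans hxs⟩
    exact Relation.EqvGen.rel _ _ ⟨_, Or.inl (Or.inr ⟨s, t, 1, le_rfl, by omega,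
      ⟨_, τ.istep_mem hz s, hw s hds rfl, hw t hdt he.symm⟩, rfl⟩), [], Or.inl ⟨rfl, rfl⟩⟩
  obtain ⟨r, hr⟩ := cs.exists_rightDescent_of_ne_one hz1
  have hrs : r ≠ s := by rintro rfl; exact hds hr
  have hrt : r ≠ t := by rintro rfl; exact hdt hr
  have hgst : τ.gen s ≠ τ.gen t := fun h => hst (τ.gen_injective h)
  have hneg := cs.isNegVec_root_iff.2 hr
  -- Otherwise `z α_r` would be a combination of `z α_s` and `z α_t`.
  have hx : ∃ x, x ≠ τ.gen s ∧ x ≠ τ.gen t ∧ cs.root z r x < 0 := by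
    by_contra! hx
    have h2 := eq_smul_add_smul hgst (v := cs.root z r) fun x hxs hxt =>
      le_antisymm (hneg.2 x) (hx x hxs hxt)
    rw [← hs, ← ht, root, root, root, ← map_smul, ← map_smul, ← map_add] at h2
    have h3 := congrFun (cs.geom_injective z h2) r
    simp [simpleRoot, hrs, hrt] at h3
  obtain ⟨x, hxs, hxt, hxr⟩ := hx
  have hw : cs.IsRightDescent (τ.istep z s) r := by
    refine cs.isRightDescent_of_root_neg x ?_
    rw [τ.istep_of_root_ne hz hds
      (by rw [hs]; exact fun h => hgst (simpleRoot_injective h).symm), root_mul_simple,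
      root_simple_mul, root_simple_mul, Pi.sub_apply, Pi.smul_apply,
      simpleReflection_apply_of_ne M hxs, simpleReflection_apply_of_ne M hxs, hs,
      simpleRoot_of_ne ℝ hxt]
    simpa using hxr
  obtain ⟨y, hy, hyd, hyr, -⟩ := τ.exists_istep_eq (τ.istep_mem hz s) hw
  obtain ⟨c, hc, hcy⟩ := τ.exists_ascends hy
  have hca : τ.Ascends 1 (c ++ [r]) := by
    rw [ascends_append, ascends_singleton, hcy]; exact ⟨hc, hyd⟩
  have hcf : τ.ifold 1 (c ++ [r]) = τ.istep z s := by rw [ifold_append, hcy]; exact hyr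
  have key : ∀ x, r ≠ x → ¬ cs.IsRightDescent z x → τ.istep z x = τ.istep z s →
      generatedEquiv (τ.braidAndHalfBraid ∪ X) (u ++ [x]) (c ++ [r]) := by
    intro x hrx hxd hxe
    have hf : τ.ifold 1 (u ++ [x]) = τ.ifold 1 (c ++ [r]) := by rw [huf, hxe, hcf]
    have hwx : cs.IsRightDescent (τ.istep z s) x := hxe ▸ τ.isRightDescent_istep z x
    have hlen : u.length + 1 = c.length + 1 := by
      simpa using τ.length_eq_of_ascends h1 (hua x hxd) hca hf
    rcases (two_le_of_ne M hrx.symm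
      (cs.matrix_ne_zero_of_isRightDescent hrx.symm hwx hw)).eq_or_lt with h2 | h2
    · obtain ⟨y, hy, n, ha1, ha2, hf1, hf2, hn⟩ :=
        τ.exists_dihedral_decomposition (τ.istep_mem hz s) hrx.symm hwx hw
      obtain ⟨v, hv, rfl⟩ := τ.exists_ascends hy
      obtain rfl | rfl : n = 0 ∨ n = 1 := by rcases hn with hn | ⟨hn, -⟩ <;> omega
      -- Here `y = z`, of which `r` is a descent.
      · have hyx : ¬ cs.IsRightDescent (τ.ifold 1 v) x := τ.ascends_singleton.1 ha1
        have := τ.istep_cancel hy hz hyx hxd (hf1.trans hxe.symm)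
        rw [← this] at hr
        exact absurd hr (τ.ascends_singleton.1 ha2)
      · have e1 := H.of_alternatingWord hX (hua x hxd) hv ha1 (by rw [hf1, huf, hxe]) hN
        have e2 := H.of_alternatingWord hX hca hv ha2 (by rw [hf2, hcf]) (hlen ▸ hN)
        have e3 := generatedEquiv_alternatingWord (τ := τ) (X := X) (s := x) (t := r) (by omega) v
        rw [← h2] at e3
        exact (e1.trans _ _ _ e3).trans _ _ _ e2.symm
    · exact H.of_matrix_lt x r (by rwa [hM]) u c (hua x hxd) hca hf hN
  exact (key s hrs hds rfl).trans _ _ _ (key t hrt hdt he.symm).symm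

/-- The inductive step: two involution words of the same element, with last letters `s` and `t`,
are equivalent. -/
theorem LinkedBefore.linked (hX : ∀ R ∈ X, τ.IsSoundPrefixRel R)
    (H : τ.LinkedBefore (generatedEquiv (τ.braidAndHalfBraid ∪ X)) N s t) (o : LinearOrder B)
    (hF : 2 < M s t → τ.ForestExists o s t)
    (hrel : 2 < M s t → ∀ R ∈ τ.forestRelations o s t, ∀ a b, τ.Ascends 1 a → τ.Ascends 1 b →
      R a b → generatedEquiv (τ.braidAndHalfBraid ∪ X) a b)
    {a b : List B} (ha : τ.Ascends 1 (a ++ [s])) (hb : τ.Ascends 1 (b ++ [t]))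
    (h : τ.ifold 1 (a ++ [s]) = τ.ifold 1 (b ++ [t])) (hN : a.length + 1 = N) :
    generatedEquiv (τ.braidAndHalfBraid ∪ X) (a ++ [s]) (b ++ [t]) := by
  have h1 := τ.one_mem_twistedInvolutions
  have hlen : a.length + 1 = b.length + 1 := by simpa using τ.length_eq_of_ascends h1 ha hb h
  by_cases hst : s = t
  · subst hst
    exact H.of_last_eq hX ha hb h hN
  have hws : cs.IsRightDescent (τ.ifold 1 (a ++ [s])) s := by
    rw [ifold_append]; exact τ.isRightDescent_istep _ s
  have hwt : cs.IsRightDescent (τ.ifold 1 (a ++ [s])) t := by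
    rw [h, ifold_append]; exact τ.isRightDescent_istep _ t
  have hM2 := two_le_of_ne M hst (cs.matrix_ne_zero_of_isRightDescent hst hws hwt)
  obtain ⟨z, hz, n, ha1, ha2, hf1, hf2, hn⟩ :=
    τ.exists_dihedral_decomposition (τ.ifold_mem h1 _) hst hws hwt
  obtain ⟨v, hv, hvz⟩ := τ.exists_ascends hz
  have e1 := H.of_alternatingWord hX ha hv (hvz ▸ ha1) (by rw [hvz, hf1]) hN
  have e2 := H.of_alternatingWord hX hb hv (hvz ▸ ha2) (by rw [hvz, hf2, h]) (hlen ▸ hN)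
  refine (e1.trans _ _ _ ?_).trans _ _ _ e2.symm
  have hvN : v.length + (n + 1) = N := by
    have := (generatedEquiv_sound hX e1).2
    simp at this
    omega
  rcases hn with hn | ⟨hn, θ, hθ, hrs, hrt, hnθ⟩
  · have := generatedEquiv_alternatingWord (τ := τ) (X := X) (s := s) (t := t) (by omega) v
    rwa [← hn] at this
  have hds : ¬ cs.IsRightDescent z s := cs.isPosVec_root_iff.1 (hrs ▸ isPosVec_simpleRoot _)
  have hdt : ¬ cs.IsRightDescent z t := cs.isPosVec_root_iff.1 (hrt ▸ isPosVec_simpleRoot _)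
  rcases hM2.eq_or_lt with h2 | h2
  · obtain rfl : n = 0 := by omega
    rcases bijOn_pair hst hθ with ⟨hθs, hθt⟩ | ⟨hθs, hθt⟩
    · simp [mTheta, ← h2, hθs, hθt] at hnθ
    · rw [hθs] at hrs
      rw [hθt] at hrt
      exact H.of_commute hX h2.symm hz hrs hrt (hf1.trans hf2.symm) hv hvz hvN
  · have hlast : ∀ x y : B, (alternatingWord y x (n + 1)).getLast? = some x := fun x y => by
      rw [alternatingWord_succ, List.concat_eq_append, List.getLast?_append]; rfl
    have hmem : ∀ x y : B, ∀ w ∈ alternatingWord x y (n + 1), w = x ∨ w = y := by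
      intro x y w hw
      rw [alternatingWord_eq_altWord] at hw
      split_ifs at hw
      exacts [mem_altWord hw, (mem_altWord hw).symm]
    have hw₁ : (τ.rootSystem s t θ).word₁ = alternatingWord t s (n + 1) := by rw [hnθ]; rfl
    have hw₂ : (τ.rootSystem s t θ).word₂ = alternatingWord s t (n + 1) := by rw [hnθ]; rfl
    have hnode : τ.ConstNode s t (τ.rootSystem s t θ) z := by
      refine ⟨⟨hz, hw₁ ▸ ha1, hw₂ ▸ ha2, by rw [hw₁, hw₂, hf1, hf2], ?_, ?_, ?_, ?_⟩, rfl, ?_⟩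
      · rw [hw₁]; exact fun x hx => (hmem t s x hx).symm
      · rw [hw₂]; exact hmem s t
      · rw [hw₁]; exact hlast s t
      · rw [hw₂]; exact hlast t s
      · rintro ⟨x, rfl | rfl⟩ y
        · rw [hrs, C_simpleRoot]; rfl
        · rw [hrt, C_simpleRoot]; rfl
    have hL := linked_of_forestVertex hX H o (hF h2) (hrel h2) _ _ (.root θ hθ) z hnode (by
      rintro ⟨x, rfl | rfl⟩ <;> assumption) v hv hvz (by rw [hw₁]; simpa using hvN)
    rwa [hw₁, hw₂] at hL

/-- The double induction: on the number of letters, and for a given number of letters downwards on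
`m(s,t)`, where `s` and `t` are the last letters. -/
theorem generatedEquiv_of_ifold_eq (hX : ∀ R ∈ X, τ.IsSoundPrefixRel R)
    (ord : B → B → LinearOrder B) (hF : ∀ s t : B, 2 < M s t → τ.ForestExists (ord s t) s t)
    (hrel : ∀ R ∈ τ.inducedRelations ord, ∀ a b, τ.Ascends 1 a → τ.Ascends 1 b →
      R a b → generatedEquiv (τ.braidAndHalfBraid ∪ X) a b)
    {a b : List B} (ha : τ.Ascends 1 a) (hb : τ.Ascends 1 b) (h : τ.ifold 1 a = τ.ifold 1 b) :
    generatedEquiv (τ.braidAndHalfBraid ∪ X) a b := by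
  have h1 := τ.one_mem_twistedInvolutions
  obtain ⟨K, hK⟩ : ∃ K, ∀ s t, M s t ≤ K :=
    ⟨Finset.univ.sup fun p : B × B => M p.1 p.2, fun s t =>
      Finset.le_sup (f := fun p : B × B => M p.1 p.2) (Finset.mem_univ (s, t))⟩
  induction hl : a.length using Nat.strong_induction_on generalizing a b with
  | _ N ihN =>
  have hlen := τ.length_eq_of_ascends h1 ha hb h
  have key : ∀ k s t, K - M s t = k → ∀ a b, τ.Ascends 1 (a ++ [s]) → τ.Ascends 1 (b ++ [t]) →
      τ.ifold 1 (a ++ [s]) = τ.ifold 1 (b ++ [t]) → a.length + 1 = N →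
      generatedEquiv (τ.braidAndHalfBraid ∪ X) (a ++ [s]) (b ++ [t]) := by
    intro k
    induction k using Nat.strong_induction_on with
    | _ k ihk =>
    intro s t hk a b ha hb h hN
    refine LinkedBefore.linked hX ⟨fun a b ha hb h hlt => ihN _ hlt ha hb h rfl,
      fun s' t' hlt => ihk (K - M s' t') ?_ s' t' rfl⟩ (ord s t) (hF s t)
      (fun hM R hR => hrel R ⟨s, t, hM, hR⟩) ha hb h hN
    have := hK s' t'
    omega
  rcases List.eq_nil_or_concat a with rfl | ⟨a', s, rfl⟩
  · have hb0 : b = [] := List.eq_nil_of_length_eq_zero hlen.symm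
    subst hb0
    exact Relation.EqvGen.refl _
  rcases List.eq_nil_or_concat b with rfl | ⟨b', t, rfl⟩
  · simp at hlen
  simp only [List.concat_eq_append] at *
  exact key _ s t rfl a' b' ha hb h (by simpa using hl)

end Main

end CoxeterTwist

theorem mainTheorem4 {B W : Type*} [Fintype B] [Group W] {M : CoxeterMatrix B}
    (cs : CoxeterSystem M W) (τ : CoxeterTwist cs)
    (ord : B → B → LinearOrder B)
    (hF : ∀ s t : B, 2 < M s t → τ.ForestExists (ord s t) s t)
    (Rmin : Set (WordRel B)) (hR : τ.IsReducedInducedSet ord Rmin) :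
    ∀ w ∈ τ.twistedInvolutions, ∃ a : List B,
      τ.involutionWords w = {b | generatedEquiv (τ.braidAndHalfBraid ∪ Rmin) a b} := by
  intro w hw
  obtain ⟨hsub, himp⟩ := hR.1
  have hX : ∀ R ∈ Rmin, τ.IsSoundPrefixRel R := fun R h =>
    τ.isSoundPrefixRel_of_inducedRelations (hsub h)
  have hrel : ∀ R ∈ τ.inducedRelations ord, ∀ a b, τ.Ascends 1 a → τ.Ascends 1 b → R a b →
      generatedEquiv (τ.braidAndHalfBraid ∪ Rmin) a b := by
    intro R h a b ha hb hab
    obtain ⟨L, hL, hconn⟩ := himp R h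
    exact CoxeterTwist.generatedEquiv_of_connects hL
      (hconn a b (τ.isInvolutionWord_iff.2 ha) (τ.isInvolutionWord_iff.2 hb) hab)
  obtain ⟨a, ha, haw⟩ := τ.exists_ascends hw
  refine ⟨a, Set.ext fun b => ?_⟩
  rw [τ.mem_involutionWords_iff, Set.mem_ofPred_eq]
  constructor
  · rintro ⟨hb, hbw⟩
    exact CoxeterTwist.generatedEquiv_of_ifold_eq hX ord hF hrel ha hb (haw.trans hbw.symm)
  · intro h
    obtain ⟨h1, h2⟩ := CoxeterTwist.generatedEquiv_sound hX h
    exact ⟨τ.ascends_of_length_le τ.one_mem_twistedInvolutions ha h1.symm h2.ge,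
      h1.symm.trans haw⟩
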